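/- **Setting.** Let $X_1,X_2,\dots$ be i.i.d. with distribution function $F_0$ on $[0,\infty)$ and, independently, $T_1,T_2,\dots$ i.i.d. with distribution function $G$ with Lebesgue density $g$ on $[0,\infty)$. One observes $(T_j,\Delta_j)$, $\Delta_j=1_{\{X_j\le T_j\}}$. Assume: * (F.1) $F_0$ has support $[0,M_0]$, is strictly increasing there, and has a density $f_0$ that is bounded away from zero on $[0,M_0]$. * (G.1) $G$ has support $[0,\infty)$, is strictly increasing on $[0,M_0]$, and its density $g$ is bounded away from zero on $[0,M_0]$ and differentiable on $[0,M_0]$ (one-sidedly at the end points) with bounded derivative $g'$ there. * (K.1) $k$ is a probability density with support $[-1,1]$, symmetric, and twice continuously differentiable on $\mathbb R$. Put $m_2(k)=\int u^2k(u)\,du$. For a bandwidth $h>0$ and $i\in\{0,1\}$ let $$\hat g_{n,i}(t)=\frac1n\sum_{j\le n,\ \Delta_j=i}\frac1h\,k\Big(\frac{t-T_j}{h}\Big)\quad(t>h),$$ and for $0\le t\le h$ let $\hat g_{n,i}(t)$ be given by the same formula with $k$ replaced by the boundary kernel $k^{\beta}$, $\beta=t/h$, where $$k^\beta(u)=\frac{\nu_{2,\beta}-\nu_{1,\beta}u}{\nu_{0,\beta}\nu_{2,\beta}-\nu_{1,\beta}^2}\,k(u)1_{(-1,\beta)}(u),\qquad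 \nu_{l,\beta}=\int_{-1}^{\beta}u^lk(u)\,du .$$ Let $\hat g_n=\hat g_{n,0}+\hat g_{n,1}$, $\hat G_{n,1}(t)=\int_0^t\hat g_{n,1}$, $\hat G_n(t)=\int_0^t\hat g_n$ and $\tau=\sup\{t\ge0:\hat g_n(t)>0\}$. The naive estimator of $F_0$ is $\hat F_n^{\mathrm{naive}}=\hat g_{n,1}/\hat g_n$. The maximum smoothed likelihood estimator $\hat F_n^{\mathrm{MS}}(t)$ is the right-hand slope, at the point with abscissa $\hat G_n(t)$, of the lower convex hull of the curve $s\mapsto(\hat G_n(s),\hat G_{n,1}(s))$, $s\in[0,\tau]$. **Theorem.** Fix $t>0$ such that $f_0''$ and $g''$ exist in a neighbourhood of $t$ and are continuous at $t$, and $g(t)f_0'(t)+2f_0(t)g'(t)\neq0$. 1. For every $c>0$, if the bandwidth is $h=cn^{-1/5}$, then, as $n\to\infty$, $$n^{2/5}\big(\hat F_n^{\mathrm{MS}}(t)-F_0(t)\big)\rightsquigarrow\mathcal N\big(\mu(c),\sigma^2(c)\big),$$ where $$\mu(c)=\tfrac12c^2m_2(k)\Big\{f_0'(t)+2\frac{f_0(t)g'(t)}{g(t)}\Big\},\qquad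 \sigma^2(c)=c^{-1}\,\frac{F_0(t)(1-F_0(t))}{g(t)}\int k(u)^2\,du .$$ 2. The same holds with $\hat F_n^{\mathrm{naive}}$ in place of $\hat F_n^{\mathrm{MS}}$. 3. Let $\mathrm{aMSE}(c)$ be the second moment of the limit law $\mathcal N(\mu(c),\sigma^2(c))$. Then $$\mathrm{aMSE}(c)=\tfrac14c^4m_2(k)^2\Big\{f_0'(t)+2\frac{f_0(t)g'(t)}{g(t)}\Big\}^2+c^{-1}\frac{F_0(t)(1-F_0(t))}{g(t)}\int k(u)^2\,du ,$$ and the asymptotically MSE-optimal bandwidth is $c_{F,\mathrm{MS}}\,n^{-1/5}$, i.e. $\mathrm{aMSE}$ attains its minimum over $c\in(0,\infty)$ exactly at $$c_{F,\mathrm{MS}}=\Big\{\frac{F_0(t)(1-F_0(t))}{g(t)}\int k(u)^2\,du\Big\}^{1/5}\Big\{m_2(k)^2\Big\{f_0'(t)+2\frac{f_0(t)g'(t)}{g(t)}\Big\}^2\Big\}^{-1/5}>0 .$$ -/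

import Mathlib

open MeasureTheory ProbabilityTheory Filter Topology

/-- The observation `(T, Δ)` with `Δ = 1_{X ≤ T}`. -/
noncomputable def observation (x t : ℝ) : ℝ × Fin 2 := (t, if x ≤ t then 1 else 0)

/-- The sampling scheme of the current status model: `X 0, X 1, …` are i.i.d. with law `μX`,
`T 0, T 1, …` are i.i.d. with law `μT`, and the two sequences are independent. -/
structure IsCurrentStatusModel {Ω : Type*} [MeasurableSpace Ω] (P : Measure Ω)
    (X T : ℕ → Ω → ℝ) (μX μT : Measure ℝ) : Prop where
  measurable_X : ∀ j, Measurable (X j)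
  measurable_T : ∀ j, Measurable (T j)
  law_X : ∀ j, P.map (X j) = μX
  law_T : ∀ j, P.map (T j) = μT
  indep_X : iIndepFun X P
  indep_T : iIndepFun T P
  indep_X_T : IndepFun (fun ω j => X j ω) (fun ω j => T j ω) P

/-- `f` is a (Lebesgue) density of the measure `μ` on the real line. -/
structure IsDensity (μ : Measure ℝ) (f : ℝ → ℝ) : Prop where
  measurable : Measurable f
  nonneg : ∀ x, 0 ≤ f x
  eq_withDensity : μ = volume.withDensity (fun x => ENNReal.ofReal (f x))

/-- The condition on the law `μX` of the event times: support `[0, M₀]`, distribution function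
strictly increasing there, and a density `f₀` that is bounded away from zero there. -/
structure ConditionF (μX : Measure ℝ) (f₀ : ℝ → ℝ) (M₀ : ℝ) : Prop where
  density : IsDensity μX f₀
  support_eq : μX.support = Set.Icc 0 M₀
  strictMonoOn_cdf : StrictMonoOn (fun x => cdf μX x) (Set.Icc 0 M₀)
  away_from_zero : ∃ ε > 0, ∀ x ∈ Set.Icc 0 M₀, ε ≤ f₀ x

/-- The condition on the law `μT` of the observation times: support `[0, ∞)`, distribution
function strictly increasing on `[0, M₀]`, and a density `g` that on `[0, M₀]` is bounded away
from zero and has a bounded derivative (one-sided at the end points). -/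
structure ConditionG (μT : Measure ℝ) (g : ℝ → ℝ) (M₀ : ℝ) : Prop where
  density : IsDensity μT g
  support_eq : μT.support = Set.Ici 0
  strictMonoOn_cdf : StrictMonoOn (fun x => cdf μT x) (Set.Icc 0 M₀)
  away_from_zero : ∃ ε > 0, ∀ x ∈ Set.Icc 0 M₀, ε ≤ g x
  differentiableOn : DifferentiableOn ℝ g (Set.Icc 0 M₀)
  bounded_deriv : ∃ C, ∀ x ∈ Set.Icc 0 M₀, |derivWithin g (Set.Icc 0 M₀) x| ≤ C

/-- The condition on the kernel: a symmetric probability density with support `[-1, 1]` that is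
twice continuously differentiable on the real line. -/
structure ConditionK (k : ℝ → ℝ) : Prop where
  nonneg : ∀ u, 0 ≤ k u
  integral_eq_one : ∫ u, k u = 1
  support_eq : tsupport k = Set.Icc (-1) 1
  symmetric : ∀ u, k (-u) = k u
  contDiff : ContDiff ℝ 2 k

/-- The second derivative of `f` exists (in a neighbourhood of `t`) and is continuous at `t`. -/
def HasContinuousSecondDerivAt (f : ℝ → ℝ) (t : ℝ) : Prop :=
  (∀ᶠ x in 𝓝 t, DifferentiableAt ℝ f x ∧ DifferentiableAt ℝ (deriv f) x) ∧
    ContinuousAt (deriv (deriv f)) t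

/-- The second moment `m₂(k) = ∫ u² k(u) du`. -/
noncomputable def secondMoment (k : ℝ → ℝ) : ℝ := ∫ u, u ^ 2 * k u

/-- The truncated moment `ν_{i,β}(k)`, the integral of `uⁱ k(u)` over `[-1, β]`. -/
noncomputable def truncMoment (k : ℝ → ℝ) (i : ℕ) (β : ℝ) : ℝ :=
  ∫ u in (-1 : ℝ)..β, u ^ i * k u

/-- The boundary kernel `k^β`. -/
noncomputable def boundaryKernel (k : ℝ → ℝ) (β u : ℝ) : ℝ :=
  (Set.Ioo (-1) β).indicator
    (fun v => (truncMoment k 2 β - truncMoment k 1 β * v) /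
      (truncMoment k 0 β * truncMoment k 2 β - truncMoment k 1 β ^ 2) * k v) u

/-- The integral of `φ` with respect to the empirical subdistribution of those among the first
`n` observation times whose indicator `Δ` equals `i`. -/
noncomputable def empiricalIntegral (z : ℕ → ℝ × Fin 2) (n : ℕ) (i : Fin 2) (φ : ℝ → ℝ) : ℝ :=
  (1 / (n : ℝ)) * ∑ j ∈ Finset.range n, if (z j).2 = i then φ (z j).1 else 0

/-- The kernel subdensity estimator `ĝ_{n,i}` with kernel `k` and bandwidth `h`, using the
boundary kernel `k^{t/h}` on `[0, h]`. -/
noncomputable def subdensityEst (k : ℝ → ℝ) (h : ℝ) (z : ℕ → ℝ × Fin 2) (n : ℕ) (i : Fin 2)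
    (t : ℝ) : ℝ :=
  if 0 ≤ t ∧ t ≤ h then
    empiricalIntegral z n i (fun u => 1 / h * boundaryKernel k (t / h) ((t - u) / h))
  else
    empiricalIntegral z n i (fun u => 1 / h * k ((t - u) / h))

/-- The kernel density estimator `ĝ_n = ĝ_{n,0} + ĝ_{n,1}`. -/
noncomputable def densityEst (k : ℝ → ℝ) (h : ℝ) (z : ℕ → ℝ × Fin 2) (n : ℕ) (t : ℝ) : ℝ :=
  subdensityEst k h z n 0 t + subdensityEst k h z n 1 t

/-- `Ĝ_{n,i}(t)`, the integral of `ĝ_{n,i}` over `[0, t]`. -/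
noncomputable def subdistributionEst (k : ℝ → ℝ) (h : ℝ) (z : ℕ → ℝ × Fin 2) (n : ℕ) (i : Fin 2)
    (t : ℝ) : ℝ :=
  ∫ u in (0 : ℝ)..t, subdensityEst k h z n i u

/-- `Ĝ_n(t)`, the integral of `ĝ_n` over `[0, t]`. -/
noncomputable def distributionEst (k : ℝ → ℝ) (h : ℝ) (z : ℕ → ℝ × Fin 2) (n : ℕ) (t : ℝ) : ℝ :=
  ∫ u in (0 : ℝ)..t, densityEst k h z n u

/-- The naive estimator `ĝ_{n,1}(t) / ĝ_n(t)` of the distribution function of `X`. -/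
noncomputable def naiveEst (k : ℝ → ℝ) (h : ℝ) (z : ℕ → ℝ × Fin 2) (n : ℕ) (t : ℝ) : ℝ :=
  subdensityEst k h z n 1 t / densityEst k h z n t

/-- The end point `τ = sup {t ≥ 0 : ĝ_n(t) > 0}` of the parameter interval of the continuous
cumulative sum diagram. -/
noncomputable def diagramEnd (k : ℝ → ℝ) (h : ℝ) (z : ℕ → ℝ × Fin 2) (n : ℕ) : ℝ :=
  sSup {t : ℝ | 0 ≤ t ∧ 0 < densityEst k h z n t}

/-- The continuous cumulative sum diagram: the curve `s ↦ (Ĝ_n(s), Ĝ_{n,1}(s))`, `s ∈ [0, τ]`. -/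
noncomputable def cumSumDiagram (k : ℝ → ℝ) (h : ℝ) (z : ℕ → ℝ × Fin 2) (n : ℕ) : Set (ℝ × ℝ) :=
  (fun s => (distributionEst k h z n s, subdistributionEst k h z n 1 s)) ''
    Set.Icc 0 (diagramEnd k h z n)

/-- The lower boundary of the convex hull of a planar set, as a function of the abscissa. -/
noncomputable def lowerConvexHull (S : Set (ℝ × ℝ)) (x : ℝ) : ℝ :=
  sInf {y : ℝ | (x, y) ∈ convexHull ℝ S}

/-- The maximum smoothed likelihood estimator: the right-hand slope of the lower convex hull of
the continuous cumulative sum diagram at the point with abscissa `Ĝ_n(t)`. -/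
noncomputable def msleEst (k : ℝ → ℝ) (h : ℝ) (z : ℕ → ℝ × Fin 2) (n : ℕ) (t : ℝ) : ℝ :=
  derivWithin (lowerConvexHull (cumSumDiagram k h z n))
    (Set.Ioi (distributionEst k h z n t)) (distributionEst k h z n t)

/-- The bandwidth `c n^{-1/5}`. -/
noncomputable def bandwidth (c : ℝ) (n : ℕ) : ℝ := c * (n : ℝ) ^ (-(1 / 5) : ℝ)

/-- The bias factor `f₀'(t) + 2 f₀(t) g'(t) / g(t)`. -/
noncomputable def biasFactor (f₀ g : ℝ → ℝ) (t : ℝ) : ℝ :=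
  deriv f₀ t + 2 * (f₀ t * deriv g t / g t)

/-- The variance factor `F₀(t) (1 - F₀(t)) / g(t) · ∫ k²`. -/
noncomputable def varFactor (F₀ g k : ℝ → ℝ) (t : ℝ) : ℝ :=
  F₀ t * (1 - F₀ t) / g t * ∫ u, k u ^ 2

/-- The asymptotic mean `½ c² m₂(k) {f₀'(t) + 2 f₀(t) g'(t) / g(t)}`. -/
noncomputable def asympMean (f₀ g k : ℝ → ℝ) (t c : ℝ) : ℝ :=
  1 / 2 * c ^ 2 * secondMoment k * biasFactor f₀ g t

/-- The asymptotic variance `c⁻¹ F₀(t) (1 - F₀(t)) / g(t) · ∫ k²`. -/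
noncomputable def asympVar (F₀ g k : ℝ → ℝ) (t c : ℝ) : ℝ :=
  c⁻¹ * varFactor F₀ g k t

/-- The limiting normal law. -/
noncomputable def limitLaw (F₀ f₀ g k : ℝ → ℝ) (t c : ℝ) : Measure ℝ :=
  gaussianReal (asympMean f₀ g k t c) (asympVar F₀ g k t c).toNNReal

instance isProbabilityMeasure_limitLaw (F₀ f₀ g k : ℝ → ℝ) (t c : ℝ) : IsProbabilityMeasure (limitLaw F₀ f₀ g k t c) := by
  unfold limitLaw
  infer_instance

/-- The asymptotic mean squared error as a function of the bandwidth constant `c`: the second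
moment of the limit law of the rescaled estimation error. -/
noncomputable def asympMSE (F₀ f₀ g k : ℝ → ℝ) (t c : ℝ) : ℝ :=
  ∫ x, x ^ 2 ∂(limitLaw F₀ f₀ g k t c)

/-- The constant of the asymptotically optimal bandwidth. -/
noncomputable def optimalConst (F₀ f₀ g k : ℝ → ℝ) (t : ℝ) : ℝ :=
  varFactor F₀ g k t ^ (1 / 5 : ℝ) *
    (secondMoment k ^ 2 * biasFactor f₀ g t ^ 2) ^ (-(1 / 5) : ℝ)

/-!
The naive estimator at `t` is asymptotically normal, and with probability tending to one the
maximum smoothed likelihood estimator equals it.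

*Naive estimator.* With `p = F₀(t)`, its error is `(ĝ_{n,1}(t) - p ĝ_n(t)) / ĝ_n(t)`. The numerator
is a mean of i.i.d. terms with expectation `∫ k(v) ψ(t - h v) dv`, where `ψ = (F₀ - p) g` vanishes
at `t` and has second order coefficient `(f₀' g + 2 f₀ g') / 2` there; since `k` is symmetric, the
linear term drops out and leaves the bias (`ConditionK.tendsto_bias`). A central limit theorem for
triangular arrays (`IsSubdensitySample.tendstoInDistribution_sum`) and Slutsky's theorem then yield
`IsSubdensitySample.tendstoInDistribution_naiveEst`.

*Equality of the estimators.* The slope of the lower convex hull at the point with parameter `t` is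
the naive estimate as soon as the tangent to the cumulative sum diagram at this point lies below the
whole diagram (`derivWithin_lowerConvexHull_of_supporting`, `ConditionK.supporting_line`). The
limiting vertical distance between diagram and tangent is `∫_t^s (F₀ - p) g`, which has a strictly
positive second derivative `f₀ g` at `t` and is bounded away from zero outside a neighbourhood of
`t`. Near `t` the estimated distance is convex, because the derivatives of the kernel estimators
converge uniformly for bandwidths of order `n^{-1/5}`; on the remaining part of `[0, M₀ + 1]` it is
positive, because the integrated estimators converge uniformly; and beyond `M₀ + h` it increases,
because every observation time larger than `M₀` has `Δ = 1`
(`IsSubdensitySample.msleEst_eq_naiveEst`). The uniform convergence comes from Hoeffding's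
inequality on a grid (`IsSubdensitySample.uniform_mean`). The nondegeneracy condition at `t` enters
in two places: it makes the bias factor nonzero, and it forces `t < M₀`
(`ConditionF.lt_of_nondegenerate`).

*Measurability.* Convergence in distribution presupposes that the estimators are measurable. Over
the projection of the diagram its lower convex hull is the supremum of the supporting lines with
rational slope (`isLUB_lowerConvexHull`), and the right derivative is a limit along a sequence
whenever that limit exists (`ConditionK.measurable_msleEst`).

*Optimal bandwidth.* The asymptotic mean squared error has the form `a c⁴ + b / c`, and with
`s⁵ = b / (4 a)` the difference of its values at `c` and at `s` is a positive multiple of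
`(c - s)²` (`quartic_add_inv_lt`).
-/

/-! ### Events of probability tending to one -/

/-- The events `A n` hold with (outer) probability tending to one; no measurability is asked
for. -/
def WithHighProbability {Ω : Type*} [MeasurableSpace Ω] (P : Measure Ω)
    (A : ℕ → Ω → Prop) : Prop :=
  Tendsto (fun n => P {ω | ¬ A n ω}) atTop (𝓝 0)

namespace WithHighProbability

variable {Ω : Type*} [MeasurableSpace Ω] {P : Measure Ω} {A B : ℕ → Ω → Prop}

lemma of_measure_le {u : ℕ → ENNReal} (hu : Tendsto u atTop (𝓝 0))
    (h : ∀ᶠ n in atTop, P {ω | ¬ A n ω} ≤ u n) : WithHighProbability P A :=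
  tendsto_of_tendsto_of_tendsto_of_le_of_le' tendsto_const_nhds hu
    (Eventually.of_forall fun _ => zero_le) h

lemma mono (hA : WithHighProbability P A)
    (h : ∀ᶠ n in atTop, ∀ ω, A n ω → B n ω) : WithHighProbability P B :=
  of_measure_le hA (h.mono fun _ hn => measure_mono fun ω hω hA' => hω (hn ω hA'))

lemma and (hA : WithHighProbability P A) (hB : WithHighProbability P B) :
    WithHighProbability P fun n ω => A n ω ∧ B n ω := by
  have hAB := hA.add hB
  rw [add_zero] at hAB
  refine of_measure_le hAB (Eventually.of_forall fun n => ?_)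
  refine (measure_mono fun ω hω => ?_).trans (measure_union_le _ _)
  by_contra hc
  simp only [Set.mem_union, Set.mem_ofPred_eq, not_or, not_not] at hc
  exact hω hc

lemma of_ae (h : ∀ n, ∀ᵐ ω ∂P, A n ω) : WithHighProbability P A :=
  of_measure_le tendsto_const_nhds (Eventually.of_forall fun n => (ae_iff.1 (h n)).le)

end WithHighProbability

lemma tendstoInMeasure_of_withHighProbability {Ω : Type*} [MeasurableSpace Ω] {P : Measure Ω}
    {Y : ℕ → Ω → ℝ} {y : ℝ} (h : ∀ ε > 0, WithHighProbability P fun n ω => |Y n ω - y| < ε) :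
    TendstoInMeasure P Y atTop (fun _ => y) := by
  rw [tendstoInMeasure_iff_norm]
  intro ε hε
  simpa [WithHighProbability, Real.norm_eq_abs] using h ε hε

/-- Modifying the variables on events of vanishing probability does not affect convergence in
distribution. -/
lemma tendstoInDistribution_of_withHighProbability_eq {Ω Ω' : Type*} [MeasurableSpace Ω]
    [MeasurableSpace Ω'] {P : Measure Ω} [IsProbabilityMeasure P] {P' : Measure Ω'}
    [IsProbabilityMeasure P'] {U V : ℕ → Ω → ℝ} {L : Ω' → ℝ}
    (hU : TendstoInDistribution U atTop L (fun _ => P) P')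
    (hV : ∀ n, AEMeasurable (V n) P)
    (h : WithHighProbability P fun n ω => U n ω = V n ω) :
    TendstoInDistribution V atTop L (fun _ => P) P' := by
  have hVU : TendstoInMeasure P (fun n ω => V n ω - U n ω) atTop (fun _ => (0 : ℝ)) := by
    refine tendstoInMeasure_of_withHighProbability fun ε hε => ?_
    refine h.mono (Eventually.of_forall fun n ω hω => ?_)
    simpa [hω] using hε
  exact tendstoInDistribution_of_tendstoInMeasure_sub V L hU hVU hV

/-! ### The sample of marked observation times -/

/-- The marked variables `Z 0, Z 1, …` are i.i.d., and the part of their common law carried by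
the mark `i` has Lebesgue density `q i`. The law is encoded by its integrals of bounded
measurable functions. -/
structure IsSubdensitySample {Ω : Type*} [MeasurableSpace Ω] (P : Measure Ω)
    (Z : ℕ → Ω → ℝ × Fin 2) (q : Fin 2 → ℝ → ℝ) : Prop where
  measurable : ∀ j, Measurable (Z j)
  indep : iIndepFun Z P
  measurable_subdensity : ∀ i, Measurable (q i)
  integrable : ∀ i, Integrable (q i)
  nonneg : ∀ i u, 0 ≤ q i u
  integral_comp : ∀ j (ψ : ℝ × Fin 2 → ℝ), Measurable ψ → (∃ C, ∀ z, |ψ z| ≤ C) →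
    ∫ ω, ψ (Z j ω) ∂P = ∑ i, ∫ u, ψ (u, i) * q i u

/-- The subdensities of the observation times with mark `Δ = i` in the current status model. -/
noncomputable def subdensity (F₀ g : ℝ → ℝ) (i : Fin 2) (u : ℝ) : ℝ :=
  (if i = 1 then F₀ u else 1 - F₀ u) * g u

/-- Independence of two i.i.d. sequences from each other makes the sequence of pairs
independent. -/
lemma iIndepFun_prodMk_of_indepFun {Ω : Type*} [MeasurableSpace Ω] {P : Measure Ω}
    {X T : ℕ → Ω → ℝ} (mX : ∀ j, Measurable (X j)) (mT : ∀ j, Measurable (T j))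
    (hX : iIndepFun X P) (hT : iIndepFun T P)
    (hXT : IndepFun (fun ω j => X j ω) (fun ω j => T j ω) P) :
    iIndepFun (fun j ω => (X j ω, T j ω)) P := by
  rw [iIndepFun_iff_iIndep]
  let R : Set (Set (ℝ × ℝ)) :=
    Set.image2 (fun s t => s ×ˢ t) {s | MeasurableSet s} {t | MeasurableSet t}
  refine iIndepSets.iIndep (fun j => ((mX j).prodMk (mT j)).comap_le)
    (fun j => {s | ∃ r ∈ R, (fun ω => (X j ω, T j ω)) ⁻¹' r = s}) (fun j => ?_) (fun j => ?_) ?_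
  · exact isPiSystem_prod.comap _
  · have : (Prod.instMeasurableSpace : MeasurableSpace (ℝ × ℝ)) =
        MeasurableSpace.generateFrom R := generateFrom_prod.symm
    rw [this, MeasurableSpace.comap_generateFrom]
    rfl
  · rw [iIndepSets_iff]
    intro S f hf
    have hf' : ∀ j, ∃ A B : Set ℝ, MeasurableSet A ∧ MeasurableSet B ∧
        (j ∈ S → f j = X j ⁻¹' A ∩ T j ⁻¹' B) := by
      intro j
      by_cases hj : j ∈ S
      · obtain ⟨r, ⟨A, hA, B, hB, rfl⟩, hr⟩ := hf j hj
        exact ⟨A, B, hA, hB, fun _ => hr.symm⟩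
      · exact ⟨∅, ∅, .empty, .empty, fun h => absurd h hj⟩
    choose A B hA hB hfAB using hf'
    have h1 : (⋂ j ∈ S, f j) = (⋂ j ∈ S, X j ⁻¹' A j) ∩ ⋂ j ∈ S, T j ⁻¹' B j := by
      ext ω
      simp only [Set.mem_inter_iff, Set.mem_iInter, ← forall₂_and]
      refine forall₂_congr fun j hj => ?_
      rw [hfAB j hj, Set.mem_inter_iff]
    have h2 : P ((⋂ j ∈ S, X j ⁻¹' A j) ∩ ⋂ j ∈ S, T j ⁻¹' B j) =
        P (⋂ j ∈ S, X j ⁻¹' A j) * P (⋂ j ∈ S, T j ⁻¹' B j) := by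
      have hm : ∀ C : ℕ → Set ℝ, (∀ j, MeasurableSet (C j)) →
          MeasurableSet {x : ℕ → ℝ | ∀ j ∈ S, x j ∈ C j} := by
        intro C hC
        have : {x : ℕ → ℝ | ∀ j ∈ S, x j ∈ C j} = ⋂ j ∈ S, (fun x : ℕ → ℝ => x j) ⁻¹' C j := by
          ext; simp
        rw [this]
        exact Finset.measurableSet_biInter _ fun j _ => measurable_pi_apply j (hC j)
      have := indepFun_iff_measure_inter_preimage_eq_mul.1 hXT _ _ (hm A hA) (hm B hB)
      convert this using 3 <;> (ext; simp)
    rw [h1, h2, hX.meas_biInter fun j _ => ⟨A j, hA j, rfl⟩,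
      hT.meas_biInter fun j _ => ⟨B j, hB j, rfl⟩, ← Finset.prod_mul_distrib]
    refine Finset.prod_congr rfl fun j hj => ?_
    have hj' := indepFun_iff_measure_inter_preimage_eq_mul.1
      (hXT.comp (measurable_pi_apply j) (measurable_pi_apply j)) _ _ (hA j) (hB j)
    rw [hfAB j hj]
    exact hj'.symm

lemma measurable_observation : Measurable fun p : ℝ × ℝ => observation p.1 p.2 := by
  unfold observation
  refine measurable_snd.prodMk (Measurable.ite ?_ measurable_const measurable_const)
  exact measurableSet_le measurable_fst measurable_snd

lemma IsDensity.integrable {μ : Measure ℝ} [IsFiniteMeasure μ] {f : ℝ → ℝ} (h : IsDensity μ f) :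
    Integrable f := by
  refine ⟨h.measurable.aestronglyMeasurable, ?_⟩
  rw [hasFiniteIntegral_iff_ofReal (ae_of_all _ h.nonneg)]
  have : ∫⁻ x, ENNReal.ofReal (f x) = μ Set.univ := by
    rw [h.eq_withDensity, withDensity_apply _ .univ, Measure.restrict_univ]
  rw [this]
  exact measure_lt_top _ _

/-- In the current status model the observations `(T, Δ)` have the subdensities `(1 - F₀) g` and
`F₀ g`. Everything below about the estimators uses the model through this lemma only. -/
lemma IsCurrentStatusModel.isSubdensitySample {Ω : Type*} [MeasurableSpace Ω] {P : Measure Ω}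
    [IsProbabilityMeasure P] {X T : ℕ → Ω → ℝ} {μX μT : Measure ℝ}
    (h : IsCurrentStatusModel P X T μX μT) {g : ℝ → ℝ} (hg : IsDensity μT g) :
    IsSubdensitySample P (fun j ω => observation (X j ω) (T j ω)) (subdensity (cdf μX) g) := by
  have hμX : IsProbabilityMeasure μX :=
    h.law_X 0 ▸ Measure.isProbabilityMeasure_map (h.measurable_X 0).aemeasurable
  have hμT : IsProbabilityMeasure μT :=
    h.law_T 0 ▸ Measure.isProbabilityMeasure_map (h.measurable_T 0).aemeasurable
  have hgint : Integrable g := hg.integrable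
  have hw : ∀ (i : Fin 2) u, 0 ≤ (if i = 1 then cdf μX u else 1 - cdf μX u) ∧
      (if i = 1 then cdf μX u else 1 - cdf μX u) ≤ 1 := by
    intro i u
    have h0 := cdf_nonneg μX u
    have h1 := cdf_le_one μX u
    split_ifs <;> constructor <;> linarith
  have hFm : Measurable fun u => cdf μX u := (monotone_cdf μX).measurable
  have hwm : ∀ i : Fin 2, Measurable fun u => (if i = 1 then cdf μX u else 1 - cdf μX u) := by
    intro i
    split_ifs
    · exact hFm
    · exact hFm.const_sub 1
  have hqint : ∀ i, Integrable (subdensity (cdf μX) g i) := fun i =>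
    hgint.bdd_mul (hwm i).aestronglyMeasurable (c := 1)
      (ae_of_all _ fun u => by rw [Real.norm_eq_abs, abs_of_nonneg (hw i u).1]; exact (hw i u).2)
  refine ⟨fun j => measurable_observation.comp ((h.measurable_X j).prodMk (h.measurable_T j)),
    ?_, fun i => (hwm i).mul hg.measurable, hqint, fun i u => mul_nonneg (hw i u).1 (hg.nonneg u), ?_⟩
  · exact (iIndepFun_prodMk_of_indepFun h.measurable_X h.measurable_T h.indep_X h.indep_T
      h.indep_X_T).comp (fun _ p => observation p.1 p.2) fun _ => measurable_observation
  · rintro j ψ hψ ⟨C, hC⟩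
    have hjoint : P.map (fun ω => (X j ω, T j ω)) = μX.prod μT := by
      have := (indepFun_iff_map_prod_eq_prod_map_map (h.measurable_X j).aemeasurable
        (h.measurable_T j).aemeasurable).1
          (h.indep_X_T.comp (measurable_pi_apply j) (measurable_pi_apply j))
      rw [← h.law_X j, ← h.law_T j]
      exact this
    have hm : Measurable fun p : ℝ × ℝ => ψ (observation p.1 p.2) := hψ.comp measurable_observation
    have e1 : ∫ ω, ψ (observation (X j ω) (T j ω)) ∂P =
        ∫ p, ψ (observation p.1 p.2) ∂(μX.prod μT) := by
      rw [← hjoint, integral_map ((h.measurable_X j).prodMk (h.measurable_T j)).aemeasurable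
        hm.aestronglyMeasurable]
    have hint : Integrable (fun p : ℝ × ℝ => ψ (observation p.1 p.2)) (μX.prod μT) :=
      Integrable.of_bound hm.aestronglyMeasurable C (ae_of_all _ fun p => hC _)
    rw [e1, integral_prod_symm _ hint]
    have e2 : ∀ u, ∫ x, ψ (observation x u) ∂μX =
        cdf μX u * ψ (u, 1) + (1 - cdf μX u) * ψ (u, 0) := by
      intro u
      have : ∀ x, ψ (observation x u) =
          ψ (u, 0) + (Set.Iic u).indicator (fun _ => ψ (u, 1) - ψ (u, 0)) x := by
        intro x
        by_cases hx : x ≤ u <;> simp [observation, hx]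
      simp_rw [this]
      rw [integral_add (integrable_const _)
        ((integrable_const _).indicator measurableSet_Iic), integral_indicator measurableSet_Iic]
      simp only [integral_const, measureReal_restrict_apply_univ, probReal_univ, smul_eq_mul,
        ← cdf_eq_real]
      ring
    simp_rw [e2]
    rw [hg.eq_withDensity, integral_withDensity_eq_integral_toReal_smul
      hg.measurable.ennreal_ofReal (ae_of_all _ fun _ => ENNReal.ofReal_lt_top)]
    have hqi : ∀ i, Integrable fun u => ψ (u, i) * subdensity (cdf μX) g i u := fun i =>
      (hqint i).bdd_mul (hψ.comp (measurable_id.prodMk measurable_const)).aestronglyMeasurable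
        (c := C) (ae_of_all _ fun u => hC _)
    rw [Fin.sum_univ_two, ← integral_add (hqi 0) (hqi 1)]
    refine integral_congr_ae (ae_of_all _ fun u => ?_)
    simp only [ENNReal.toReal_ofReal (hg.nonneg u), smul_eq_mul, subdensity, Fin.isValue,
      zero_ne_one, if_false, if_true]
    ring

/-! ### Deviation inequalities and the central limit theorem -/

namespace IsSubdensitySample

variable {Ω : Type*} [MeasurableSpace Ω] {P : Measure Ω} [IsProbabilityMeasure P]
  {Z : ℕ → Ω → ℝ × Fin 2} {q : Fin 2 → ℝ → ℝ}

/-- Hoeffding's inequality for the sample mean of a bounded function of the observations. -/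
lemma measure_abs_mean_sub_ge_le (hZ : IsSubdensitySample P Z q) {ψ : ℝ × Fin 2 → ℝ}
    (hψ : Measurable ψ) {C : ℝ} (hC : ∀ z, |ψ z| ≤ C) {ε : ℝ} (hε : 0 ≤ ε) {n : ℕ} (hn : 0 < n) :
    P.real {ω | ε ≤ |1 / (n : ℝ) * ∑ j ∈ Finset.range n, ψ (Z j ω) -
      ∑ i, ∫ u, ψ (u, i) * q i u|} ≤ 2 * Real.exp (-(n * ε ^ 2) / (2 * C ^ 2)) := by
  have hC0 : 0 ≤ C := (abs_nonneg _).trans (hC (0, 0))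
  have hn' : (0 : ℝ) < n := Nat.cast_pos.2 hn
  set m := ∑ i, ∫ u, ψ (u, i) * q i u with hm
  -- Both signs are treated by applying the one-sided bound to `ψ` and `-ψ`.
  have key : ∀ φ : ℝ × Fin 2 → ℝ, Measurable φ → (∀ z, |φ z| ≤ C) →
      P.real {ω | n * ε ≤ ∑ j ∈ Finset.range n, (φ (Z j ω) - ∑ i, ∫ u, φ (u, i) * q i u)} ≤
        Real.exp (-(n * ε ^ 2) / (2 * C ^ 2)) := by
    intro φ hφ hφC
    have hind : iIndepFun (fun j ω => φ (Z j ω) - ∑ i, ∫ u, φ (u, i) * q i u) P :=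
      hZ.indep.comp (fun _ z => φ z - ∑ i, ∫ u, φ (u, i) * q i u) fun _ => hφ.sub_const _
    have hsub : ∀ j < n, HasSubgaussianMGF (fun ω => φ (Z j ω) - ∑ i, ∫ u, φ (u, i) * q i u)
        ((‖C - -C‖₊ / 2) ^ 2) P := by
      intro j _
      rw [← hZ.integral_comp j φ hφ ⟨C, hφC⟩]
      exact hasSubgaussianMGF_of_mem_Icc (hφ.comp (hZ.measurable j)).aemeasurable
        (ae_of_all _ fun ω => abs_le.1 (hφC _))
    refine (HasSubgaussianMGF.measure_sum_range_ge_le_of_iIndepFun hind hsub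
      (mul_nonneg hn'.le hε)).trans (le_of_eq ?_)
    congr 1
    have : ((((‖C - -C‖₊ / 2) ^ 2 : NNReal)) : ℝ) = C ^ 2 := by
      push_cast
      rw [Real.norm_eq_abs, abs_of_nonneg (by linarith)]
      ring
    rw [this]
    rcases hC0.eq_or_lt with h0 | h0
    · simp [← h0]
    · field_simp
  have h1 := key ψ hψ hC
  have h2 := key (fun z => -ψ z) hψ.neg (fun z => by rw [abs_neg]; exact hC z)
  have hsubset : {ω | ε ≤ |1 / (n : ℝ) * ∑ j ∈ Finset.range n, ψ (Z j ω) - m|} ⊆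
      {ω | n * ε ≤ ∑ j ∈ Finset.range n, (ψ (Z j ω) - m)} ∪
      {ω | n * ε ≤ ∑ j ∈ Finset.range n, (-ψ (Z j ω) - ∑ i, ∫ u, -ψ (u, i) * q i u)} := by
    intro ω hω
    have hneg : ∑ i, ∫ u, -ψ (u, i) * q i u = -m := by
      simp_rw [hm, neg_mul, integral_neg, Finset.sum_neg_distrib]
    simp only [Set.mem_union, Set.mem_ofPred_eq, hneg, Finset.sum_sub_distrib, Finset.sum_const,
      Finset.card_range, nsmul_eq_mul, Finset.sum_neg_distrib] at hω ⊢
    have hs : ∑ j ∈ Finset.range n, ψ (Z j ω) =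
        n * (1 / (n : ℝ) * ∑ j ∈ Finset.range n, ψ (Z j ω)) := by field_simp
    rw [hs]
    rcases le_abs.1 hω with h | h
    · left
      rw [← mul_sub]
      exact mul_le_mul_of_nonneg_left h hn'.le
    · right
      have := mul_le_mul_of_nonneg_left h hn'.le
      linarith
  refine (measureReal_mono hsubset).trans ((measureReal_union_le _ _).trans ?_)
  linarith

/-- The exponential bound of Hoeffding's inequality beats a polynomially growing number of events
as soon as the summands are of order `n ^ (2 / 5)`. -/
lemma tendsto_mul_exp_neg_zero {a : ℝ} (ha : 0 < a) :
    Tendsto (fun n : ℕ => ((n : ℝ) + 1) * (2 * Real.exp (-(a * (n : ℝ) ^ (1 / 5 : ℝ)))))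
      atTop (𝓝 0) := by
  have hx : Tendsto (fun n : ℕ => (n : ℝ) ^ (1 / 5 : ℝ)) atTop atTop :=
    (tendsto_rpow_atTop (by norm_num)).comp tendsto_natCast_atTop_atTop
  have h5 := ((Real.tendsto_pow_mul_exp_neg_atTop_nhds_zero 5).comp
    (hx.const_mul_atTop ha)).const_mul (2 / a ^ 5)
  have h0 := ((Real.tendsto_pow_mul_exp_neg_atTop_nhds_zero 0).comp
    (hx.const_mul_atTop ha)).const_mul 2
  have := h5.add h0
  rw [mul_zero, mul_zero, add_zero] at this
  refine this.congr fun n => ?_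
  have hn : ((n : ℝ) ^ (1 / 5 : ℝ)) ^ 5 = n := by
    rw [← Real.rpow_natCast, ← Real.rpow_mul (Nat.cast_nonneg n)]
    norm_num
  simp only [Function.comp_apply, mul_pow, hn, pow_zero]
  field_simp

/-- A uniform law of large numbers for a triangular family `ψ n s`, `s ∈ [a, b]`, of functions of
order `n ^ (2 / 5)` that are Lipschitz in `s` with constants of order `n ^ (3 / 5)`. Hoeffding's
inequality and a union bound control the means on a grid of mesh `1 / n`, the Lipschitz condition
controls them in between. -/
lemma uniform_mean (hZ : IsSubdensitySample P Z q) {ψ : ℕ → ℝ → ℝ × Fin 2 → ℝ} {a b C : ℝ}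
    (hab : a ≤ b) (hC : 0 < C) (hψ : ∀ n s, Measurable (ψ n s))
    (hbound : ∀ n : ℕ, 0 < n → ∀ s z, |ψ n s z| ≤ C * (n : ℝ) ^ (2 / 5 : ℝ))
    (hlip : ∀ n : ℕ, 0 < n → ∀ s ∈ Set.Icc a b, ∀ s' ∈ Set.Icc a b, ∀ z,
      |ψ n s z - ψ n s' z| ≤ C * (n : ℝ) ^ (3 / 5 : ℝ) * |s - s'|)
    {ε : ℝ} (hε : 0 < ε) :
    WithHighProbability P fun n ω => ∀ s ∈ Set.Icc a b,
      |1 / (n : ℝ) * ∑ j ∈ Finset.range n, ψ n s (Z j ω) -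
        ∑ i, ∫ u, ψ n s (u, i) * q i u| < ε := by
  have mean_lip : ∀ n : ℕ, 0 < n → ∀ s ∈ Set.Icc a b, ∀ s' ∈ Set.Icc a b, ∀ ω,
      |1 / (n : ℝ) * ∑ j ∈ Finset.range n, ψ n s (Z j ω) -
        1 / (n : ℝ) * ∑ j ∈ Finset.range n, ψ n s' (Z j ω)| ≤
        C * (n : ℝ) ^ (3 / 5 : ℝ) * |s - s'| := by
    intro n hn s hs s' hs' ω
    have hn' : (0 : ℝ) < n := Nat.cast_pos.2 hn
    rw [← mul_sub, ← Finset.sum_sub_distrib, abs_mul, abs_of_nonneg (by positivity)]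
    have := (Finset.abs_sum_le_sum_abs (fun j => ψ n s (Z j ω) - ψ n s' (Z j ω))
      (Finset.range n)).trans (Finset.sum_le_sum fun j _ => hlip n hn s hs s' hs' (Z j ω))
    rw [Finset.sum_const, Finset.card_range, nsmul_eq_mul] at this
    rw [one_div, inv_mul_le_iff₀ hn']
    exact this
  have exp_lip : ∀ n : ℕ, 0 < n → ∀ s ∈ Set.Icc a b, ∀ s' ∈ Set.Icc a b,
      |(∑ i, ∫ u, ψ n s (u, i) * q i u) - ∑ i, ∫ u, ψ n s' (u, i) * q i u| ≤
        C * (n : ℝ) ^ (3 / 5 : ℝ) * |s - s'| := by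
    intro n hn s hs s' hs'
    have hb : ∀ s, ∃ B, ∀ z, |ψ n s z| ≤ B := fun s => ⟨_, hbound n hn s⟩
    have hi : ∀ s, Integrable (fun ω => ψ n s (Z 0 ω)) P := fun s =>
      Integrable.of_bound ((hψ n s).comp (hZ.measurable 0)).aestronglyMeasurable _
        (ae_of_all _ fun ω => hbound n hn s (Z 0 ω))
    rw [← hZ.integral_comp 0 _ (hψ n s) (hb s), ← hZ.integral_comp 0 _ (hψ n s') (hb s'),
      ← integral_sub (hi s) (hi s')]
    have := norm_integral_le_of_norm_le_const (μ := P)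
      (f := fun ω => ψ n s (Z 0 ω) - ψ n s' (Z 0 ω))
      (ae_of_all _ fun ω => hlip n hn s hs s' hs' (Z 0 ω))
    simpa using this
  -- The grid with `n + 1` equidistant points.
  let grid : ℕ → ℕ → ℝ := fun n m => a + (b - a) * (m / n)
  have grid_mem : ∀ n : ℕ, 0 < n → ∀ m ∈ Finset.range (n + 1), grid n m ∈ Set.Icc a b := by
    intro n hn m hm
    have hn' : (0 : ℝ) < n := Nat.cast_pos.2 hn
    have h1 : (m : ℝ) / n ≤ 1 := by
      rw [div_le_one hn']
      exact_mod_cast Nat.lt_succ_iff.1 (Finset.mem_range.1 hm)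
    have h0 : (0 : ℝ) ≤ m / n := by positivity
    constructor
    · simp only [grid]; nlinarith
    · simp only [grid]; nlinarith
  have grid_near : ∀ n : ℕ, 0 < n → ∀ s ∈ Set.Icc a b, ∃ m ∈ Finset.range (n + 1),
      |s - grid n m| ≤ (b - a) / n := by
    intro n hn s hs
    have hn' : (0 : ℝ) < n := Nat.cast_pos.2 hn
    rcases hab.eq_or_lt with h | h
    · refine ⟨0, by simp, ?_⟩
      have : s = a := le_antisymm (h ▸ hs.2) hs.1
      simp [grid, this, h]
    · have hba : 0 < b - a := sub_pos.2 h
      set y := (s - a) / (b - a) * n with hy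
      have hy0 : 0 ≤ y := mul_nonneg (div_nonneg (sub_nonneg.2 hs.1) hba.le) hn'.le
      have hyn : y ≤ n := by
        have : (s - a) / (b - a) ≤ 1 := by rw [div_le_one hba]; linarith [hs.2]
        nlinarith
      refine ⟨⌊y⌋₊, ?_, ?_⟩
      · rw [Finset.mem_range, Nat.lt_succ_iff]
        exact_mod_cast (Nat.floor_le hy0).trans hyn
      · have hs' : s = a + (b - a) * (y / n) := by rw [hy]; field_simp; ring
        have h1 := Nat.floor_le hy0
        have h2 := Nat.lt_floor_add_one y
        have : s - grid n ⌊y⌋₊ = (b - a) / n * (y - ⌊y⌋₊) := by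
          simp only [grid]
          rw [hs']
          ring
        rw [this, abs_of_nonneg (mul_nonneg (by positivity) (by linarith))]
        exact mul_le_of_le_one_right (by positivity) (by linarith)
  have hmesh : Tendsto (fun n : ℕ => C * (b - a) * (n : ℝ) ^ (-(2 / 5) : ℝ)) atTop (𝓝 0) := by
    have := ((tendsto_rpow_neg_atTop (y := (2 / 5 : ℝ)) (by norm_num)).comp
      tendsto_natCast_atTop_atTop).const_mul (C * (b - a))
    rwa [mul_zero] at this
  have hA : 0 < (ε / 2) ^ 2 / (2 * C ^ 2) := by positivity
  refine WithHighProbability.of_measure_le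
    (u := fun n => ENNReal.ofReal (((n : ℝ) + 1) *
      (2 * Real.exp (-((ε / 2) ^ 2 / (2 * C ^ 2) * (n : ℝ) ^ (1 / 5 : ℝ))))))
    (by simpa using ENNReal.tendsto_ofReal (tendsto_mul_exp_neg_zero hA)) ?_
  filter_upwards [eventually_gt_atTop 0,
    hmesh.eventually (gt_mem_nhds (show (0 : ℝ) < ε / 4 by positivity))] with n hn hsmall
  have hn' : (0 : ℝ) < n := Nat.cast_pos.2 hn
  have hstep : ∀ s ∈ Set.Icc a b, ∀ s' ∈ Set.Icc a b, |s - s'| ≤ (b - a) / n →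
      C * (n : ℝ) ^ (3 / 5 : ℝ) * |s - s'| ≤ ε / 4 := by
    intro s _ s' _ h
    refine le_trans ?_ hsmall.le
    have e : (n : ℝ) ^ (-(2 / 5) : ℝ) = (n : ℝ) ^ (3 / 5 : ℝ) / n := by
      rw [← Real.rpow_sub_one hn'.ne']
      norm_num
    calc C * (n : ℝ) ^ (3 / 5 : ℝ) * |s - s'| ≤ C * (n : ℝ) ^ (3 / 5 : ℝ) * ((b - a) / n) := by
          gcongr
      _ = _ := by rw [e]; ring
  have hsub : {ω | ¬ ∀ s ∈ Set.Icc a b, |1 / (n : ℝ) * ∑ j ∈ Finset.range n, ψ n s (Z j ω) -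
        ∑ i, ∫ u, ψ n s (u, i) * q i u| < ε} ⊆
      ⋃ m ∈ Finset.range (n + 1), {ω | ε / 2 ≤ |1 / (n : ℝ) *
        ∑ j ∈ Finset.range n, ψ n (grid n m) (Z j ω) -
          ∑ i, ∫ u, ψ n (grid n m) (u, i) * q i u|} := by
    intro ω hω
    simp only [Set.mem_ofPred_eq, not_forall, not_lt] at hω
    obtain ⟨s, hs, hω⟩ := hω
    obtain ⟨m, hm, hsm⟩ := grid_near n hn s hs
    simp only [Set.mem_iUnion]
    refine ⟨m, hm, ?_⟩
    have hg := grid_mem n hn m hm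
    have h1 := (mean_lip n hn s hs _ hg ω).trans (hstep s hs _ hg hsm)
    have h2 := (exp_lip n hn s hs _ hg).trans (hstep s hs _ hg hsm)
    simp only [Set.mem_ofPred_eq]
    have h1' := abs_le.1 h1
    have h2' := abs_le.1 h2
    rcases le_abs.1 hω with h | h
    · exact le_trans (by linarith [h1'.2, h2'.1]) (le_abs_self _)
    · exact le_trans (by linarith [h1'.1, h2'.2]) (neg_le_abs _)
  refine (measure_mono hsub).trans ((measure_biUnion_finset_le _ _).trans ?_)
  have hterm : ∀ m ∈ Finset.range (n + 1), P {ω | ε / 2 ≤ |1 / (n : ℝ) *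
        ∑ j ∈ Finset.range n, ψ n (grid n m) (Z j ω) -
          ∑ i, ∫ u, ψ n (grid n m) (u, i) * q i u|} ≤
      ENNReal.ofReal (2 * Real.exp (-((ε / 2) ^ 2 / (2 * C ^ 2) * (n : ℝ) ^ (1 / 5 : ℝ)))) := by
    intro m _
    rw [← ofReal_measureReal]
    refine ENNReal.ofReal_le_ofReal ((hZ.measure_abs_mean_sub_ge_le (hψ n _) (hbound n hn _)
      (by positivity : 0 ≤ ε / 2) hn).trans (le_of_eq ?_))
    congr 3
    have e : (n : ℝ) = (n : ℝ) ^ (1 / 5 : ℝ) * ((n : ℝ) ^ (2 / 5 : ℝ)) ^ 2 := by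
      rw [← Real.rpow_natCast, ← Real.rpow_mul hn'.le, ← Real.rpow_add hn']
      norm_num
    have hp : 0 < (n : ℝ) ^ (2 / 5 : ℝ) := Real.rpow_pos_of_pos hn' _
    nth_rewrite 1 [e]
    field_simp
  refine (Finset.sum_le_sum hterm).trans (le_of_eq ?_)
  rw [Finset.sum_const, Finset.card_range, nsmul_eq_mul,
    show (n : ℝ) + 1 = ((n + 1 : ℕ) : ℝ) by push_cast; ring,
    ENNReal.ofReal_mul (Nat.cast_nonneg _), ENNReal.ofReal_natCast]

/-- The central limit theorem for triangular arrays with identically distributed, uniformly small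
rows: if `|W n| ≤ b n → 0`, `n E W n → m` and `n E (W n)² → v`, the row sums converge to
`N(m, v)`. -/
lemma tendstoInDistribution_sum (hZ : IsSubdensitySample P Z q) {W : ℕ → ℝ × Fin 2 → ℝ}
    (hW : ∀ n, Measurable (W n)) {b : ℕ → ℝ} (hb : ∀ n z, |W n z| ≤ b n)
    (hb0 : Tendsto b atTop (𝓝 0)) {m v : ℝ} (hv : 0 ≤ v)
    (hm : Tendsto (fun n : ℕ => n * ∑ i, ∫ u, W n (u, i) * q i u) atTop (𝓝 m))
    (hv' : Tendsto (fun n : ℕ => n * ∑ i, ∫ u, W n (u, i) ^ 2 * q i u) atTop (𝓝 v)) :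
    TendstoInDistribution (fun n ω => ∑ j ∈ Finset.range n, W n (Z j ω)) atTop id (fun _ => P)
      (gaussianReal m v.toNNReal) := by
  have hWZ : ∀ n j, Measurable fun ω => W n (Z j ω) := fun n j => (hW n).comp (hZ.measurable j)
  refine ⟨fun n => (Finset.measurable_fun_sum _ fun j _ => hWZ n j).aemeasurable,
    aemeasurable_id, ?_⟩
  refine ProbabilityMeasure.tendsto_iff_tendsto_charFun.2 fun s => ?_
  have hchar : ∀ n, charFun (P.map fun ω => ∑ j ∈ Finset.range n, W n (Z j ω)) s =
      (∫ ω, Complex.exp (s * W n (Z 0 ω) * Complex.I) ∂P) ^ n := by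
    intro n
    have hident : ∀ j, P.map (Z j) = P.map (Z 0) := by
      intro j
      have : ∀ j, IsFiniteMeasure (P.map (Z j)) := fun j => inferInstance
      refine Measure.ext fun B hB => ?_
      have h1 : ∀ j, (P.map (Z j)).real B = ∑ i, ∫ u, B.indicator 1 (u, i) * q i u := by
        intro j
        rw [← hZ.integral_comp j (B.indicator 1) (measurable_one.indicator hB)
          ⟨1, fun z => by by_cases hz : z ∈ B <;> simp [hz]⟩, map_measureReal_apply
          (hZ.measurable j) hB]
        have : ∀ ω, B.indicator (1 : ℝ × Fin 2 → ℝ) (Z j ω) = (Z j ⁻¹' B).indicator 1 ω := by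
          intro ω
          by_cases hω : Z j ω ∈ B
          · rw [Set.indicator_of_mem hω, Set.indicator_of_mem (show ω ∈ Z j ⁻¹' B from hω)]
            rfl
          · rw [Set.indicator_of_notMem hω, Set.indicator_of_notMem (show ω ∉ Z j ⁻¹' B from hω)]
        simp_rw [this]
        rw [integral_indicator_one (hZ.measurable j hB)]
      have := (h1 j).trans (h1 0).symm
      rwa [measureReal_def, measureReal_def, ENNReal.toReal_eq_toReal_iff' (measure_ne_top _ _)
        (measure_ne_top _ _)] at this
    have hind : iIndepFun (fun j ω => W n (Z j ω)) P := hZ.indep.comp (fun _ => W n) fun _ => hW n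
    rw [iIndepFun.charFun_map_fun_finsetSum_eq_prod (fun j _ => (hWZ n j).aemeasurable)
      (hind.restrict _), Finset.prod_apply]
    have : ∀ j ∈ Finset.range n, charFun (P.map fun ω => W n (Z j ω)) s =
        ∫ ω, Complex.exp (s * W n (Z 0 ω) * Complex.I) ∂P := by
      intro j _
      have e : P.map (fun ω => W n (Z j ω)) = P.map fun ω => W n (Z 0 ω) := by
        have := congrArg (Measure.map (W n)) (hident j)
        rwa [Measure.map_map (hW n) (hZ.measurable j), Measure.map_map (hW n) (hZ.measurable 0)]
          at this
      rw [e, charFun_apply_real, integral_map (hWZ n 0).aemeasurable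
        (by fun_prop : Continuous fun x : ℝ => Complex.exp (s * x * Complex.I)).aestronglyMeasurable]
    rw [Finset.prod_congr rfl this, Finset.prod_const, Finset.card_range]
  have hlim : charFun ((gaussianReal m v.toNNReal).map id) s =
      Complex.exp (s * m * Complex.I - v * s ^ 2 / 2) := by
    rw [Measure.map_id, charFun_gaussianReal, Real.coe_toNNReal _ hv]
  simp only [ProbabilityMeasure.coe_mk, hchar]
  rw [hlim]
  -- The characteristic function of the row sum is `(1 + R n) ^ n`, so that it suffices to find the
  -- limit of `n * R n`.
  let R : ℕ → ℂ := fun n => ∫ ω, (Complex.exp (s * W n (Z 0 ω) * Complex.I) - 1) ∂P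
  have hexp_int : ∀ n, Integrable (fun ω => Complex.exp (s * W n (Z 0 ω) * Complex.I)) P := by
    intro n
    refine Integrable.of_bound (C := 1) ?_ (ae_of_all _ fun ω => ?_)
    · have : Continuous fun x : ℝ => Complex.exp (s * x * Complex.I) := by fun_prop
      exact (this.measurable.comp (hWZ n 0)).aestronglyMeasurable
    · rw [show (s * W n (Z 0 ω) * Complex.I : ℂ) = ((s * W n (Z 0 ω) : ℝ) : ℂ) * Complex.I by
        push_cast; ring, Complex.norm_exp_ofReal_mul_I]
  have hR : ∀ n, ∫ ω, Complex.exp (s * W n (Z 0 ω) * Complex.I) ∂P = 1 + R n := by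
    intro n
    simp only [R]
    rw [integral_sub (hexp_int n) (integrable_const _)]
    simp
  simp_rw [hR]
  refine Complex.tendsto_one_add_pow_exp_of_tendsto ?_
  have hW1 : ∀ n, Integrable (fun ω => W n (Z 0 ω)) P := fun n =>
    Integrable.of_bound (hWZ n 0).aestronglyMeasurable (b n) (ae_of_all _ fun ω => hb n _)
  have hW2 : ∀ n, Integrable (fun ω => W n (Z 0 ω) ^ 2) P := fun n =>
    Integrable.of_bound ((hWZ n 0).pow_const 2).aestronglyMeasurable (b n ^ 2)
      (ae_of_all _ fun ω => by
        rw [norm_pow]; exact pow_le_pow_left₀ (norm_nonneg _) (hb n _) 2)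
  have hE1 : ∀ n, ∑ i, ∫ u, W n (u, i) * q i u = ∫ ω, W n (Z 0 ω) ∂P := fun n =>
    (hZ.integral_comp 0 _ (hW n) ⟨_, hb n⟩).symm
  have hE2 : ∀ n, ∑ i, ∫ u, W n (u, i) ^ 2 * q i u = ∫ ω, W n (Z 0 ω) ^ 2 ∂P := fun n =>
    (hZ.integral_comp 0 (fun z => W n z ^ 2) ((hW n).pow_const 2) ⟨b n ^ 2, fun z => by
      rw [abs_pow]; exact pow_le_pow_left₀ (abs_nonneg _) (hb n _) 2⟩).symm
  simp_rw [hE1] at hm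
  simp_rw [hE2] at hv'
  -- Second order expansion of the characteristic function.
  have hmain : Tendsto (fun n : ℕ => s * ((n * ∫ ω, W n (Z 0 ω) ∂P : ℝ) : ℂ) * Complex.I -
      ((n * ∫ ω, W n (Z 0 ω) ^ 2 ∂P : ℝ) : ℂ) * s ^ 2 / 2) atTop
      (𝓝 (s * m * Complex.I - v * s ^ 2 / 2)) := by
    have h1 := (Complex.continuous_ofReal.tendsto m).comp hm
    have h2 := (Complex.continuous_ofReal.tendsto v).comp hv'
    exact ((h1.const_mul _).mul_const _).sub ((h2.mul_const _).div_const _)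
  have herr : Tendsto (fun n : ℕ => |s| ^ 3 * b n * (n * ∫ ω, W n (Z 0 ω) ^ 2 ∂P)) atTop (𝓝 0) := by
    have := (hb0.const_mul (|s| ^ 3)).mul hv'
    simpa using this
  have hb00 : ∀ n, 0 ≤ b n := fun n => (abs_nonneg _).trans (hb n (0, 0))
  have hsb : ∀ᶠ n in atTop, |s| * b n ≤ 1 := by
    have := hb0.const_mul |s|
    rw [mul_zero] at this
    exact (this.eventually (gt_mem_nhds one_pos)).mono fun n h => h.le
  refine (tendsto_of_tendsto_of_dist (f₁ := fun n : ℕ =>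
    s * ((n * ∫ ω, W n (Z 0 ω) ∂P : ℝ) : ℂ) * Complex.I -
      ((n * ∫ ω, W n (Z 0 ω) ^ 2 ∂P : ℝ) : ℂ) * s ^ 2 / 2) hmain ?_)
  refine squeeze_zero' (Eventually.of_forall fun _ => dist_nonneg) ?_ herr
  filter_upwards [hsb] with n hn
  have hpt : ∀ ω, ‖Complex.exp (s * W n (Z 0 ω) * Complex.I) - 1 -
      (s * W n (Z 0 ω) * Complex.I - (W n (Z 0 ω)) ^ 2 * s ^ 2 / 2)‖ ≤
      |s| ^ 3 * b n * W n (Z 0 ω) ^ 2 := by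
    intro ω
    set x := W n (Z 0 ω)
    have hx : |x| ≤ b n := hb n _
    have hnorm : ‖(s * x * Complex.I : ℂ)‖ = |s| * |x| := by simp
    have hle : ‖(s * x * Complex.I : ℂ)‖ ≤ 1 := by
      rw [hnorm]
      exact (mul_le_mul_of_nonneg_left hx (abs_nonneg s)).trans hn
    have h := Complex.exp_bound hle (n := 3) (by norm_num)
    rw [hnorm] at h
    have e : ∑ k ∈ Finset.range 3, (s * x * Complex.I : ℂ) ^ k / (k.factorial : ℂ) =
        1 + (s * x * Complex.I - x ^ 2 * s ^ 2 / 2) := by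
      simp only [Finset.sum_range_succ, Finset.sum_range_zero, Nat.factorial]
      have := Complex.I_sq
      push_cast
      linear_combination (s : ℂ) ^ 2 * x ^ 2 / 2 * this
    rw [e, ← sub_sub] at h
    refine h.trans ?_
    have h3 : |x| ^ 3 ≤ b n * x ^ 2 := by
      rw [pow_succ', sq_abs]
      exact mul_le_mul_of_nonneg_right hx (sq_nonneg x)
    have hfac : ((Nat.succ 3 : ℕ) : ℝ) * ((Nat.factorial 3 : ℝ) * (3 : ℕ))⁻¹ ≤ 1 := by
      norm_num [Nat.factorial]
    calc (|s| * |x|) ^ 3 * (((Nat.succ 3 : ℕ) : ℝ) * ((Nat.factorial 3 : ℝ) * (3 : ℕ))⁻¹)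
        ≤ (|s| * |x|) ^ 3 * 1 := by gcongr
      _ = |s| ^ 3 * |x| ^ 3 := by ring
      _ ≤ |s| ^ 3 * (b n * x ^ 2) := by gcongr
      _ = _ := by ring
  have hc1 : Integrable (fun ω => (s * (W n (Z 0 ω) : ℂ) * Complex.I)) P :=
    ((hW1 n).ofReal.const_mul _).mul_const _
  have hc2 : Integrable (fun ω => ((W n (Z 0 ω) : ℂ) ^ 2 * s ^ 2 / 2)) P := by
    have := (((hW2 n).ofReal (𝕜 := ℂ)).mul_const ((s : ℂ) ^ 2)).div_const 2
    simpa using this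
  have hsplit : R n - (s * ((∫ ω, W n (Z 0 ω) ∂P : ℝ) : ℂ) * Complex.I -
      ((∫ ω, W n (Z 0 ω) ^ 2 ∂P : ℝ) : ℂ) * s ^ 2 / 2) =
      ∫ ω, (Complex.exp (s * W n (Z 0 ω) * Complex.I) - 1 -
      (s * W n (Z 0 ω) * Complex.I - (W n (Z 0 ω) : ℂ) ^ 2 * s ^ 2 / 2)) ∂P := by
    have i1 : ∫ ω, (s * (W n (Z 0 ω) : ℂ) * Complex.I) ∂P =
        s * ((∫ ω, W n (Z 0 ω) ∂P : ℝ) : ℂ) * Complex.I := by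
      rw [integral_mul_const, integral_const_mul, integral_complex_ofReal]
    have i2 : ∫ ω, ((W n (Z 0 ω) : ℂ) ^ 2 * s ^ 2 / 2) ∂P =
        ((∫ ω, W n (Z 0 ω) ^ 2 ∂P : ℝ) : ℂ) * s ^ 2 / 2 := by
      rw [integral_div, integral_mul_const, ← integral_complex_ofReal]
      simp
    have hc0 : Integrable (fun ω => Complex.exp (s * W n (Z 0 ω) * Complex.I) - 1) P :=
      (hexp_int n).sub (integrable_const _)
    have hc3 : Integrable (fun ω => s * (W n (Z 0 ω) : ℂ) * Complex.I -
        (W n (Z 0 ω) : ℂ) ^ 2 * s ^ 2 / 2) P := hc1.sub hc2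
    rw [integral_sub hc0 hc3, integral_sub hc1 hc2, i1, i2]
  have hbd := norm_integral_le_of_norm_le ((hW2 n).const_mul (|s| ^ 3 * b n)) (ae_of_all _ hpt)
  rw [← hsplit, integral_const_mul] at hbd
  rw [dist_comm, dist_eq_norm]
  have : (n : ℂ) * R n - (s * ((n * ∫ ω, W n (Z 0 ω) ∂P : ℝ) : ℂ) * Complex.I -
      ((n * ∫ ω, W n (Z 0 ω) ^ 2 ∂P : ℝ) : ℂ) * s ^ 2 / 2) =
      n * (R n - (s * ((∫ ω, W n (Z 0 ω) ∂P : ℝ) : ℂ) * Complex.I -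
      ((∫ ω, W n (Z 0 ω) ^ 2 ∂P : ℝ) : ℂ) * s ^ 2 / 2)) := by
    push_cast
    ring
  rw [this, norm_mul, Complex.norm_natCast]
  calc (n : ℝ) * _ ≤ n * (|s| ^ 3 * b n * ∫ ω, W n (Z 0 ω) ^ 2 ∂P) := by gcongr
    _ = _ := by ring

end IsSubdensitySample

/-! ### The kernel and its boundary modifications -/

/-- A continuous function whose topological support lies in `[-1, 1]` vanishes outside the open
interval. -/
lemma eq_zero_of_tsupport_subset_Icc {φ : ℝ → ℝ} (hφ : Continuous φ)
    (hs : tsupport φ ⊆ Set.Icc (-1) 1) {u : ℝ} (hu : u ∉ Set.Ioo (-1 : ℝ) 1) : φ u = 0 := by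
  by_contra h
  have hopen : IsOpen (Function.support φ) := hφ.isOpen_support
  have hsub : Function.support φ ⊆ interior (Set.Icc (-1) 1) :=
    interior_maximal ((subset_tsupport φ).trans hs) hopen
  rw [interior_Icc] at hsub
  exact hu (hsub h)

namespace ConditionK

variable {k : ℝ → ℝ} (hK : ConditionK k)
include hK

lemma continuous : Continuous k := hK.contDiff.continuous

lemma contDiff_deriv : ContDiff ℝ 1 (deriv k) :=
  (contDiff_succ_iff_deriv.1 (by simpa [one_add_one_eq_two] using hK.contDiff : ContDiff ℝ (1 + 1) k)).2.2

lemma continuous_deriv : Continuous (deriv k) := hK.contDiff_deriv.continuous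

lemma continuous_deriv_deriv : Continuous (deriv (deriv k)) :=
  hK.contDiff_deriv.continuous_deriv le_rfl

lemma hasDerivAt (u : ℝ) : HasDerivAt k (deriv k u) u :=
  (hK.contDiff.differentiable (by norm_num) u).hasDerivAt

lemma hasDerivAt_deriv (u : ℝ) : HasDerivAt (deriv k) (deriv (deriv k) u) u :=
  (hK.contDiff_deriv.differentiable (by norm_num) u).hasDerivAt

lemma tsupport_deriv : tsupport (deriv k) ⊆ Set.Icc (-1) 1 :=
  tsupport_deriv_subset.trans hK.support_eq.le

lemma eq_zero {u : ℝ} (hu : u ∉ Set.Ioo (-1 : ℝ) 1) : k u = 0 :=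
  eq_zero_of_tsupport_subset_Icc hK.continuous hK.support_eq.le hu

lemma deriv_eq_zero {u : ℝ} (hu : u ∉ Set.Ioo (-1 : ℝ) 1) : deriv k u = 0 :=
  eq_zero_of_tsupport_subset_Icc hK.continuous_deriv hK.tsupport_deriv hu

lemma hasCompactSupport : HasCompactSupport k := by
  unfold HasCompactSupport
  rw [hK.support_eq]
  exact isCompact_Icc

/-- A common bound for the kernel and its first two derivatives. -/
lemma exists_bound : ∃ C > 0, ∀ u, |k u| ≤ C ∧ |deriv k u| ≤ C ∧ |deriv (deriv k) u| ≤ C := by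
  obtain ⟨A, hA⟩ := hK.continuous.bounded_above_of_compact_support hK.hasCompactSupport
  obtain ⟨B, hB⟩ := hK.continuous_deriv.bounded_above_of_compact_support hK.hasCompactSupport.deriv
  obtain ⟨D, hD⟩ := hK.continuous_deriv_deriv.bounded_above_of_compact_support
    hK.hasCompactSupport.deriv.deriv
  refine ⟨max 1 (max A (max B D)), lt_max_of_lt_left one_pos, fun u => ⟨?_, ?_, ?_⟩⟩
  · exact (hA u).trans (by simp)
  · exact (hB u).trans (by simp)
  · exact (hD u).trans (by simp)

lemma integrable_pow_mul (l : ℕ) : Integrable fun u => u ^ l * k u :=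
  ((continuous_pow l).mul hK.continuous).integrable_of_hasCompactSupport
    hK.hasCompactSupport.mul_left

lemma integrable : Integrable k := by simpa using hK.integrable_pow_mul 0

lemma integral_pow_mul_eq (l : ℕ) : ∫ u in (-1 : ℝ)..1, u ^ l * k u = ∫ u, u ^ l * k u := by
  refine intervalIntegral.integral_eq_integral_of_support_subset fun u hu => ?_
  by_contra h
  refine hu ?_
  have : k u = 0 := hK.eq_zero fun h' => h ⟨h'.1, h'.2.le⟩
  simp [this]

lemma integral_mul_eq_zero : ∫ u, u * k u = 0 := by
  have h := integral_neg_eq_self (fun u => u * k u) volume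
  simp only [hK.symmetric, neg_mul, integral_neg] at h
  linarith

lemma exists_pos_mem {β : ℝ} (hβ : -1 < β) : ∃ u ∈ Set.Ioo (-1) β, 0 < k u := by
  have h1 : (-1 : ℝ) ∈ tsupport k := by rw [hK.support_eq]; simp
  obtain ⟨u, hu, hku⟩ := mem_closure_iff_nhds.1 h1 (Set.Iio β) (Iio_mem_nhds hβ)
  have hu1 : u ∈ Set.Ioo (-1 : ℝ) 1 := by
    by_contra h
    exact hku (hK.eq_zero h)
  exact ⟨u, ⟨hu1.1, hu⟩, lt_of_le_of_ne (hK.nonneg u) (Ne.symm hku)⟩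

lemma secondMoment_pos : 0 < secondMoment k := by
  obtain ⟨u, hu, hku⟩ := hK.exists_pos_mem (β := 0) (by norm_num)
  exact ((continuous_pow 2).mul hK.continuous).integral_pos_of_hasCompactSupport_nonneg_nonzero
    hK.hasCompactSupport.mul_left (fun u => mul_nonneg (sq_nonneg u) (hK.nonneg u))
    (x := u) (mul_pos (sq_pos_of_neg hu.2) hku).ne'

lemma continuous_truncMoment (l : ℕ) : Continuous (truncMoment k l) :=
  intervalIntegral.continuous_primitive
    (fun _ _ => ((continuous_pow l).mul hK.continuous).intervalIntegrable _ _) _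

/-- The determinant in the boundary kernel is positive: a strict Cauchy-Schwarz inequality. It
equals `ν₀ ∫ (x - m)² k(x) dx` with `m = ν₁ / ν₀`. -/
lemma truncMoment_det_pos {β : ℝ} (hβ : -1 < β) :
    0 < truncMoment k 0 β * truncMoment k 2 β - truncMoment k 1 β ^ 2 := by
  obtain ⟨u, hu, hku⟩ := hK.exists_pos_mem hβ
  have h0 : 0 < truncMoment k 0 β := by
    refine intervalIntegral.integral_pos hβ
      ((continuous_pow 0).mul hK.continuous).continuousOn
      (fun x _ => by simpa using hK.nonneg x) ⟨u, ⟨hu.1.le, hu.2.le⟩, by simpa using hku⟩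
  set m := truncMoment k 1 β / truncMoment k 0 β with hm
  have hpos : 0 < ∫ x in (-1 : ℝ)..β, (x - m) ^ 2 * k x := by
    have hc : Continuous fun x : ℝ => (x - m) ^ 2 * k x := by
      have := hK.continuous
      fun_prop
    -- The kernel is positive on a whole interval, hence at some point other than `m`.
    obtain ⟨v, hv, hkv, hvm⟩ : ∃ v ∈ Set.Ioo (-1) β, 0 < k v ∧ v ≠ m := by
      by_cases hum : u = m
      · obtain ⟨v, hv, hkv⟩ := hK.exists_pos_mem (β := u) hu.1
        exact ⟨v, ⟨hv.1, hv.2.trans hu.2⟩, hkv, fun h => hv.2.ne (h.trans hum.symm)⟩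
      · exact ⟨u, hu, hku, hum⟩
    refine intervalIntegral.integral_pos hβ hc.continuousOn
      (fun x _ => mul_nonneg (sq_nonneg _) (hK.nonneg x)) ⟨v, ⟨hv.1.le, hv.2.le⟩, ?_⟩
    have : v - m ≠ 0 := sub_ne_zero.2 hvm
    positivity
  have hi : ∀ l : ℕ, IntervalIntegrable (fun x => x ^ l * k x) volume (-1) β := fun l =>
    ((continuous_pow l).mul hK.continuous).intervalIntegrable _ _
  have hexp : ∫ x in (-1 : ℝ)..β, (x - m) ^ 2 * k x =
      truncMoment k 2 β - 2 * m * truncMoment k 1 β + m ^ 2 * truncMoment k 0 β := by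
    have : ∀ x, (x - m) ^ 2 * k x =
        x ^ 2 * k x - 2 * m * (x ^ 1 * k x) + m ^ 2 * (x ^ 0 * k x) := fun x => by ring
    simp_rw [this]
    rw [intervalIntegral.integral_add (((hi 2).sub ((hi 1).const_mul _)))
      ((hi 0).const_mul _), intervalIntegral.integral_sub (hi 2) ((hi 1).const_mul _),
      intervalIntegral.integral_const_mul, intervalIntegral.integral_const_mul]
    rfl
  rw [hexp] at hpos
  have : truncMoment k 0 β * truncMoment k 2 β - truncMoment k 1 β ^ 2 =
      truncMoment k 0 β *
        (truncMoment k 2 β - 2 * m * truncMoment k 1 β + m ^ 2 * truncMoment k 0 β) := by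
    rw [hm]
    field_simp
    ring
  rw [this]
  exact mul_pos h0 hpos

/-- The boundary kernels are uniformly bounded. -/
lemma exists_bound_boundaryKernel :
    ∃ C > 0, ∀ β ∈ Set.Icc (0 : ℝ) 1, ∀ u, |boundaryKernel k β u| ≤ C := by
  obtain ⟨A, hA, hkA⟩ := hK.exists_bound
  have hc : ContinuousOn (fun β => (|truncMoment k 2 β| + |truncMoment k 1 β|) /
      (truncMoment k 0 β * truncMoment k 2 β - truncMoment k 1 β ^ 2) * A) (Set.Icc 0 1) := by
    have h := hK.continuous_truncMoment
    refine ContinuousOn.mul (ContinuousOn.div ?_ ?_ ?_) continuousOn_const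
    · exact ((h 2).abs.add (h 1).abs).continuousOn
    · exact (((h 0).mul (h 2)).sub ((h 1).pow 2)).continuousOn
    · exact fun β hβ => (hK.truncMoment_det_pos (by linarith [hβ.1])).ne'
  obtain ⟨C, hC⟩ := isCompact_Icc.exists_bound_of_continuousOn hc
  refine ⟨max C 1, lt_max_of_lt_right one_pos, fun β hβ u => ?_⟩
  have hD := hK.truncMoment_det_pos (β := β) (by linarith [hβ.1])
  refine le_trans ?_ (((le_abs_self _).trans (hC β hβ)).trans (le_max_left _ _))
  by_cases hu : u ∈ Set.Ioo (-1) β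
  · rw [boundaryKernel, Set.indicator_of_mem hu, abs_mul, abs_div, abs_of_pos hD]
    have hu1 : |u| ≤ 1 := abs_le.2 ⟨hu.1.le, hu.2.le.trans hβ.2⟩
    gcongr
    · calc |truncMoment k 2 β - truncMoment k 1 β * u|
          ≤ |truncMoment k 2 β| + |truncMoment k 1 β * u| := abs_sub _ _
        _ ≤ _ := by
            rw [abs_mul]
            gcongr
            exact mul_le_of_le_one_right (abs_nonneg _) hu1
    · exact (hkA u).1
  · rw [boundaryKernel, Set.indicator_of_notMem hu, abs_zero]
    positivity

/-- For a positive observation time `u`, a single formula describes the kernel term at `s`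
in the boundary region and in the interior: the truncation of the boundary kernel at `s / h` is
void because `(s - u) / h < s / h`, and the kernel `k^β` with `β = 1` is `k` itself. -/
lemma kernel_term_eq {h s u : ℝ} (hh : 0 < h) (hs : 0 ≤ s) (hu : 0 < u) :
    (if 0 ≤ s ∧ s ≤ h then 1 / h * boundaryKernel k (s / h) ((s - u) / h)
      else 1 / h * k ((s - u) / h)) =
    1 / h * ((truncMoment k 2 (min (s / h) 1) - truncMoment k 1 (min (s / h) 1) * ((s - u) / h)) /
      (truncMoment k 0 (min (s / h) 1) * truncMoment k 2 (min (s / h) 1) -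
        truncMoment k 1 (min (s / h) 1) ^ 2) * k ((s - u) / h)) := by
  split_ifs with hsh
  · rw [min_eq_left ((div_le_one hh).2 hsh.2)]
    congr 1
    by_cases hm : (s - u) / h ∈ Set.Ioo (-1) (s / h)
    · rw [boundaryKernel, Set.indicator_of_mem hm]
    · rw [boundaryKernel, Set.indicator_of_notMem hm, hK.eq_zero, mul_zero]
      intro hm'
      exact hm ⟨hm'.1, by gcongr; linarith⟩
  · have hsh' : h < s := by
      by_contra hc
      exact hsh ⟨hs, not_lt.1 hc⟩
    rw [min_eq_right ((one_le_div hh).2 hsh'.le)]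
    have h0 : truncMoment k 0 1 = 1 := by
      rw [truncMoment, hK.integral_pow_mul_eq]
      simpa using hK.integral_eq_one
    have h1 : truncMoment k 1 1 = 0 := by
      rw [truncMoment, hK.integral_pow_mul_eq]
      simpa using hK.integral_mul_eq_zero
    have h2 := hK.truncMoment_det_pos (β := 1) (by norm_num)
    rw [h0, h1] at *
    simp only [one_mul, ne_eq, OfNat.ofNat_ne_zero, not_false_eq_true, zero_pow, sub_zero,
      zero_mul] at *
    rw [div_self h2.ne', one_mul]

/-- With positive observation times, the kernel subdensity estimators are continuous on
`[0, ∞)`. -/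
lemma continuousOn_subdensityEst {h : ℝ} (hh : 0 < h) {z : ℕ → ℝ × Fin 2}
    (hz : ∀ j, 0 < (z j).1) (n : ℕ) (i : Fin 2) :
    ContinuousOn (subdensityEst k h z n i) (Set.Ici 0) := by
  have hterm : ∀ u, 0 < u → ContinuousOn (fun s => if 0 ≤ s ∧ s ≤ h then
      1 / h * boundaryKernel k (s / h) ((s - u) / h) else 1 / h * k ((s - u) / h)) (Set.Ici 0) := by
    intro u hu
    refine ContinuousOn.congr ?_ fun s hs => hK.kernel_term_eq hh hs hu
    have hb : Continuous fun s => min (s / h) 1 := by fun_prop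
    have ht := fun l => (hK.continuous_truncMoment l).comp hb
    have hl : Continuous fun s : ℝ => (s - u) / h := by fun_prop
    refine continuousOn_const.mul (ContinuousOn.mul (ContinuousOn.div ?_ ?_ ?_) ?_)
    · exact ((ht 2).sub ((ht 1).mul hl)).continuousOn
    · exact (((ht 0).mul (ht 2)).sub ((ht 1).pow 2)).continuousOn
    · intro s hs
      refine (hK.truncMoment_det_pos (lt_min ?_ (by norm_num))).ne'
      have : 0 ≤ s / h := div_nonneg hs hh.le
      linarith
    · exact (hK.continuous.comp hl).continuousOn
  have : subdensityEst k h z n i = fun s => 1 / (n : ℝ) * ∑ j ∈ Finset.range n,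
      if (z j).2 = i then (if 0 ≤ s ∧ s ≤ h then
        1 / h * boundaryKernel k (s / h) ((s - (z j).1) / h) else
          1 / h * k ((s - (z j).1) / h)) else 0 := by
    funext s
    unfold subdensityEst empiricalIntegral
    split_ifs <;> rfl
  rw [this]
  refine continuousOn_const.mul (continuousOn_finsetSum _ fun j _ => ?_)
  split_ifs
  · exact hterm _ (hz j)
  · exact continuousOn_const

end ConditionK

/-- In the boundary region only the observation times in a neighbourhood of the origin matter. -/
lemma abs_boundary_term_le {C : ℝ}
    (hC : ∀ β ∈ Set.Icc (0 : ℝ) 1, ∀ u, |boundaryKernel k β u| ≤ C) {h s u : ℝ}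
    (hh : 0 < h) (hs : 0 ≤ s) (hsh : s ≤ h) :
    |1 / h * boundaryKernel k (s / h) ((s - u) / h)| ≤
      C / h * (Set.Iic (2 * h)).indicator 1 u := by
  have hC0 : 0 ≤ C := (abs_nonneg _).trans (hC 0 (by simp) 0)
  by_cases hu : u ∈ Set.Iic (2 * h)
  · rw [Set.indicator_of_mem hu, abs_mul, abs_of_pos (by positivity)]
    have := hC (s / h) ⟨div_nonneg hs hh.le, (div_le_one hh).2 hsh⟩ ((s - u) / h)
    calc 1 / h * |boundaryKernel k (s / h) ((s - u) / h)| ≤ 1 / h * C := by gcongr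
      _ = C / h * (1 : ℝ → ℝ) u := by simp; ring
  · have : boundaryKernel k (s / h) ((s - u) / h) = 0 := by
      rw [boundaryKernel, Set.indicator_of_notMem]
      intro hm
      have h1 := hm.1
      rw [lt_div_iff₀ hh] at h1
      exact hu (by simp only [Set.mem_Iic]; linarith)
    rw [this, Set.indicator_of_notMem hu]
    simp

/-! ### Expectations of kernel functionals -/

lemma integral_kernel_comp (φ q : ℝ → ℝ) {h : ℝ} (hh : 0 < h) (s : ℝ) :
    ∫ u, φ ((s - u) / h) * q u = h * ∫ v, φ v * q (s - h * v) := by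
  have h1 := Measure.integral_comp_mul_left (fun x => φ (x / h) * q (s - x)) h
  have h2 := integral_sub_left_eq_self (fun x => φ (x / h) * q (s - x)) volume s
  simp only [sub_sub_cancel] at h2
  rw [h2]
  have h3 : ∀ v : ℝ, h * v / h = v := fun v => by field_simp
  simp only [h3, smul_eq_mul, abs_of_pos (inv_pos.2 hh)] at h1
  rw [h1]
  field_simp

/-- The kernel is an approximate identity at points of continuity. -/
lemma tendsto_integral_kernel {φ χ : ℝ → ℝ} (hφ : Continuous φ)
    (hφ0 : ∀ u, u ∉ Set.Ioo (-1 : ℝ) 1 → φ u = 0) (hχ : Measurable χ) {t : ℝ}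
    (hχt : ContinuousAt χ t) {h : ℕ → ℝ} (hh : Tendsto h atTop (𝓝 0)) :
    Tendsto (fun n => ∫ v, φ v * χ (t - h n * v)) atTop (𝓝 ((∫ v, φ v) * χ t)) := by
  have hcs : HasCompactSupport φ :=
    HasCompactSupport.intro (isCompact_Icc (a := (-1 : ℝ)) (b := 1))
      fun u hu => hφ0 u fun h => hu ⟨h.1.le, h.2.le⟩
  have hint : Integrable φ := hφ.integrable_of_hasCompactSupport hcs
  obtain ⟨δ, hδ, hδχ⟩ := Metric.continuousAt_iff.1 hχt 1 one_pos
  rw [← integral_mul_const]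
  refine tendsto_integral_filter_of_dominated_convergence (fun v => |φ v| * (|χ t| + 1)) ?_ ?_ ?_ ?_
  · exact Eventually.of_forall fun n => (hφ.measurable.mul (hχ.comp (by fun_prop))).aestronglyMeasurable
  · have := hh.eventually (Metric.ball_mem_nhds 0 hδ)
    filter_upwards [this] with n hn
    refine ae_of_all _ fun v => ?_
    rw [norm_mul, Real.norm_eq_abs, Real.norm_eq_abs]
    by_cases hv : v ∈ Set.Ioo (-1 : ℝ) 1
    · gcongr
      have hv1 : |v| ≤ 1 := abs_le.2 ⟨hv.1.le, hv.2.le⟩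
      have hd : dist (t - h n * v) t < δ := by
        rw [Real.dist_eq, sub_sub_cancel_left, abs_neg, abs_mul]
        rw [dist_zero_right, Real.norm_eq_abs] at hn
        exact (mul_le_of_le_one_right (abs_nonneg _) hv1).trans_lt hn
      have := hδχ hd
      rw [Real.dist_eq] at this
      linarith [abs_sub_abs_le_abs_sub (χ (t - h n * v)) (χ t)]
    · simp [hφ0 v hv]
  · exact hint.abs.mul_const _
  · refine ae_of_all _ fun v => Tendsto.const_mul _ ?_
    refine hχt.tendsto.comp ?_
    simpa using tendsto_const_nhds.sub (hh.mul_const v)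

/-- The second order bias of a symmetric kernel at a zero `t` of `χ`: the linear term of the
expansion drops out. -/
lemma ConditionK.tendsto_bias {k : ℝ → ℝ} (hK : ConditionK k) {χ : ℝ → ℝ} (hχ : Measurable χ)
    {t a b : ℝ}
    (hexp : (fun x => χ (t + x) - (a * x + b * x ^ 2)) =o[𝓝 0] fun x => x ^ 2)
    {h : ℕ → ℝ} (hh : Tendsto h atTop (𝓝 0)) (hpos : ∀ᶠ n in atTop, 0 < h n) :
    Tendsto (fun n => (h n)⁻¹ ^ 2 * ∫ v, k v * χ (t - h n * v)) atTop
      (𝓝 (b * secondMoment k)) := by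
  let r : ℝ → ℝ := fun x => χ (t + x) - (a * x + b * x ^ 2)
  have hr : Measurable r := by
    have : Measurable fun x => χ (t + x) := hχ.comp (by fun_prop)
    exact this.sub (by fun_prop)
  -- The normalized remainder is dominated by the kernel and vanishes pointwise.
  have hrem : Tendsto (fun n => ∫ v, (h n)⁻¹ ^ 2 * (k v * r (-(h n * v)))) atTop
      (𝓝 (∫ _ : ℝ, (0 : ℝ))) := by
    have hb := hexp.def one_pos
    obtain ⟨δ, hδ, hδr⟩ := Metric.eventually_nhds_iff.1 hb
    refine tendsto_integral_filter_of_dominated_convergence (fun v => k v) ?_ ?_ hK.integrable ?_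
    · exact Eventually.of_forall fun n => (measurable_const.mul
        (hK.continuous.measurable.mul (hr.comp (by fun_prop)))).aestronglyMeasurable
    · filter_upwards [hpos, hh.eventually (Metric.ball_mem_nhds 0 hδ)] with n hn hnδ
      refine ae_of_all _ fun v => ?_
      by_cases hv : v ∈ Set.Ioo (-1 : ℝ) 1
      · have hv1 : |v| ≤ 1 := abs_le.2 ⟨hv.1.le, hv.2.le⟩
        have hd : dist (-(h n * v)) 0 < δ := by
          rw [dist_zero_right, norm_neg, Real.norm_eq_abs, abs_mul]
          rw [dist_zero_right, Real.norm_eq_abs] at hnδ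
          exact (mul_le_of_le_one_right (abs_nonneg _) hv1).trans_lt hnδ
        have h1 := hδr hd
        rw [one_mul] at h1
        have h2 : ‖(-(h n * v)) ^ 2‖ ≤ h n ^ 2 := by
          rw [Real.norm_eq_abs, neg_sq, mul_pow, abs_of_nonneg (by positivity)]
          have : v ^ 2 ≤ 1 := by rw [← sq_abs]; exact pow_le_one₀ (abs_nonneg v) hv1
          exact mul_le_of_le_one_right (by positivity) this
        rw [norm_mul, norm_mul, Real.norm_of_nonneg (hK.nonneg v),
          Real.norm_of_nonneg (by positivity)]
        have h3 := h1.trans h2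
        calc (h n)⁻¹ ^ 2 * (k v * ‖r (-(h n * v))‖) ≤ (h n)⁻¹ ^ 2 * (k v * h n ^ 2) := by
              have := hK.nonneg v
              gcongr
          _ = k v := by field_simp
      · simp [hK.eq_zero hv]
    · refine ae_of_all _ fun v => ?_
      have hx : Tendsto (fun n => -(h n * v)) atTop (𝓝 0) := by
        simpa using (hh.mul_const v).neg
      have ho := (hexp.comp_tendsto hx).tendsto_div_nhds_zero
      have := ho.const_mul (k v * v ^ 2)
      rw [mul_zero] at this
      refine this.congr' ?_
      filter_upwards [hpos] with n hn
      by_cases hv : v = 0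
      · have hr0 : r 0 = 0 := by
          have := (hexp.def one_pos).self_of_nhds
          simp only [ne_eq, OfNat.ofNat_ne_zero, not_false_eq_true, zero_pow, norm_zero, mul_zero,
            norm_le_zero_iff] at this
          simpa [r] using this
        simp [hv, hr0]
      · simp only [Function.comp_apply, r]
        field_simp
  have hmain : Tendsto (fun n => b * secondMoment k +
      ∫ v, (h n)⁻¹ ^ 2 * (k v * r (-(h n * v)))) atTop (𝓝 (b * secondMoment k)) := by
    simpa using hrem.const_add (b * secondMoment k)
  refine hmain.congr' ?_
  have hev : ∀ᶠ n in atTop, Integrable fun v => k v * r (-(h n * v)) := by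
    have hb := hexp.def one_pos
    obtain ⟨δ, hδ, hδr⟩ := Metric.eventually_nhds_iff.1 hb
    filter_upwards [hh.eventually (Metric.ball_mem_nhds 0 hδ)] with n hnδ
    refine (hK.integrable.const_mul (h n ^ 2)).mono'
      (hK.continuous.measurable.mul (hr.comp (by fun_prop))).aestronglyMeasurable
      (ae_of_all _ fun v => ?_)
    by_cases hv : v ∈ Set.Ioo (-1 : ℝ) 1
    · have hv1 : |v| ≤ 1 := abs_le.2 ⟨hv.1.le, hv.2.le⟩
      have hd : dist (-(h n * v)) 0 < δ := by
        rw [dist_zero_right, norm_neg, Real.norm_eq_abs, abs_mul]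
        rw [dist_zero_right, Real.norm_eq_abs] at hnδ
        exact (mul_le_of_le_one_right (abs_nonneg _) hv1).trans_lt hnδ
      have h1 := hδr hd
      rw [one_mul] at h1
      have h2 : ‖(-(h n * v)) ^ 2‖ ≤ h n ^ 2 := by
        rw [Real.norm_eq_abs, neg_sq, mul_pow, abs_of_nonneg (by positivity)]
        have : v ^ 2 ≤ 1 := by rw [← sq_abs]; exact pow_le_one₀ (abs_nonneg v) hv1
        exact mul_le_of_le_one_right (by positivity) this
      rw [norm_mul, Real.norm_of_nonneg (hK.nonneg v), mul_comm]
      exact mul_le_mul_of_nonneg_right (h1.trans h2) (hK.nonneg v)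
    · simp [hK.eq_zero hv]
  filter_upwards [hpos, hev] with n hn hi
  have hdec : ∀ v, k v * χ (t - h n * v) =
      k v * r (-(h n * v)) + (-(a * h n) * (v ^ 1 * k v) + b * h n ^ 2 * (v ^ 2 * k v)) := by
    intro v
    simp only [r, ← sub_eq_add_neg]
    ring
  have hi1 := (hK.integrable_pow_mul 1).const_mul (-(a * h n))
  have hi2 := (hK.integrable_pow_mul 2).const_mul (b * h n ^ 2)
  have hi3 : Integrable fun v => -(a * h n) * (v ^ 1 * k v) + b * h n ^ 2 * (v ^ 2 * k v) :=
    hi1.add hi2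
  simp_rw [hdec]
  rw [integral_add hi hi3, integral_add hi1 hi2, integral_const_mul,
    integral_const_mul, integral_const_mul]
  have h0 : ∫ v, v ^ 1 * k v = 0 := by simpa using hK.integral_mul_eq_zero
  rw [h0]
  unfold secondMoment
  field_simp
  ring

lemma ConditionK.integral_deriv {k : ℝ → ℝ} (hK : ConditionK k) : ∫ v, deriv k v = 0 := by
  have h : ∫ v in (-1 : ℝ)..1, deriv k v = ∫ v, deriv k v := by
    refine intervalIntegral.integral_eq_integral_of_support_subset fun u hu => ?_
    by_contra h
    exact hu (hK.deriv_eq_zero fun h' => h ⟨h'.1, h'.2.le⟩)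
  rw [← h, intervalIntegral.integral_eq_sub_of_hasDerivAt (fun x _ => hK.hasDerivAt x)
    (hK.continuous_deriv.intervalIntegrable _ _), hK.eq_zero (by simp), hK.eq_zero (by simp),
    sub_zero]

lemma ConditionK.integral_mul_deriv {k : ℝ → ℝ} (hK : ConditionK k) :
    ∫ v, v * deriv k v = -1 := by
  have h : ∫ v in (-1 : ℝ)..1, v * deriv k v = ∫ v, v * deriv k v := by
    refine intervalIntegral.integral_eq_integral_of_support_subset fun u hu => ?_
    by_contra h
    refine hu ?_
    simp only [hK.deriv_eq_zero fun h' => h ⟨h'.1, h'.2.le⟩, mul_zero]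
  have h1 := hK.integral_pow_mul_eq 0
  simp only [pow_zero, one_mul, hK.integral_eq_one] at h1
  rw [← h, intervalIntegral.integral_mul_deriv_eq_deriv_mul (u := fun x => x) (u' := fun _ => 1)
    (fun x _ => hasDerivAt_id x) (fun x _ => hK.hasDerivAt x)
    intervalIntegrable_const (hK.continuous_deriv.intervalIntegrable _ _)]
  simp only [one_mul, h1, hK.eq_zero (u := 1) (by simp), hK.eq_zero (u := -1) (by simp)]
  norm_num

/-- Uniform convergence of the expected derivative of the kernel estimator, on an interval in
whose neighbourhood the density is continuously differentiable. -/
lemma ConditionK.eventually_abs_deriv_mean_sub_lt {k : ℝ → ℝ} (hK : ConditionK k)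
    {q q' : ℝ → ℝ} (hq : Measurable q) {a b r : ℝ} (hr : 0 < r)
    (hd : ∀ x ∈ Set.Icc (a - r) (b + r), HasDerivAt q (q' x) x)
    (hc : ContinuousOn q' (Set.Icc (a - r) (b + r)))
    {h : ℕ → ℝ} (hh : Tendsto h atTop (𝓝 0)) (hpos : ∀ᶠ n in atTop, 0 < h n) {ε : ℝ}
    (hε : 0 < ε) :
    ∀ᶠ n in atTop, ∀ s ∈ Set.Icc a b,
      |(∫ u, (h n)⁻¹ ^ 2 * deriv k ((s - u) / h n) * q u) - q' s| < ε := by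
  obtain ⟨C, hC, hkC⟩ := hK.exists_bound
  have huc := isCompact_Icc.uniformContinuousOn_of_continuous hc
  obtain ⟨δ, hδ, hδq⟩ := Metric.uniformContinuousOn_iff.1 huc (ε / (4 * C)) (by positivity)
  filter_upwards [hpos, hh.eventually (Metric.ball_mem_nhds 0 (lt_min hδ hr))] with n hn hnδ s hs
  rw [dist_zero_right, Real.norm_eq_abs, abs_of_pos hn, lt_min_iff] at hnδ
  have hsmem : s ∈ Set.Icc (a - r) (b + r) := ⟨by linarith [hs.1], by linarith [hs.2]⟩
  have e1 : ∫ u, (h n)⁻¹ ^ 2 * deriv k ((s - u) / h n) * q u =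
      ∫ v, (h n)⁻¹ * (deriv k v * q (s - h n * v)) := by
    simp_rw [mul_assoc]
    rw [integral_const_mul, integral_kernel_comp _ _ hn, integral_const_mul]
    field_simp
  let B : ℝ → ℝ := fun v => (h n)⁻¹ * (q (s - h n * v) - q s) + v * q' s
  -- The mean value theorem controls the bracket on the support of the kernel.
  have hB : ∀ v ∈ Set.Ioo (-1 : ℝ) 1, |B v| ≤ ε / (4 * C) := by
    intro v hv
    have hv1 : |v| ≤ 1 := abs_le.2 ⟨hv.1.le, hv.2.le⟩
    have hnear : ∀ x ∈ Set.uIcc s (s - h n * v), |x - s| ≤ h n := by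
      intro x hx
      have h1 := Set.abs_sub_left_of_mem_uIcc hx
      have h2 : |s - h n * v - s| ≤ h n := by
        rw [sub_sub_cancel_left, abs_neg, abs_mul, abs_of_pos hn]
        exact mul_le_of_le_one_right hn.le hv1
      exact h1.trans h2
    have hmem : ∀ x ∈ Set.uIcc s (s - h n * v), x ∈ Set.Icc (a - r) (b + r) := by
      intro x hx
      have := abs_le.1 (hnear x hx)
      exact ⟨by linarith [hs.1], by linarith [hs.2]⟩
    have hmv := (convex_uIcc s (s - h n * v)).norm_image_sub_le_of_norm_hasDerivWithin_le
      (f := fun x => q x - q' s * x) (f' := fun x => q' x - q' s * 1) (C := ε / (4 * C))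
      (fun x hx => ((hd x (hmem x hx)).sub ((hasDerivAt_id x).const_mul _)).hasDerivWithinAt)
      (fun x hx => by
        have := hδq x (hmem x hx) s hsmem (by
          rw [Real.dist_eq]
          exact (hnear x hx).trans_lt hnδ.1)
        rw [mul_one, Real.norm_eq_abs]
        exact this.le)
      Set.left_mem_uIcc Set.right_mem_uIcc
    have hBv : B v = (h n)⁻¹ * ((q (s - h n * v) - q' s * (s - h n * v)) - (q s - q' s * s)) := by
      simp only [B]
      field_simp
      ring
    rw [hBv, abs_mul, abs_of_pos (inv_pos.2 hn), inv_mul_le_iff₀ hn]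
    refine hmv.trans ?_
    rw [sub_sub_cancel_left, norm_neg, norm_mul, Real.norm_of_nonneg hn.le, Real.norm_eq_abs,
      mul_comm]
    gcongr
    exact mul_le_of_le_one_right hn.le hv1
  have hBm : Measurable B :=
    ((hq.comp (by fun_prop : Measurable fun v => s - h n * v)).sub_const _).const_mul _
      |>.add (by fun_prop)
  have hbd : ∀ v, ‖deriv k v * B v‖ ≤ (Set.Ioo (-1 : ℝ) 1).indicator (fun _ => ε / 4) v := by
    intro v
    by_cases hv : v ∈ Set.Ioo (-1 : ℝ) 1
    · rw [Set.indicator_of_mem hv, norm_mul, Real.norm_eq_abs, Real.norm_eq_abs]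
      calc |deriv k v| * |B v| ≤ C * (ε / (4 * C)) := by
            have := hB v hv
            have := (hkC v).2.1
            gcongr
        _ = ε / 4 := by field_simp
    · rw [Set.indicator_of_notMem hv, hK.deriv_eq_zero hv]
      simp
  have hindint : Integrable ((Set.Ioo (-1 : ℝ) 1).indicator fun _ => ε / 4) :=
    (integrable_indicator_iff measurableSet_Ioo).2 (integrableOn_const (by simp))
  have hi : Integrable fun v => deriv k v * B v :=
    hindint.mono' (hK.continuous_deriv.measurable.mul hBm).aestronglyMeasurable
      (ae_of_all _ hbd)
  have hk1 : Integrable (deriv k) :=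
    hK.continuous_deriv.integrable_of_hasCompactSupport hK.hasCompactSupport.deriv
  have hk2 : Integrable fun v => v * deriv k v :=
    (continuous_id.mul hK.continuous_deriv).integrable_of_hasCompactSupport
      hK.hasCompactSupport.deriv.mul_left
  have e2 : ∫ v, (h n)⁻¹ * (deriv k v * q (s - h n * v)) = (∫ v, deriv k v * B v) + q' s := by
    have : ∀ v, (h n)⁻¹ * (deriv k v * q (s - h n * v)) =
        deriv k v * B v + ((h n)⁻¹ * q s * deriv k v - q' s * (v * deriv k v)) := by
      intro v
      simp only [B]
      ring
    simp_rw [this]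
    have hk3 : Integrable fun v => (h n)⁻¹ * q s * deriv k v - q' s * (v * deriv k v) :=
      (hk1.const_mul _).sub (hk2.const_mul _)
    rw [integral_add hi hk3,
      integral_sub (hk1.const_mul _) (hk2.const_mul _), integral_const_mul, integral_const_mul,
      hK.integral_deriv, hK.integral_mul_deriv]
    ring
  rw [e1, e2, add_sub_cancel_right]
  have := norm_integral_le_of_norm_le hindint (ae_of_all _ hbd)
  rw [integral_indicator measurableSet_Ioo, setIntegral_const] at this
  simp only [Real.volume_real_Ioo, smul_eq_mul] at this
  rw [Real.norm_eq_abs] at this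
  norm_num at this
  linarith

/-! ### The integrated kernel -/

/-- The distribution function `y ↦ ∫ u in -1..y, k u` of the kernel. -/
noncomputable def kernelCDF (k : ℝ → ℝ) (y : ℝ) : ℝ := ∫ u in (-1 : ℝ)..y, k u

namespace ConditionK

variable {k : ℝ → ℝ} (hK : ConditionK k)
include hK

lemma hasDerivAt_kernelCDF (y : ℝ) : HasDerivAt (kernelCDF k) (k y) y :=
  intervalIntegral.integral_hasDerivAt_right (hK.continuous.intervalIntegrable _ _)
    (hK.continuous.stronglyMeasurableAtFilter _ _) hK.continuous.continuousAt

lemma continuous_kernelCDF : Continuous (kernelCDF k) :=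
  continuous_iff_continuousAt.2 fun y => (hK.hasDerivAt_kernelCDF y).continuousAt

lemma monotone_kernelCDF : Monotone (kernelCDF k) :=
  monotone_of_deriv_nonneg (fun y => (hK.hasDerivAt_kernelCDF y).differentiableAt) fun y => by
    rw [(hK.hasDerivAt_kernelCDF y).deriv]
    exact hK.nonneg y

lemma kernelCDF_of_le {y : ℝ} (hy : y ≤ -1) : kernelCDF k y = 0 := by
  unfold kernelCDF
  rw [intervalIntegral.integral_symm, intervalIntegral.integral_congr (g := fun _ => (0 : ℝ))]
  · simp
  · intro u hu
    rw [Set.uIcc_of_le hy] at hu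
    exact hK.eq_zero fun h => absurd h.1 (not_lt.2 hu.2)

lemma kernelCDF_of_ge {y : ℝ} (hy : 1 ≤ y) : kernelCDF k y = 1 := by
  unfold kernelCDF
  rw [intervalIntegral.integral_eq_integral_of_support_subset, hK.integral_eq_one]
  intro u hu
  have : u ∈ Set.Ioo (-1 : ℝ) 1 := by
    by_contra h
    exact hu (hK.eq_zero h)
  exact ⟨this.1, this.2.le.trans hy⟩

lemma kernelCDF_nonneg (y : ℝ) : 0 ≤ kernelCDF k y := by
  rcases le_total y (-1) with h | h
  · rw [hK.kernelCDF_of_le h]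
  · rw [← hK.kernelCDF_of_le le_rfl]
    exact hK.monotone_kernelCDF h

lemma kernelCDF_le_one (y : ℝ) : kernelCDF k y ≤ 1 := by
  rcases le_total 1 y with h | h
  · rw [hK.kernelCDF_of_ge h]
  · rw [← hK.kernelCDF_of_ge le_rfl]
    exact hK.monotone_kernelCDF h

lemma abs_kernelCDF_sub_le {C : ℝ} (hC : ∀ u, |k u| ≤ C) (x y : ℝ) :
    |kernelCDF k x - kernelCDF k y| ≤ C * |x - y| := by
  have := convex_univ.norm_image_sub_le_of_norm_hasDerivWithin_le (f := kernelCDF k) (f' := k)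
    (C := C) (fun x _ => (hK.hasDerivAt_kernelCDF x).hasDerivWithinAt) (fun x _ => hC x)
    (Set.mem_univ y) (Set.mem_univ x)
  simpa using this

/-- The smoothed indicator of a half-line differs from the indicator only near the end point. -/
lemma abs_kernelCDF_sub_indicator_le {h : ℝ} (hh : 0 < h) (s x : ℝ) :
    |kernelCDF k ((s - x) / h) - (Set.Iic s).indicator 1 x| ≤
      (Set.Icc (s - h) (s + h)).indicator 1 x := by
  by_cases hx : x ∈ Set.Icc (s - h) (s + h)
  · have h0 := hK.kernelCDF_nonneg ((s - x) / h)
    have h1 := hK.kernelCDF_le_one ((s - x) / h)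
    rw [Set.indicator_of_mem hx, abs_le]
    by_cases hxs : x ∈ Set.Iic s
    · rw [Set.indicator_of_mem hxs]
      simp only [Pi.one_apply]
      constructor <;> linarith
    · rw [Set.indicator_of_notMem hxs]
      simp only [Pi.one_apply]
      constructor <;> linarith
  · rw [Set.indicator_of_notMem hx]
    simp only [Set.mem_Icc, not_and_or, not_le] at hx
    rcases hx with hx | hx
    · have : 1 ≤ (s - x) / h := by rw [le_div_iff₀ hh]; linarith
      rw [hK.kernelCDF_of_ge this, Set.indicator_of_mem (by simp only [Set.mem_Iic]; linarith)]
      simp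
    · have : (s - x) / h ≤ -1 := by rw [div_le_iff₀ hh]; linarith
      rw [hK.kernelCDF_of_le this, Set.indicator_of_notMem (by simp only [Set.mem_Iic]; linarith)]
      simp

lemma integral_scaled_kernel (h x s : ℝ) :
    ∫ u in (0 : ℝ)..s, 1 / h * k ((u - x) / h) =
      kernelCDF k ((s - x) / h) - kernelCDF k ((0 - x) / h) := by
  refine intervalIntegral.integral_eq_sub_of_hasDerivAt
    (f := fun u => kernelCDF k ((u - x) / h)) (fun u _ => ?_) ?_
  · have h1 : HasDerivAt (fun u => (u - x) / h) (1 / h) u :=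
      ((hasDerivAt_id u).sub_const x).div_const h
    rw [mul_comm]
    exact (hK.hasDerivAt_kernelCDF ((u - x) / h)).comp u h1
  · have : Continuous fun u => 1 / h * k ((u - x) / h) := by
      have := hK.continuous
      fun_prop
    exact this.intervalIntegrable _ _

/-- Uniform convergence of the expected integrated kernel estimator. No regularity of the density
is needed: the smoothed indicators differ from indicators on intervals of length `2 h` only, whose
mass vanishes uniformly by absolute continuity. -/
lemma eventually_abs_integrated_mean_sub_lt {q : ℝ → ℝ} (hq : Integrable q) (hq0 : ∀ u, 0 ≤ q u)
    {h : ℕ → ℝ} (hh : Tendsto h atTop (𝓝 0)) (hpos : ∀ᶠ n in atTop, 0 < h n) {ε : ℝ}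
    (hε : 0 < ε) :
    ∀ᶠ n in atTop, ∀ s, 0 ≤ s →
      |(∫ u, (kernelCDF k ((s - u) / h n) - kernelCDF k ((0 - u) / h n)) * q u) -
        ∫ u in (0 : ℝ)..s, q u| < ε := by
  have hfin : ∫⁻ u, ENNReal.ofReal (q u) ≠ ⊤ :=
    ((hasFiniteIntegral_iff_ofReal (ae_of_all _ hq0)).1 hq.2).ne
  obtain ⟨δ, hδ, hδq⟩ := exists_pos_setLIntegral_lt_of_measure_lt hfin
    (ε := ENNReal.ofReal (ε / 2)) (by simpa using hε)
  have hsmall : ∀ᶠ n in atTop, ENNReal.ofReal (2 * h n) < δ := by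
    have : Tendsto (fun n => ENNReal.ofReal (2 * h n)) atTop (𝓝 0) := by
      have := ENNReal.tendsto_ofReal (hh.const_mul 2)
      simpa using this
    exact this.eventually (gt_mem_nhds hδ)
  filter_upwards [hpos, hsmall] with n hn hnδ s hs
  have hint : ∀ x, ∫ u, (Set.Icc (x - h n) (x + h n)).indicator 1 u * q u < ε / 2 := by
    intro x
    have e : ∀ u, (Set.Icc (x - h n) (x + h n)).indicator (1 : ℝ → ℝ) u * q u =
        (Set.Icc (x - h n) (x + h n)).indicator q u := by
      intro u
      by_cases hu : u ∈ Set.Icc (x - h n) (x + h n) <;> simp [hu]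
    simp_rw [e]
    rw [integral_indicator measurableSet_Icc, integral_eq_lintegral_of_nonneg_ae
      (ae_of_all _ hq0) hq.aestronglyMeasurable.restrict]
    refine ENNReal.toReal_lt_of_lt_ofReal (hδq _ ?_)
    rw [Real.volume_Icc]
    convert hnδ using 2
    ring
  have hind : ∀ x, Integrable fun u => (Set.Icc (x - h n) (x + h n)).indicator 1 u * q u := by
    intro x
    refine hq.bdd_mul (c := 1) (measurable_one.indicator measurableSet_Icc).aestronglyMeasurable
      (ae_of_all _ fun u => ?_)
    by_cases hu : u ∈ Set.Icc (x - h n) (x + h n) <;> simp [hu]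
  have hcdf : ∀ x, Integrable fun u => kernelCDF k ((x - u) / h n) * q u := by
    intro x
    have hc : Continuous fun u => kernelCDF k ((x - u) / h n) := by
      have := hK.continuous_kernelCDF
      fun_prop
    refine hq.bdd_mul (c := 1) hc.aestronglyMeasurable (ae_of_all _ fun u => ?_)
    rw [Real.norm_of_nonneg (hK.kernelCDF_nonneg _)]
    exact hK.kernelCDF_le_one _
  have hIic : ∀ x, Integrable fun u => (Set.Iic x).indicator 1 u * q u := by
    intro x
    refine hq.bdd_mul (c := 1) (measurable_one.indicator measurableSet_Iic).aestronglyMeasurable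
      (ae_of_all _ fun u => ?_)
    by_cases hu : u ∈ Set.Iic x <;> simp [hu]
  have hone : ∀ x, |(∫ u, kernelCDF k ((x - u) / h n) * q u) -
      ∫ u, (Set.Iic x).indicator 1 u * q u| < ε / 2 := by
    intro x
    rw [← integral_sub (hcdf x) (hIic x), ← Real.norm_eq_abs]
    refine (norm_integral_le_of_norm_le (hind x) (ae_of_all _ fun u => ?_)).trans_lt (hint x)
    rw [← sub_mul, norm_mul, Real.norm_of_nonneg (hq0 u), Real.norm_eq_abs]
    exact mul_le_mul_of_nonneg_right (hK.abs_kernelCDF_sub_indicator_le hn x u) (hq0 u)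
  have e1 : ∫ u in (0 : ℝ)..s, q u = (∫ u, (Set.Iic s).indicator 1 u * q u) -
      ∫ u, (Set.Iic 0).indicator 1 u * q u := by
    have e : ∀ x u, (Set.Iic x).indicator (1 : ℝ → ℝ) u * q u = (Set.Iic x).indicator q u := by
      intro x u
      by_cases hu : u ∈ Set.Iic x <;> simp [hu]
    simp_rw [e]
    rw [integral_indicator measurableSet_Iic, integral_indicator measurableSet_Iic,
      intervalIntegral.integral_Iic_sub_Iic hq.integrableOn hq.integrableOn]
  have e2 : ∫ u, (kernelCDF k ((s - u) / h n) - kernelCDF k ((0 - u) / h n)) * q u =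
      (∫ u, kernelCDF k ((s - u) / h n) * q u) - ∫ u, kernelCDF k ((0 - u) / h n) * q u := by
    rw [← integral_sub (hcdf s) (hcdf 0)]
    simp_rw [sub_mul]
  rw [e1, e2]
  have h1 := abs_lt.1 (hone s)
  have h2 := abs_lt.1 (hone 0)
  rw [abs_lt]
  constructor <;> linarith

end ConditionK

/-! ### The bandwidth -/

lemma bandwidth_pos {c : ℝ} (hc : 0 < c) {n : ℕ} (hn : 0 < n) : 0 < bandwidth c n :=
  mul_pos hc (Real.rpow_pos_of_pos (Nat.cast_pos.2 hn) _)

lemma tendsto_bandwidth (c : ℝ) : Tendsto (bandwidth c) atTop (𝓝 0) := by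
  have := ((tendsto_rpow_neg_atTop (y := (1 / 5 : ℝ)) (by norm_num)).comp
    tendsto_natCast_atTop_atTop).const_mul c
  rwa [mul_zero] at this

lemma inv_bandwidth_pow (c : ℝ) (n m : ℕ) :
    (bandwidth c n)⁻¹ ^ m = c⁻¹ ^ m * (n : ℝ) ^ (m / 5 : ℝ) := by
  unfold bandwidth
  rw [mul_inv, mul_pow, Real.rpow_neg (Nat.cast_nonneg n), inv_inv, ← Real.rpow_natCast
    ((n : ℝ) ^ (1 / 5 : ℝ)), ← Real.rpow_mul (Nat.cast_nonneg n)]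
  congr 2
  ring

/-! ### Consistency of the kernel estimators -/

namespace IsSubdensitySample

variable {Ω : Type*} [MeasurableSpace Ω] {P : Measure Ω} [IsProbabilityMeasure P]
  {Z : ℕ → Ω → ℝ × Fin 2} {q : Fin 2 → ℝ → ℝ}

lemma sum_integral_mark (q : Fin 2 → ℝ → ℝ) (i : Fin 2) (φ : ℝ → ℝ) :
    ∑ i', ∫ u, (if i' = i then φ u else 0) * q i' u = ∫ u, φ u * q i u := by
  rw [Finset.sum_eq_single i]
  · simp
  · intro i' _ h
    simp [h]
  · simp

lemma measurable_mark {φ : ℝ → ℝ} (hφ : Measurable φ) (i : Fin 2) :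
    Measurable fun p : ℝ × Fin 2 => if p.2 = i then φ p.1 else 0 :=
  Measurable.ite (measurable_snd (measurableSet_singleton i)) (hφ.comp measurable_fst)
    measurable_const

/-- No observation falls into a region of vanishing mass. -/
lemma ae_notMem (hZ : IsSubdensitySample P Z q) {B : Set ℝ} (hB : MeasurableSet B) {i : Fin 2}
    (h0 : ∫ u in B, q i u = 0) : ∀ᵐ ω ∂P, ∀ j, (Z j ω).2 = i → (Z j ω).1 ∉ B := by
  refine ae_all_iff.2 fun j => ?_
  have hm := measurable_mark (measurable_one.indicator hB : Measurable (B.indicator (1 : ℝ → ℝ))) i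
  have hb : ∀ z : ℝ × Fin 2, 0 ≤ (if z.2 = i then B.indicator (1 : ℝ → ℝ) z.1 else 0) ∧
      (if z.2 = i then B.indicator (1 : ℝ → ℝ) z.1 else 0) ≤ 1 := by
    intro z
    by_cases h1 : z.2 = i <;> by_cases h2 : z.1 ∈ B <;> simp [h1, h2]
  have h := hZ.integral_comp j _ hm ⟨1, fun z => by rw [abs_of_nonneg (hb z).1]; exact (hb z).2⟩
  simp only at h
  rw [sum_integral_mark q i (B.indicator 1)] at h
  have e : ∀ u, B.indicator (1 : ℝ → ℝ) u * q i u = B.indicator (q i) u := by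
    intro u
    by_cases hu : u ∈ B <;> simp [hu]
  simp_rw [e] at h
  rw [integral_indicator hB, h0, integral_eq_zero_iff_of_nonneg (fun ω => (hb (Z j ω)).1)
    (Integrable.of_bound (hm.comp (hZ.measurable j)).aestronglyMeasurable 1 (ae_of_all _ fun ω => by
      rw [Real.norm_of_nonneg (hb (Z j ω)).1]; exact (hb (Z j ω)).2))] at h
  filter_upwards [h] with ω hω hi hmem
  simp [hi, hmem] at hω

lemma ae_pos (hZ : IsSubdensitySample P Z q) (h0 : ∀ i, ∫ u in Set.Iic 0, q i u = 0) :
    ∀ᵐ ω ∂P, ∀ j, 0 < (Z j ω).1 := by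
  filter_upwards [hZ.ae_notMem measurableSet_Iic (h0 0),
    hZ.ae_notMem measurableSet_Iic (h0 1)] with ω h1 h2 j
  obtain h | h : (Z j ω).2 = 0 ∨ (Z j ω).2 = 1 := by
    generalize (Z j ω).2 = i
    fin_cases i <;> simp
  · simpa using h1 j h
  · simpa using h2 j h

/-- The uniform law of large numbers for the empirical integrals with respect to one mark. -/
lemma uniform_empiricalIntegral (hZ : IsSubdensitySample P Z q) (i : Fin 2)
    {φ : ℕ → ℝ → ℝ → ℝ} {a b C : ℝ} (hab : a ≤ b) (hC : 0 < C)
    (hφ : ∀ n s, Measurable (φ n s))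
    (hbound : ∀ n : ℕ, 0 < n → ∀ s u, |φ n s u| ≤ C * (n : ℝ) ^ (2 / 5 : ℝ))
    (hlip : ∀ n : ℕ, 0 < n → ∀ s ∈ Set.Icc a b, ∀ s' ∈ Set.Icc a b, ∀ u,
      |φ n s u - φ n s' u| ≤ C * (n : ℝ) ^ (3 / 5 : ℝ) * |s - s'|)
    {ε : ℝ} (hε : 0 < ε) :
    WithHighProbability P fun n ω => ∀ s ∈ Set.Icc a b,
      |empiricalIntegral (fun j => Z j ω) n i (φ n s) - ∫ u, φ n s u * q i u| < ε := by
  refine (hZ.uniform_mean (ψ := fun n s p => if p.2 = i then φ n s p.1 else 0) hab hC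
    (fun n s => measurable_mark (hφ n s) i) ?_ ?_ hε).mono (Eventually.of_forall fun n ω h s hs => ?_)
  · intro n hn s z
    split_ifs
    · exact hbound n hn s z.1
    · simp only [abs_zero]
      positivity
  · intro n hn s hs s' hs' z
    split_ifs
    · exact hlip n hn s hs s' hs' z.1
    · simp only [sub_zero, abs_zero]
      positivity
  · have := h s hs
    rwa [sum_integral_mark q i (φ n s)] at this

lemma rpow_le_rpow_of_nat {n : ℕ} (hn : 0 < n) {x y : ℝ} (h : x ≤ y) : (n : ℝ) ^ x ≤ (n : ℝ) ^ y :=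
  Real.rpow_le_rpow_of_exponent_le (by exact_mod_cast hn) h

lemma subdensityEst_eq {k : ℝ → ℝ} {h s : ℝ} (hs : h < s) (z : ℕ → ℝ × Fin 2) (n : ℕ)
    (i : Fin 2) :
    subdensityEst k h z n i s = empiricalIntegral z n i (fun u => 1 / h * k ((s - u) / h)) := by
  unfold subdensityEst
  rw [if_neg fun h' => absurd h'.2 (not_le.2 hs)]

/-- Pointwise consistency of the subdensity estimators. -/
lemma subdensityEst_consistent (hZ : IsSubdensitySample P Z q) {k : ℝ → ℝ} (hK : ConditionK k)
    {c : ℝ} (hc : 0 < c) {t : ℝ} (ht : 0 < t) (i : Fin 2) (hq : ContinuousAt (q i) t) {ε : ℝ}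
    (hε : 0 < ε) :
    WithHighProbability P fun n ω =>
      |subdensityEst k (bandwidth c n) (fun j => Z j ω) n i t - q i t| < ε := by
  obtain ⟨C, hC, hkC⟩ := hK.exists_bound
  have h1 := hZ.uniform_empiricalIntegral i (a := t) (b := t) (C := c⁻¹ * C) le_rfl (by positivity)
    (φ := fun n s u => 1 / bandwidth c n * k ((s - u) / bandwidth c n))
    (fun n s => (hK.continuous.measurable.comp (by fun_prop)).const_mul _)
    (fun n hn s u => by
      have hb := bandwidth_pos hc hn
      rw [abs_mul, abs_of_pos (by positivity), one_div, ← pow_one (bandwidth c n)⁻¹,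
        inv_bandwidth_pow, pow_one]
      have h1 := rpow_le_rpow_of_nat hn (show ((1 : ℕ) / 5 : ℝ) ≤ 2 / 5 by norm_num)
      have h2 := (hkC ((s - u) / bandwidth c n)).1
      calc c⁻¹ * (n : ℝ) ^ ((1 : ℕ) / 5 : ℝ) * |k ((s - u) / bandwidth c n)|
          ≤ c⁻¹ * (n : ℝ) ^ (2 / 5 : ℝ) * C := by gcongr
        _ = _ := by ring)
    (fun n hn s hs s' hs' u => by
      rw [le_antisymm hs.2 hs.1, le_antisymm hs'.2 hs'.1]
      simp) (half_pos hε)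
  have hlim := tendsto_integral_kernel hK.continuous (fun u => hK.eq_zero)
    (hZ.measurable_subdensity i) hq (tendsto_bandwidth c)
  rw [hK.integral_eq_one, one_mul] at hlim
  have hev := hlim.eventually (Metric.ball_mem_nhds (q i t) (half_pos hε))
  refine h1.mono ?_
  filter_upwards [hev, eventually_gt_atTop 0, (tendsto_bandwidth c).eventually (gt_mem_nhds ht)]
    with n hn hn0 hnt ω hω
  have hb := bandwidth_pos hc hn0
  have := hω t (by simp)
  rw [← subdensityEst_eq hnt] at this
  have e : ∫ u, 1 / bandwidth c n * k ((t - u) / bandwidth c n) * q i u =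
      ∫ v, k v * q i (t - bandwidth c n * v) := by
    simp_rw [mul_assoc]
    rw [integral_const_mul, integral_kernel_comp _ _ hb]
    field_simp
  rw [e] at this
  have h3 : |(∫ v, k v * q i (t - bandwidth c n * v)) - q i t| < ε / 2 := by
    simpa [Real.dist_eq] using hn
  calc _ ≤ _ := abs_sub_le _ (∫ v, k v * q i (t - bandwidth c n * v)) _
    _ < ε := by linarith

/-- Uniform consistency of the derivatives of the subdensity estimators. -/
lemma deriv_subdensityEst_consistent (hZ : IsSubdensitySample P Z q) {k : ℝ → ℝ}
    (hK : ConditionK k) {c : ℝ} (hc : 0 < c) (i : Fin 2) {q' : ℝ → ℝ} {a b r : ℝ} (hab : a ≤ b)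
    (hr : 0 < r) (hd : ∀ x ∈ Set.Icc (a - r) (b + r), HasDerivAt (q i) (q' x) x)
    (hq' : ContinuousOn q' (Set.Icc (a - r) (b + r))) {ε : ℝ} (hε : 0 < ε) :
    WithHighProbability P fun n ω => ∀ s ∈ Set.Icc a b,
      |empiricalIntegral (fun j => Z j ω) n i
        (fun u => (bandwidth c n)⁻¹ ^ 2 * deriv k ((s - u) / bandwidth c n)) - q' s| < ε := by
  obtain ⟨C, hC, hkC⟩ := hK.exists_bound
  have h1 := hZ.uniform_empiricalIntegral i (a := a) (b := b)
    (C := c⁻¹ ^ 2 * C + c⁻¹ ^ 3 * C) hab (by positivity)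
    (φ := fun n s u => (bandwidth c n)⁻¹ ^ 2 * deriv k ((s - u) / bandwidth c n))
    (fun n s => (hK.continuous_deriv.measurable.comp (by fun_prop)).const_mul _)
    (fun n hn s u => by
      rw [abs_mul, abs_of_nonneg (by positivity), inv_bandwidth_pow]
      have h2 := (hkC ((s - u) / bandwidth c n)).2.1
      calc c⁻¹ ^ 2 * (n : ℝ) ^ ((2 : ℕ) / 5 : ℝ) * |deriv k ((s - u) / bandwidth c n)|
          ≤ c⁻¹ ^ 2 * (n : ℝ) ^ ((2 : ℕ) / 5 : ℝ) * C := by gcongr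
        _ = c⁻¹ ^ 2 * C * (n : ℝ) ^ (2 / 5 : ℝ) := by push_cast; ring
        _ ≤ _ := by
          gcongr
          have : 0 ≤ c⁻¹ ^ 3 * C := by positivity
          linarith)
    (fun n hn s hs s' hs' u => by
      have hb := bandwidth_pos hc hn
      have hl := convex_univ.norm_image_sub_le_of_norm_hasDerivWithin_le (f := deriv k)
        (f' := deriv (deriv k)) (C := C)
        (fun x _ => (hK.hasDerivAt_deriv x).hasDerivWithinAt) (fun x _ => (hkC x).2.2)
        (Set.mem_univ ((s' - u) / bandwidth c n)) (Set.mem_univ ((s - u) / bandwidth c n))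
      rw [Real.norm_eq_abs, Real.norm_eq_abs, ← sub_div, sub_sub_sub_cancel_right, abs_div,
        abs_of_pos hb] at hl
      rw [← mul_sub, abs_mul, abs_of_nonneg (by positivity)]
      calc (bandwidth c n)⁻¹ ^ 2 *
            |deriv k ((s - u) / bandwidth c n) - deriv k ((s' - u) / bandwidth c n)|
          ≤ (bandwidth c n)⁻¹ ^ 2 * (C * (|s - s'| / bandwidth c n)) := by gcongr
        _ = (bandwidth c n)⁻¹ ^ 3 * (C * |s - s'|) := by ring
        _ = c⁻¹ ^ 3 * C * (n : ℝ) ^ (3 / 5 : ℝ) * |s - s'| := by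
          rw [inv_bandwidth_pow]; push_cast; ring
        _ ≤ _ := by
          gcongr
          have : 0 ≤ c⁻¹ ^ 2 * C := by positivity
          linarith) (half_pos hε)
  have hev := hK.eventually_abs_deriv_mean_sub_lt (hZ.measurable_subdensity i) hr hd hq'
    (tendsto_bandwidth c) ((eventually_gt_atTop 0).mono fun n hn => bandwidth_pos hc hn)
    (half_pos hε)
  refine h1.mono ?_
  filter_upwards [hev] with n hn ω hω s hs
  have h2 := hω s hs
  have h3 := hn s hs
  calc _ ≤ _ := abs_sub_le _ (∫ u, (bandwidth c n)⁻¹ ^ 2 *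
        deriv k ((s - u) / bandwidth c n) * q i u) _
    _ < ε := by linarith

lemma abs_empiricalIntegral_le {z : ℕ → ℝ × Fin 2} {n : ℕ} {i : Fin 2} {φ χ : ℝ → ℝ}
    (h : ∀ j, |φ (z j).1| ≤ χ (z j).1) :
    |empiricalIntegral z n i φ| ≤ empiricalIntegral z n i χ := by
  unfold empiricalIntegral
  rw [abs_mul, abs_of_nonneg (by positivity)]
  refine mul_le_mul_of_nonneg_left ((Finset.abs_sum_le_sum_abs _ _).trans
    (Finset.sum_le_sum fun j _ => ?_)) (by positivity)
  split_ifs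
  · exact h j
  · simp

lemma empiricalIntegral_sub (z : ℕ → ℝ × Fin 2) (n : ℕ) (i : Fin 2) (φ χ : ℝ → ℝ) :
    empiricalIntegral z n i φ - empiricalIntegral z n i χ =
      empiricalIntegral z n i (fun u => φ u - χ u) := by
  unfold empiricalIntegral
  rw [← mul_sub, ← Finset.sum_sub_distrib]
  congr 1
  refine Finset.sum_congr rfl fun j _ => ?_
  split_ifs <;> simp

lemma empiricalIntegral_const_mul (z : ℕ → ℝ × Fin 2) (n : ℕ) (i : Fin 2) (a : ℝ) (φ : ℝ → ℝ) :
    empiricalIntegral z n i (fun u => a * φ u) = a * empiricalIntegral z n i φ := by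
  unfold empiricalIntegral
  rw [mul_left_comm a, Finset.mul_sum (a := a)]
  simp only [mul_ite, mul_zero]

lemma continuous_empiricalIntegral (z : ℕ → ℝ × Fin 2) (n : ℕ) (i : Fin 2) {φ : ℝ → ℝ → ℝ}
    (hφ : ∀ u, Continuous fun s => φ s u) :
    Continuous fun s => empiricalIntegral z n i (φ s) := by
  unfold empiricalIntegral
  refine continuous_const.mul (continuous_finsetSum _ fun j _ => ?_)
  split_ifs
  · exact hφ _
  · exact continuous_const

lemma integral_empiricalIntegral (z : ℕ → ℝ × Fin 2) (n : ℕ) (i : Fin 2) {φ : ℝ → ℝ → ℝ}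
    (hφ : ∀ u, Continuous fun s => φ s u) (a b : ℝ) :
    ∫ s in a..b, empiricalIntegral z n i (φ s) =
      empiricalIntegral z n i (fun u => ∫ s in a..b, φ s u) := by
  unfold empiricalIntegral
  rw [intervalIntegral.integral_const_mul, intervalIntegral.integral_finsetSum]
  · congr 1
    refine Finset.sum_congr rfl fun j _ => ?_
    split_ifs
    · rfl
    · simp
  · intro j _
    split_ifs
    · exact (hφ _).intervalIntegrable _ _
    · exact intervalIntegrable_const

/-- The effect of the boundary kernels on the integrated estimators is bounded by the fraction of
observation times in a shrinking neighbourhood of the origin. -/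
lemma abs_subdistributionEst_sub_le {k : ℝ → ℝ} (hK : ConditionK k) :
    ∃ M > 0, ∀ (h : ℝ) (z : ℕ → ℝ × Fin 2) (n : ℕ) (i : Fin 2) (s : ℝ), 0 < h →
      (∀ j, 0 < (z j).1) → 0 ≤ s →
      |subdistributionEst k h z n i s - empiricalIntegral z n i
        (fun u => kernelCDF k ((s - u) / h) - kernelCDF k ((0 - u) / h))| ≤
      M * empiricalIntegral z n i ((Set.Iic (2 * h)).indicator 1) := by
  obtain ⟨B, hB, hkB⟩ := hK.exists_bound_boundaryKernel
  obtain ⟨C, hC, hkC⟩ := hK.exists_bound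
  refine ⟨B + C, by positivity, fun h z n i s hh hz hs => ?_⟩
  set D := empiricalIntegral z n i ((Set.Iic (2 * h)).indicator 1) with hD
  have hD0 : 0 ≤ D := (abs_nonneg _).trans (abs_empiricalIntegral_le (φ := fun _ => 0)
    fun j => by rw [abs_zero]; exact Set.indicator_nonneg (fun _ _ => zero_le_one) _)
  have hcs : ∀ u, Continuous fun x => 1 / h * k ((x - u) / h) := fun u => by
    have := hK.continuous
    fun_prop
  have e : empiricalIntegral z n i
      (fun u => kernelCDF k ((s - u) / h) - kernelCDF k ((0 - u) / h)) =
      ∫ x in (0 : ℝ)..s, empiricalIntegral z n i (fun u => 1 / h * k ((x - u) / h)) := by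
    rw [integral_empiricalIntegral z n i hcs]
    simp_rw [hK.integral_scaled_kernel h _ s]
  have hi1 : IntervalIntegrable (subdensityEst k h z n i) volume 0 s :=
    ((hK.continuousOn_subdensityEst hh hz n i).mono
      (by rw [Set.uIcc_of_le hs]; exact Set.Icc_subset_Ici_self)).intervalIntegrable
  have hi2 := (continuous_empiricalIntegral z n i hcs).intervalIntegrable (μ := volume) 0 s
  rw [e, subdistributionEst, ← intervalIntegral.integral_sub hi1 hi2]
  have hpt : ∀ x ∈ Set.Ioc 0 s, ‖subdensityEst k h z n i x -
      empiricalIntegral z n i (fun u => 1 / h * k ((x - u) / h))‖ ≤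
        (Set.Iic h).indicator (fun _ => (B + C) / h * D) x := by
    intro x hx
    rcases le_or_gt x h with hxh | hxh
    · rw [Set.indicator_of_mem (show x ∈ Set.Iic h from hxh), subdensityEst, if_pos ⟨hx.1.le, hxh⟩,
        empiricalIntegral_sub, hD, ← empiricalIntegral_const_mul, Real.norm_eq_abs]
      refine abs_empiricalIntegral_le fun j => ?_
      have h1 := abs_boundary_term_le hkB hh hx.1.le hxh (u := (z j).1)
      have h2 : |1 / h * k ((x - (z j).1) / h)| ≤
          C / h * (Set.Iic (2 * h)).indicator 1 (z j).1 := by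
        by_cases hu : (z j).1 ∈ Set.Iic (2 * h)
        · rw [Set.indicator_of_mem hu, abs_mul, abs_of_pos (by positivity)]
          have := (hkC ((x - (z j).1) / h)).1
          calc 1 / h * |k ((x - (z j).1) / h)| ≤ 1 / h * C := by gcongr
            _ = C / h * (1 : ℝ → ℝ) (z j).1 := by simp; ring
        · have : k ((x - (z j).1) / h) = 0 := by
            refine hK.eq_zero fun hm => hu ?_
            have h1 := hm.1
            rw [lt_div_iff₀ hh] at h1
            simp only [Set.mem_Iic]
            linarith
          rw [this, Set.indicator_of_notMem hu]
          simp
      calc _ ≤ _ := abs_sub _ _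
        _ ≤ B / h * (Set.Iic (2 * h)).indicator 1 (z j).1 +
            C / h * (Set.Iic (2 * h)).indicator 1 (z j).1 := add_le_add h1 h2
        _ = _ := by ring
    · rw [Set.indicator_of_notMem (by simpa using hxh), subdensityEst_eq hxh, sub_self, norm_zero]
  have hgi : IntervalIntegrable (fun x => (Set.Iic h).indicator (fun _ => (B + C) / h * D) x)
      volume 0 s := by
    rw [intervalIntegrable_iff]
    exact (integrableOn_const (by simp)).indicator measurableSet_Iic
  have h1 := intervalIntegral.norm_integral_le_of_norm_le hs (ae_of_all _ hpt) hgi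
  rw [Real.norm_eq_abs] at h1
  refine h1.trans ?_
  rw [intervalIntegral.integral_of_le hs, integral_indicator measurableSet_Iic,
    Measure.restrict_restrict measurableSet_Iic, setIntegral_const, smul_eq_mul]
  have hvol : volume.real (Set.Iic h ∩ Set.Ioc 0 s) ≤ h := by
    have : volume.real (Set.Ioc 0 h) = h := by rw [Real.volume_real_Ioc_of_le hh.le, sub_zero]
    nth_rewrite 2 [← this]
    exact measureReal_mono (fun x hx => ⟨hx.2.1, hx.1⟩) (by simp)
  calc _ ≤ h * ((B + C) / h * D) := by gcongr
    _ = _ := by field_simp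

/-- Uniform consistency of the integrated subdensity estimators on compact intervals. -/
lemma subdistributionEst_consistent (hZ : IsSubdensitySample P Z q) {k : ℝ → ℝ}
    (hK : ConditionK k) {c : ℝ} (hc : 0 < c) (h0 : ∀ i, ∫ u in Set.Iic 0, q i u = 0) (i : Fin 2)
    {S : ℝ} (hS : 0 ≤ S) {ε : ℝ} (hε : 0 < ε) :
    WithHighProbability P fun n ω => ∀ s ∈ Set.Icc 0 S,
      |subdistributionEst k (bandwidth c n) (fun j => Z j ω) n i s -
        ∫ u in (0 : ℝ)..s, q i u| < ε := by
  obtain ⟨M, hM, hMbd⟩ := abs_subdistributionEst_sub_le hK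
  obtain ⟨C, hC, hkC⟩ := hK.exists_bound
  -- Without the boundary correction the integrated estimator is an empirical mean of integrated
  -- kernels (`hA`); the correction is bounded by a multiple of the fraction of observation times
  -- below `2 * h` (`hN`), whose expectation vanishes (`hlim`).
  have hb1 : ∀ n : ℕ, 0 < n → (1 : ℝ) ≤ (n : ℝ) ^ (2 / 5 : ℝ) := fun n hn =>
    Real.one_le_rpow (by exact_mod_cast hn) (by norm_num)
  have hA := hZ.uniform_empiricalIntegral i (a := 0) (b := S) (C := 1 + c⁻¹ * C) hS (by positivity)
    (φ := fun n s u =>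
      kernelCDF k ((s - u) / bandwidth c n) - kernelCDF k ((0 - u) / bandwidth c n))
    (fun n s => (hK.continuous_kernelCDF.measurable.comp (by fun_prop)).sub
      (hK.continuous_kernelCDF.measurable.comp (by fun_prop)))
    (fun n hn s u => by
      have h1 := hK.kernelCDF_nonneg ((s - u) / bandwidth c n)
      have h2 := hK.kernelCDF_nonneg ((0 - u) / bandwidth c n)
      have h3 := hK.kernelCDF_le_one ((s - u) / bandwidth c n)
      have h4 := hK.kernelCDF_le_one ((0 - u) / bandwidth c n)
      have h5 : 0 ≤ c⁻¹ * C := by positivity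
      have : (1 : ℝ) ≤ (1 + c⁻¹ * C) * (n : ℝ) ^ (2 / 5 : ℝ) := by
        nlinarith [hb1 n hn]
      rw [abs_le]
      constructor <;> linarith)
    (fun n hn s hs s' hs' u => by
      have hb := bandwidth_pos hc hn
      rw [sub_sub_sub_cancel_right]
      refine (hK.abs_kernelCDF_sub_le (fun u => (hkC u).1) _ _).trans ?_
      rw [← sub_div, sub_sub_sub_cancel_right, abs_div, abs_of_pos hb]
      have h1 := rpow_le_rpow_of_nat hn (show ((1 : ℕ) / 5 : ℝ) ≤ 3 / 5 by norm_num)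
      calc C * (|s - s'| / bandwidth c n) = C * |s - s'| * (bandwidth c n)⁻¹ ^ 1 := by
            rw [pow_one]; ring
        _ = c⁻¹ * C * (n : ℝ) ^ ((1 : ℕ) / 5 : ℝ) * |s - s'| := by
            rw [inv_bandwidth_pow]; ring
        _ ≤ (1 + c⁻¹ * C) * (n : ℝ) ^ (3 / 5 : ℝ) * |s - s'| := by
            gcongr
            linarith) (show 0 < ε / 4 by positivity)
  have hN := hZ.uniform_empiricalIntegral i (a := 0) (b := 0) (C := 1) le_rfl one_pos
    (φ := fun n _ => (Set.Iic (2 * bandwidth c n)).indicator 1)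
    (fun n s => measurable_one.indicator measurableSet_Iic)
    (fun n hn s u => by
      rw [one_mul]
      refine le_trans ?_ (hb1 n hn)
      by_cases hu : u ∈ Set.Iic (2 * bandwidth c n)
      · rw [Set.indicator_of_mem hu]; simp
      · rw [Set.indicator_of_notMem hu]; simp)
    (fun n hn s hs s' hs' u => by
      simp only [sub_self, abs_zero]
      positivity) (show 0 < ε / (4 * M) by positivity)
  have hlim : Tendsto (fun n => ∫ u, (Set.Iic (2 * bandwidth c n)).indicator 1 u * q i u) atTop
      (𝓝 0) := by
    have e : ∀ n, ∫ u, (Set.Iic (2 * bandwidth c n)).indicator 1 u * q i u =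
        ∫ u in (0 : ℝ)..(2 * bandwidth c n), q i u := by
      intro n
      have e1 : ∀ u, (Set.Iic (2 * bandwidth c n)).indicator (1 : ℝ → ℝ) u * q i u =
          (Set.Iic (2 * bandwidth c n)).indicator (q i) u := by
        intro u
        by_cases hu : u ∈ Set.Iic (2 * bandwidth c n)
        · rw [Set.indicator_of_mem hu, Set.indicator_of_mem hu]; simp
        · rw [Set.indicator_of_notMem hu, Set.indicator_of_notMem hu]; simp
      simp_rw [e1]
      rw [integral_indicator measurableSet_Iic, ← intervalIntegral.integral_Iic_sub_Iic
        (hZ.integrable i).integrableOn (hZ.integrable i).integrableOn, h0 i, sub_zero]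
    simp_rw [e]
    have hcont := intervalIntegral.continuous_primitive (μ := volume)
      (fun a b => (hZ.integrable i).intervalIntegrable) (0 : ℝ)
    have h2 : Tendsto (fun n => 2 * bandwidth c n) atTop (𝓝 0) := by
      simpa using (tendsto_bandwidth c).const_mul 2
    have h3 := (hcont.tendsto 0).comp h2
    rw [intervalIntegral.integral_same] at h3
    exact h3
  have hev := hK.eventually_abs_integrated_mean_sub_lt (hZ.integrable i) (hZ.nonneg i)
    (tendsto_bandwidth c) ((eventually_gt_atTop 0).mono fun n hn => bandwidth_pos hc hn)
    (show 0 < ε / 4 by positivity)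
  refine ((hA.and hN).and (WithHighProbability.of_ae fun _ => hZ.ae_pos h0)).mono ?_
  filter_upwards [hev, eventually_gt_atTop 0, hlim.eventually
    (gt_mem_nhds (show (0 : ℝ) < ε / (4 * M) by positivity))] with n hn hn0 hnl ω hω s hs
  obtain ⟨⟨hA, hN⟩, hz⟩ := hω
  have h1 := hMbd _ (fun j => Z j ω) n i s (bandwidth_pos hc hn0) hz hs.1
  have h2 := hA s hs
  have h3 := hn s hs.1
  have h4 := (abs_lt.1 (hN 0 (by simp))).2
  have h5 : M * empiricalIntegral (fun j => Z j ω) n i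
      ((Set.Iic (2 * bandwidth c n)).indicator 1) ≤ M * (ε / (4 * M) + ε / (4 * M)) := by
    gcongr
    linarith
  have h6 : M * (ε / (4 * M) + ε / (4 * M)) = ε / 2 := by field_simp; norm_num
  have h1' := abs_le.1 h1
  have h2' := abs_lt.1 h2
  have h3' := abs_lt.1 h3
  rw [abs_lt]
  constructor <;> linarith

end IsSubdensitySample

/-! ### Supporting lines of the cumulative sum diagram -/

lemma le_of_mem_convexHull {S : Set (ℝ × ℝ)} {α β : ℝ} (h : ∀ p ∈ S, α + β * p.1 ≤ p.2)
    {p : ℝ × ℝ} (hp : p ∈ convexHull ℝ S) : α + β * p.1 ≤ p.2 := by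
  have hconv : Convex ℝ {p : ℝ × ℝ | α + β * p.1 ≤ p.2} := by
    intro p hp p' hp' a b ha hb hab
    simp only [Set.mem_ofPred_eq, Prod.fst_add, Prod.smul_fst, Prod.snd_add, Prod.smul_snd,
      smul_eq_mul] at *
    have h1 := mul_le_mul_of_nonneg_left hp ha
    have h2 := mul_le_mul_of_nonneg_left hp' hb
    have h3 : a * α + b * α = α := by rw [← add_mul, hab, one_mul]
    linarith
  exact convexHull_min h hconv hp

/-- If the tangent at an interior point supports the whole curve, the lower convex hull is squeezed
between tangent and curve, so its right-hand slope is that of the tangent. -/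
lemma derivWithin_lowerConvexHull_of_supporting {x y : ℝ → ℝ} {τ t b s₀ p : ℝ} (ht : 0 ≤ t)
    (htb : t < b) (hbτ : b ≤ τ) (hx : HasDerivAt x p t) (hp : 0 < p)
    (hy : HasDerivAt y (s₀ * p) t) (hcont : ContinuousOn x (Set.Icc t b))
    (hsupp : ∀ s ∈ Set.Icc 0 τ, y t + s₀ * (x s - x t) ≤ y s) :
    derivWithin (lowerConvexHull ((fun s => (x s, y s)) '' Set.Icc 0 τ)) (Set.Ioi (x t)) (x t) =
      s₀ := by
  set S := (fun s => (x s, y s)) '' Set.Icc 0 τ with hS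
  have hlow : ∀ X Y, (X, Y) ∈ convexHull ℝ S → y t + s₀ * (X - x t) ≤ Y := by
    intro X Y hXY
    have := le_of_mem_convexHull (α := y t - s₀ * x t) (β := s₀) (S := S) ?_ hXY
    · simp only at this
      linarith
    · rintro _ ⟨s, hs, rfl⟩
      have := hsupp s hs
      simp only
      linarith
  have hbdd : ∀ X, BddBelow {Y | (X, Y) ∈ convexHull ℝ S} := fun X => ⟨_, fun Y hY => hlow X Y hY⟩
  have hmem : ∀ s ∈ Set.Icc 0 τ, (x s, y s) ∈ convexHull ℝ S := fun s hs =>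
    subset_convexHull ℝ S ⟨s, hs, rfl⟩
  have hval : lowerConvexHull S (x t) = y t := by
    have htm := hmem t ⟨ht, htb.le.trans hbτ⟩
    refine le_antisymm (csInf_le (hbdd _) htm) (le_csInf ⟨_, htm⟩ fun Y hY => ?_)
    have := hlow _ _ hY
    simpa using this
  refine HasDerivWithinAt.derivWithin ?_ (uniqueDiffWithinAt_Ioi _)
  rw [hasDerivWithinAt_iff_isLittleO, Asymptotics.isLittleO_iff]
  intro ε hε
  have hr : HasDerivAt (fun s => y s - s₀ * x s) 0 t := by
    have := hy.sub (hx.const_mul s₀)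
    rwa [sub_self] at this
  have h1 := (Asymptotics.isLittleO_iff.1 (hasDerivAt_iff_isLittleO.1 hr))
    (show 0 < ε * (p / 2) by positivity)
  have h2 := (Asymptotics.isLittleO_iff.1 (hasDerivAt_iff_isLittleO.1 hx)) (half_pos hp)
  obtain ⟨δ, hδ, hδ12⟩ := Metric.eventually_nhds_iff.1 (h1.and h2)
  set b' := min b (t + δ / 2) with hb'
  have htb' : t < b' := lt_min htb (by linarith)
  have hnear : ∀ s ∈ Set.Icc t b', y s - y t - s₀ * (x s - x t) ≤ ε * (x s - x t) ∧
      p / 2 * (s - t) ≤ x s - x t := by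
    intro s hs
    have hsδ : dist s t < δ := by
      have := hs.2.trans (min_le_right _ _)
      rw [Real.dist_eq, abs_of_nonneg (by linarith [hs.1])]
      linarith
    obtain ⟨e1, e2⟩ := hδ12 hsδ
    have hst : 0 ≤ s - t := by linarith [hs.1]
    simp only [smul_eq_mul, mul_zero, sub_zero, Real.norm_eq_abs, abs_of_nonneg hst] at e1 e2
    have e1' := (abs_le.1 e1).2
    have e2' := (abs_le.1 e2).1
    have e3 : p / 2 * (s - t) ≤ x s - x t := by linarith
    refine ⟨?_, e3⟩
    have := mul_le_mul_of_nonneg_left e3 hε.le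
    linarith
  have hxb : x t < x b' := by
    have := (hnear b' ⟨htb'.le, le_rfl⟩).2
    have h3 : 0 < p / 2 * (b' - t) := mul_pos (half_pos hp) (sub_pos.2 htb')
    linarith
  filter_upwards [Ioo_mem_nhdsGT hxb] with X hX
  obtain ⟨s, hs, rfl⟩ := intermediate_value_Icc htb'.le
    (hcont.mono (Set.Icc_subset_Icc_right (min_le_left _ _))) ⟨hX.1.le, hX.2.le⟩
  have hsτ : s ∈ Set.Icc 0 τ :=
    ⟨ht.trans hs.1, (hs.2.trans (min_le_left _ _)).trans hbτ⟩
  have hup : lowerConvexHull S (x s) ≤ y s := csInf_le (hbdd _) (hmem s hsτ)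
  have hlo : y t + s₀ * (x s - x t) ≤ lowerConvexHull S (x s) :=
    le_csInf ⟨_, hmem s hsτ⟩ fun Y hY => hlow _ _ hY
  have := (hnear s hs).1
  rw [hval, smul_eq_mul, Real.norm_eq_abs, Real.norm_eq_abs, abs_of_pos (sub_pos.2 hX.1),
    abs_of_nonneg (by linarith)]
  linarith

namespace ConditionK

variable {k : ℝ → ℝ} (hK : ConditionK k)
include hK

lemma hasDerivAt_subdistributionEst {h : ℝ} (hh : 0 < h) {z : ℕ → ℝ × Fin 2}
    (hz : ∀ j, 0 < (z j).1) (n : ℕ) (i : Fin 2) {s : ℝ} (hs : 0 < s) :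
    HasDerivAt (subdistributionEst k h z n i) (subdensityEst k h z n i s) s := by
  have hc := hK.continuousOn_subdensityEst hh hz n i
  refine intervalIntegral.integral_hasDerivAt_right ?_ ?_ (hc.continuousAt (Ici_mem_nhds hs))
  · exact (hc.mono (by rw [Set.uIcc_of_le hs.le]; exact Set.Icc_subset_Ici_self)).intervalIntegrable
  · exact ContinuousOn.stronglyMeasurableAtFilter isOpen_Ioi (hc.mono Set.Ioi_subset_Ici_self) s hs

lemma distributionEst_eq {h : ℝ} (hh : 0 < h) {z : ℕ → ℝ × Fin 2} (hz : ∀ j, 0 < (z j).1)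
    (n : ℕ) {s : ℝ} (hs : 0 ≤ s) :
    distributionEst k h z n s = subdistributionEst k h z n 0 s + subdistributionEst k h z n 1 s := by
  have hi : ∀ i, IntervalIntegrable (subdensityEst k h z n i) volume 0 s := fun i =>
    ((hK.continuousOn_subdensityEst hh hz n i).mono
      (by rw [Set.uIcc_of_le hs]; exact Set.Icc_subset_Ici_self)).intervalIntegrable
  unfold distributionEst densityEst subdistributionEst
  exact intervalIntegral.integral_add (hi 0) (hi 1)

lemma continuousOn_subdistributionEst {h : ℝ} (hh : 0 < h) {z : ℕ → ℝ × Fin 2}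
    (hz : ∀ j, 0 < (z j).1) (n : ℕ) (i : Fin 2) :
    ContinuousOn (subdistributionEst k h z n i) (Set.Ici 0) := by
  intro s hs
  have hi : IntegrableOn (subdensityEst k h z n i) (Set.Icc 0 (s + 1)) :=
    ((hK.continuousOn_subdensityEst hh hz n i).mono Set.Icc_subset_Ici_self).integrableOn_Icc
  have h1 := intervalIntegral.continuousOn_primitive_interval (μ := volume) (a := 0) (b := s + 1)
    (f := subdensityEst k h z n i) (by
      rwa [Set.uIcc_of_le (by linarith [Set.mem_Ici.1 hs])])
  rw [Set.uIcc_of_le (by linarith [Set.mem_Ici.1 hs])] at h1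
  have h2 := h1 s ⟨hs, by linarith⟩
  refine h2.mono_of_mem_nhdsWithin ?_
  rw [← Set.Ici_inter_Iic]
  exact inter_mem_nhdsWithin _ (Iic_mem_nhds (by linarith))

lemma continuousOn_densityEst {h : ℝ} (hh : 0 < h) {z : ℕ → ℝ × Fin 2}
    (hz : ∀ j, 0 < (z j).1) (n : ℕ) : ContinuousOn (densityEst k h z n) (Set.Ici 0) :=
  (hK.continuousOn_subdensityEst hh hz n 0).add (hK.continuousOn_subdensityEst hh hz n 1)

lemma continuousOn_distributionEst {h : ℝ} (hh : 0 < h) {z : ℕ → ℝ × Fin 2}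
    (hz : ∀ j, 0 < (z j).1) (n : ℕ) : ContinuousOn (distributionEst k h z n) (Set.Ici 0) :=
  ((hK.continuousOn_subdistributionEst hh hz n 0).add
    (hK.continuousOn_subdistributionEst hh hz n 1)).congr
      fun _ hs => hK.distributionEst_eq hh hz n hs

lemma subdensityEst_eq_zero {h : ℝ} (hh : 0 < h) {z : ℕ → ℝ × Fin 2} {n : ℕ} {i : Fin 2} {s : ℝ}
    (hs : h < s) (hz : ∀ j < n, (z j).2 = i → (z j).1 + h ≤ s) :
    subdensityEst k h z n i s = 0 := by
  rw [IsSubdensitySample.subdensityEst_eq hs, empiricalIntegral]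
  refine mul_eq_zero_of_right _ (Finset.sum_eq_zero fun j hj => ?_)
  split_ifs with hi
  · have h1 := hz j (Finset.mem_range.1 hj) hi
    rw [hK.eq_zero, mul_zero]
    intro hm
    have h2 := hm.2
    rw [div_lt_one hh] at h2
    linarith
  · rfl

lemma bddAbove_densityEst_pos {h : ℝ} (hh : 0 < h) {z : ℕ → ℝ × Fin 2}
    (hz : ∀ j, 0 < (z j).1) (n : ℕ) : BddAbove {s : ℝ | 0 ≤ s ∧ 0 < densityEst k h z n s} := by
  refine ⟨h + ∑ j ∈ Finset.range n, (z j).1, fun s hs => ?_⟩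
  by_contra hc
  rw [not_le] at hc
  have hsum : ∀ j < n, (z j).1 ≤ ∑ j ∈ Finset.range n, (z j).1 := fun j hj =>
    Finset.single_le_sum (f := fun j => (z j).1) (fun j _ => (hz j).le) (Finset.mem_range.2 hj)
  have hs0 : h < s := by
    have : 0 ≤ ∑ j ∈ Finset.range n, (z j).1 := Finset.sum_nonneg fun j _ => (hz j).le
    linarith
  have h0 : ∀ i, subdensityEst k h z n i s = 0 := fun i =>
    hK.subdensityEst_eq_zero hh hs0 fun j hj _ => by linarith [hsum j hj]
  have := hs.2
  simp [densityEst, h0] at this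

/-- If the line through the point of the diagram with parameter `t` whose slope is the naive
estimate supports the diagram, the maximum smoothed likelihood and naive estimators agree. -/
lemma msleEst_eq_naiveEst {h : ℝ} (hh : 0 < h) {z : ℕ → ℝ × Fin 2} (hz : ∀ j, 0 < (z j).1)
    {n : ℕ} {t : ℝ} (ht : 0 < t) (hpos : 0 < densityEst k h z n t)
    (hsupp : ∀ s, 0 ≤ s → subdistributionEst k h z n 1 t + naiveEst k h z n t *
      (distributionEst k h z n s - distributionEst k h z n t) ≤ subdistributionEst k h z n 1 s) :
    msleEst k h z n t = naiveEst k h z n t := by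
  have hcont := hK.continuousOn_densityEst hh hz n
  have hev := (hcont.continuousAt (Ici_mem_nhds ht)).eventually (lt_mem_nhds hpos)
  obtain ⟨δ, hδ, hδpos⟩ := Metric.eventually_nhds_iff.1 hev
  have hb : t + δ / 2 ≤ diagramEnd k h z n := by
    refine le_csSup (hK.bddAbove_densityEst_pos hh hz n) ⟨by linarith, hδpos ?_⟩
    rw [Real.dist_eq, add_sub_cancel_left, abs_of_pos (half_pos hδ)]
    linarith
  have hx : HasDerivAt (distributionEst k h z n) (densityEst k h z n t) t := by
    refine ((hK.hasDerivAt_subdistributionEst hh hz n 0 ht).add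
      (hK.hasDerivAt_subdistributionEst hh hz n 1 ht)).congr_of_eventuallyEq ?_
    filter_upwards [Ioi_mem_nhds ht] with s hs
    exact hK.distributionEst_eq hh hz n (le_of_lt hs)
  have hy : HasDerivAt (subdistributionEst k h z n 1)
      (naiveEst k h z n t * densityEst k h z n t) t := by
    rw [naiveEst, div_mul_cancel₀ _ hpos.ne']
    exact hK.hasDerivAt_subdistributionEst hh hz n 1 ht
  exact derivWithin_lowerConvexHull_of_supporting ht.le (by linarith) hb hx hpos hy
    ((hK.continuousOn_distributionEst hh hz n).mono fun s hs => ht.le.trans hs.1)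
    fun s hs => hsupp s hs.1

lemma hasDerivAt_subdensityEst {h : ℝ} {z : ℕ → ℝ × Fin 2} (n : ℕ)
    (i : Fin 2) {s : ℝ} (hs : h < s) :
    HasDerivAt (subdensityEst k h z n i)
      (empiricalIntegral z n i fun u => h⁻¹ ^ 2 * deriv k ((s - u) / h)) s := by
  have h1 : HasDerivAt (fun s => empiricalIntegral z n i fun u => 1 / h * k ((s - u) / h))
      (empiricalIntegral z n i fun u => h⁻¹ ^ 2 * deriv k ((s - u) / h)) s := by
    unfold empiricalIntegral
    refine HasDerivAt.const_mul _ (HasDerivAt.fun_sum fun j _ => ?_)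
    split_ifs
    · have h2 : HasDerivAt (fun s => (s - (z j).1) / h) (1 / h) s :=
        ((hasDerivAt_id s).sub_const _).div_const h
      have h3 := ((hK.hasDerivAt ((s - (z j).1) / h)).comp s h2).const_mul (1 / h)
      refine h3.congr_deriv ?_
      ring
    · exact hasDerivAt_const _ _
  refine h1.congr_of_eventuallyEq ?_
  filter_upwards [Ioi_mem_nhds hs] with s' hs'
  exact IsSubdensitySample.subdensityEst_eq hs' z n i

/-- The line of slope `naiveEst` supports the diagram: near `t` the vertical distance is convex
with vanishing slope at `t`, at intermediate distance it is nonnegative by assumption, and far out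
only observations with mark `1` remain, so that it increases. -/
lemma supporting_line {h : ℝ} (hh : 0 < h) {z : ℕ → ℝ × Fin 2} (hz : ∀ j, 0 < (z j).1)
    {n : ℕ} {t δ M S : ℝ} (hδ : 0 < δ) (ht : h < t - δ) (hMS : M + h ≤ S) (htS : t + δ ≤ S)
    (hmark : ∀ j, (z j).2 = 0 → (z j).1 ≤ M) (hpos : 0 < densityEst k h z n t)
    (hN1 : naiveEst k h z n t ≤ 1)
    (hconv : ∀ s ∈ Set.Icc (t - δ) (t + δ), 0 ≤ (1 - naiveEst k h z n t) *
        (empiricalIntegral z n 1 fun u => h⁻¹ ^ 2 * deriv k ((s - u) / h)) -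
      naiveEst k h z n t * empiricalIntegral z n 0 fun u => h⁻¹ ^ 2 * deriv k ((s - u) / h))
    (hmid : ∀ s ∈ Set.Icc 0 S, δ ≤ |s - t| → 0 ≤ (1 - naiveEst k h z n t) *
        (subdistributionEst k h z n 1 s - subdistributionEst k h z n 1 t) -
      naiveEst k h z n t * (subdistributionEst k h z n 0 s - subdistributionEst k h z n 0 t))
    {s : ℝ} (hs : 0 ≤ s) :
    subdistributionEst k h z n 1 t + naiveEst k h z n t *
      (distributionEst k h z n s - distributionEst k h z n t) ≤ subdistributionEst k h z n 1 s := by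
  set N := naiveEst k h z n t with hN
  let L : ℝ → ℝ := fun s => (1 - N) *
        (subdistributionEst k h z n 1 s - subdistributionEst k h z n 1 t) -
      N * (subdistributionEst k h z n 0 s - subdistributionEst k h z n 0 t)
  let L' : ℝ → ℝ := fun s => (1 - N) * subdensityEst k h z n 1 s - N * subdensityEst k h z n 0 s
  have ht0 : 0 < t := by linarith
  have hL : ∀ s, 0 < s → HasDerivAt L (L' s) s := fun s hs =>
    (((hK.hasDerivAt_subdistributionEst hh hz n 1 hs).sub_const _).const_mul _).sub
      (((hK.hasDerivAt_subdistributionEst hh hz n 0 hs).sub_const _).const_mul _)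
  have hL' : ∀ s, h < s → HasDerivAt L' ((1 - N) *
      (empiricalIntegral z n 1 fun u => h⁻¹ ^ 2 * deriv k ((s - u) / h)) -
      N * empiricalIntegral z n 0 fun u => h⁻¹ ^ 2 * deriv k ((s - u) / h)) s := fun s hs =>
    ((hK.hasDerivAt_subdensityEst n 1 hs).const_mul _).sub
      ((hK.hasDerivAt_subdensityEst n 0 hs).const_mul _)
  have hLt : L t = 0 := by simp [L]
  have hL't : L' t = 0 := by
    have : N * densityEst k h z n t = subdensityEst k h z n 1 t := by
      rw [hN, naiveEst, div_mul_cancel₀ _ hpos.ne']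
    simp only [L']
    rw [densityEst] at this
    linarith
  have hmono : MonotoneOn L' (Set.Icc (t - δ) (t + δ)) := by
    refine monotoneOn_of_hasDerivWithinAt_nonneg (convex_Icc _ _)
      (fun s hs => (hL' s (ht.trans_le hs.1)).continuousAt.continuousWithinAt)
      (fun s hs => (hL' s (ht.trans_le (interior_subset hs).1)).hasDerivWithinAt)
      fun s hs => hconv s (interior_subset hs)
  have hLs : 0 ≤ L s := by
    rcases lt_or_ge |s - t| δ with hsδ | hsδ
    · rw [abs_lt] at hsδ
      rcases le_total t s with hts | hts
      · have : MonotoneOn L (Set.Icc t s) := by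
          refine monotoneOn_of_hasDerivWithinAt_nonneg (convex_Icc _ _)
            (fun x hx => (hL x (ht0.trans_le hx.1)).continuousAt.continuousWithinAt)
            (fun x hx => (hL x (ht0.trans_le (interior_subset hx).1)).hasDerivWithinAt)
            fun x hx => ?_
          have hx := interior_subset hx
          rw [← hL't]
          exact hmono ⟨by linarith, by linarith⟩ ⟨by linarith [hx.1], by linarith [hx.2]⟩ hx.1
        rw [← hLt]
        exact this ⟨le_rfl, hts⟩ ⟨hts, le_rfl⟩ hts
      · have hs0 : 0 < s := by linarith
        have : AntitoneOn L (Set.Icc s t) := by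
          refine antitoneOn_of_hasDerivWithinAt_nonpos (convex_Icc _ _)
            (fun x hx => (hL x (hs0.trans_le hx.1)).continuousAt.continuousWithinAt)
            (fun x hx => (hL x (hs0.trans_le (interior_subset hx).1)).hasDerivWithinAt)
            fun x hx => ?_
          have hx := interior_subset hx
          rw [← hL't]
          exact hmono ⟨by linarith [hx.1], by linarith [hx.2]⟩ ⟨by linarith, by linarith⟩ hx.2
        rw [← hLt]
        exact this ⟨le_rfl, hts⟩ ⟨hts, le_rfl⟩ hts
    · rcases le_total s S with hsS | hsS
      · exact hmid s ⟨hs, hsS⟩ hsδ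
      · have hS0 : 0 < S := by linarith
        have hLS : 0 ≤ L S := hmid S ⟨hS0.le, le_rfl⟩ (by
          rw [abs_of_nonneg (by linarith)]
          linarith)
        have : MonotoneOn L (Set.Icc S s) := by
          refine monotoneOn_of_hasDerivWithinAt_nonneg (convex_Icc _ _)
            (fun x hx => (hL x (hS0.trans_le hx.1)).continuousAt.continuousWithinAt)
            (fun x hx => (hL x (hS0.trans_le (interior_subset hx).1)).hasDerivWithinAt)
            fun x hx => ?_
          have hx := interior_subset hx
          have hhx : h < x := by linarith [hx.1]
          simp only [L']
          rw [hK.subdensityEst_eq_zero (i := 0) hh hhx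
            (fun j _ hj => by linarith [hmark j hj, hx.1]), mul_zero, sub_zero]
          refine mul_nonneg (sub_nonneg.2 hN1) ?_
          rw [IsSubdensitySample.subdensityEst_eq hhx, empiricalIntegral]
          refine mul_nonneg (by positivity) (Finset.sum_nonneg fun j _ => ?_)
          split_ifs
          · exact mul_nonneg (by positivity) (hK.nonneg _)
          · exact le_rfl
        exact hLS.trans (this ⟨le_rfl, hsS⟩ ⟨hsS, le_rfl⟩ hsS)
  simp only [L] at hLs
  rw [hK.distributionEst_eq hh hz n hs, hK.distributionEst_eq hh hz n ht0.le]
  linarith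

end ConditionK

/-! ### Asymptotic equivalence of the two estimators -/

/-- Perturbation of a strictly positive combination `(1 - p) d₁ - p d₀`. With `N` the naive
estimate, `(1 - N) D₁ - N D₀` is the vertical distance of the diagram from the line of slope `N`,
or its second derivative. -/
lemma nonneg_of_perturbation {N p D₁ D₀ d₁ d₀ K η e m : ℝ} (hN : |N - p| ≤ η) (hN0 : 0 ≤ N)
    (hN1 : N ≤ 1) (h1 : |D₁ - d₁| ≤ e) (h0 : |D₀ - d₀| ≤ e) (hK : |d₁ + d₀| ≤ K)
    (hm : m ≤ (1 - p) * d₁ - p * d₀) (hle : K * η + e ≤ m) : 0 ≤ (1 - N) * D₁ - N * D₀ := by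
  have e1 : (1 - N) * (d₁ - e) ≤ (1 - N) * D₁ :=
    mul_le_mul_of_nonneg_left (by linarith [(abs_le.1 h1).1]) (by linarith)
  have e0 : N * D₀ ≤ N * (d₀ + e) :=
    mul_le_mul_of_nonneg_left (by linarith [(abs_le.1 h0).2]) hN0
  have e2 : (N - p) * (d₁ + d₀) ≤ η * K := by
    refine (le_abs_self _).trans ?_
    rw [abs_mul]
    exact mul_le_mul hN hK (abs_nonneg _) ((abs_nonneg _).trans hN)
  nlinarith

namespace IsSubdensitySample

variable {Ω : Type*} [MeasurableSpace Ω] {P : Measure Ω} [IsProbabilityMeasure P]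
  {Z : ℕ → Ω → ℝ × Fin 2} {q : Fin 2 → ℝ → ℝ}

lemma densityEst_consistent (hZ : IsSubdensitySample P Z q) {k : ℝ → ℝ} (hK : ConditionK k)
    {c : ℝ} (hc : 0 < c) {t : ℝ} (ht : 0 < t) (hq : ∀ i, ContinuousAt (q i) t) {ε : ℝ}
    (hε : 0 < ε) :
    WithHighProbability P fun n ω =>
      |densityEst k (bandwidth c n) (fun j => Z j ω) n t - (q 0 t + q 1 t)| < ε := by
  refine ((hZ.subdensityEst_consistent hK hc ht 0 (hq 0) (half_pos hε)).and
    (hZ.subdensityEst_consistent hK hc ht 1 (hq 1) (half_pos hε))).mono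
      (Eventually.of_forall fun n ω hω => ?_)
  have h0 := abs_lt.1 hω.1
  have h1 := abs_lt.1 hω.2
  rw [densityEst, abs_lt]
  constructor <;> linarith

lemma densityEst_pos (hZ : IsSubdensitySample P Z q) {k : ℝ → ℝ} (hK : ConditionK k)
    {c : ℝ} (hc : 0 < c) {t : ℝ} (ht : 0 < t) (hq : ∀ i, ContinuousAt (q i) t)
    (hpos : 0 < q 0 t + q 1 t) :
    WithHighProbability P fun n ω => 0 < densityEst k (bandwidth c n) (fun j => Z j ω) n t := by
  refine (hZ.densityEst_consistent hK hc ht hq hpos).mono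
    (Eventually.of_forall fun n ω hω => ?_)
  linarith [(abs_lt.1 hω).1]

/-- Pointwise consistency of the naive estimator. -/
lemma naiveEst_consistent (hZ : IsSubdensitySample P Z q) {k : ℝ → ℝ} (hK : ConditionK k)
    {c : ℝ} (hc : 0 < c) {t : ℝ} (ht : 0 < t) (hq : ∀ i, ContinuousAt (q i) t)
    (hpos : 0 < q 0 t + q 1 t) {ε : ℝ} (hε : 0 < ε) :
    WithHighProbability P fun n ω =>
      |naiveEst k (bandwidth c n) (fun j => Z j ω) n t - q 1 t / (q 0 t + q 1 t)| < ε := by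
  have hcont : ContinuousAt (fun x : ℝ × ℝ => x.2 / (x.1 + x.2)) (q 0 t, q 1 t) :=
    ContinuousAt.div continuousAt_snd (continuousAt_fst.add continuousAt_snd) hpos.ne'
  obtain ⟨δ, hδ, hδε⟩ := Metric.continuousAt_iff.1 hcont ε hε
  refine ((hZ.subdensityEst_consistent hK hc ht 0 (hq 0) hδ).and
    (hZ.subdensityEst_consistent hK hc ht 1 (hq 1) hδ)).mono
      (Eventually.of_forall fun n ω hω => ?_)
  exact hδε (x := (subdensityEst k (bandwidth c n) (fun j => Z j ω) n 0 t,
    subdensityEst k (bandwidth c n) (fun j => Z j ω) n 1 t))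
    (by rw [Prod.dist_eq]; exact max_lt hω.1 hω.2)

/-- With probability tending to one, the maximum smoothed likelihood estimator and the naive
estimator coincide at `t`. In the limit the diagram lies above its tangent at `t`, with second
derivative `(1 - p) q₁' - p q₀' > 0` there and with a distance bounded below away from `t`; uniform
consistency of the derivatives near `t` and of the integrated estimators on `[0, M + 1]` carries
this over to the estimated diagram. -/
lemma msleEst_eq_naiveEst (hZ : IsSubdensitySample P Z q) {k : ℝ → ℝ} (hK : ConditionK k)
    {c : ℝ} (hc : 0 < c) {t M r p : ℝ} (ht : 0 < t) (htM : t < M) (hr : 0 < r)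
    (h0 : ∀ i, ∫ u in Set.Iic 0, q i u = 0) (hM : ∫ u in Set.Ioi M, q 0 u = 0)
    {q' : Fin 2 → ℝ → ℝ}
    (hd : ∀ i, ∀ x ∈ Set.Icc (t - r) (t + r), HasDerivAt (q i) (q' i x) x)
    (hq' : ∀ i, ContinuousOn (q' i) (Set.Icc (t - r) (t + r)))
    (hp0 : 0 < p) (hp1 : p < 1) (hpos : 0 < q 0 t + q 1 t) (hpt : q 1 t / (q 0 t + q 1 t) = p)
    (hslope : 0 < (1 - p) * q' 1 t - p * q' 0 t)
    (hneg : ∀ u ∈ Set.Ioo 0 t, (1 - p) * q 1 u - p * q 0 u < 0)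
    (hpos' : ∀ u ∈ Set.Ioo t M, 0 < (1 - p) * q 1 u - p * q 0 u)
    (hnn : ∀ u, t < u → 0 ≤ (1 - p) * q 1 u - p * q 0 u) :
    WithHighProbability P fun n ω => msleEst k (bandwidth c n) (fun j => Z j ω) n t =
      naiveEst k (bandwidth c n) (fun j => Z j ω) n t := by
  have hnhds : Set.Icc (t - r) (t + r) ∈ 𝓝 t := Icc_mem_nhds (by linarith) (by linarith)
  have hq : ∀ i, ContinuousAt (q i) t := fun i =>
    (hd i t (mem_of_mem_nhds hnhds)).continuousAt
  set m := ((1 - p) * q' 1 t - p * q' 0 t) / 2 with hm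
  have hm0 : 0 < m := half_pos hslope
  -- The half-width of a window around `t` on which the limiting slope is bounded below.
  have hslope_ev : ∀ᶠ s in 𝓝 t, m < (1 - p) * q' 1 s - p * q' 0 s := by
    have hc : ContinuousAt (fun s => (1 - p) * q' 1 s - p * q' 0 s) t :=
      (((hq' 1).continuousAt hnhds).const_mul _).sub (((hq' 0).continuousAt hnhds).const_mul _)
    exact hc.eventually (lt_mem_nhds (half_lt_self hslope))
  obtain ⟨δ₀, hδ₀, hδ₀s⟩ := Metric.eventually_nhds_iff.1 hslope_ev
  set δ := min (min (δ₀ / 2) (r / 2)) (min (t / 2) ((M - t) / 2)) with hδ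
  have hδpos : 0 < δ := by
    have : 0 < M - t := sub_pos.2 htM
    simp only [hδ, lt_min_iff]
    refine ⟨⟨?_, ?_⟩, ?_, ?_⟩ <;> linarith
  have hδ1 : δ ≤ δ₀ / 2 := (min_le_left _ _).trans (min_le_left _ _)
  have hδ2 : δ ≤ r / 2 := (min_le_left _ _).trans (min_le_right _ _)
  have hδ3 : δ ≤ t / 2 := (min_le_right _ _).trans (min_le_left _ _)
  have hδ4 : δ ≤ (M - t) / 2 := (min_le_right _ _).trans (min_le_right _ _)
  have hwin : ∀ s ∈ Set.Icc (t - δ) (t + δ), m ≤ (1 - p) * q' 1 s - p * q' 0 s := by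
    intro s hs
    refine (hδ₀s ?_).le
    rw [Real.dist_eq, abs_lt]
    constructor <;> linarith [hs.1, hs.2]
  have hsub : Set.Icc (t - δ - δ) (t + δ + δ) ⊆ Set.Icc (t - r) (t + r) :=
    Set.Icc_subset_Icc (by linarith) (by linarith)
  obtain ⟨K, hK'⟩ := isCompact_Icc.exists_bound_of_continuousOn ((hq' 1).add (hq' 0))
  have hK0 : 0 ≤ K := (norm_nonneg _).trans (hK' t (mem_of_mem_nhds hnhds))
  -- The limiting vertical distance is bounded away from zero outside the window.
  let w : ℝ → ℝ := fun u => (1 - p) * q 1 u - p * q 0 u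
  have hwi : Integrable w :=
    ((hZ.integrable 1).const_mul (1 - p)).sub ((hZ.integrable 0).const_mul p)
  have hwii : ∀ a b, IntervalIntegrable w volume a b := fun a b => hwi.intervalIntegrable
  have hη₁ : 0 < ∫ u in t..(t + δ), w u :=
    intervalIntegral.intervalIntegral_pos_of_pos_on (hwii _ _)
      (fun u hu => hpos' u ⟨hu.1, by linarith [hu.2]⟩) (by linarith)
  have hη₂ : 0 < ∫ u in (t - δ)..t, -w u :=
    intervalIntegral.intervalIntegral_pos_of_pos_on (hwii _ _).neg
      (fun u hu => neg_pos.2 (hneg u ⟨by linarith [hu.1], hu.2⟩)) (by linarith)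
  set η₀ := min (∫ u in t..(t + δ), w u) (∫ u in (t - δ)..t, -w u) with hη₀
  have hη₀pos : 0 < η₀ := lt_min hη₁ hη₂
  have hΛ : ∀ s, 0 ≤ s → δ ≤ |s - t| → η₀ ≤ ∫ u in t..s, w u := by
    intro s hs hst
    rcases le_abs.1 hst with h | h
    · refine (min_le_left _ _).trans ?_
      rw [← intervalIntegral.integral_add_adjacent_intervals (hwii t (t + δ)) (hwii (t + δ) s)]
      have : 0 ≤ ∫ u in (t + δ)..s, w u := by
        refine intervalIntegral.integral_nonneg (by linarith) fun u hu => hnn u ?_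
        linarith [hu.1]
      linarith
    · refine (min_le_right _ _).trans ?_
      have hsplit : ∫ u in t..s, w u =
          (∫ u in s..(t - δ), -w u) + ∫ u in (t - δ)..t, -w u := by
        rw [intervalIntegral.integral_neg, intervalIntegral.integral_neg,
          intervalIntegral.integral_symm s t,
          ← intervalIntegral.integral_add_adjacent_intervals (hwii s (t - δ)) (hwii (t - δ) t)]
        ring
      rw [hsplit]
      have : 0 ≤ ∫ u in s..(t - δ), -w u := by
        rw [intervalIntegral.integral_of_le (by linarith)]
        refine setIntegral_nonneg measurableSet_Ioc fun u hu => ?_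
        exact neg_nonneg.2 (hneg u ⟨by linarith [hu.1], by linarith [hu.2]⟩).le
      linarith
  set A := (∫ u, q 1 u) + ∫ u, q 0 u with hA
  have hA0 : 0 ≤ A := add_nonneg (integral_nonneg (hZ.nonneg 1)) (integral_nonneg (hZ.nonneg 0))
  have hAbd : ∀ s, |(∫ u in t..s, q 1 u) + ∫ u in t..s, q 0 u| ≤ A := by
    intro s
    have hb : ∀ i, |∫ u in t..s, q i u| ≤ ∫ u, q i u := by
      intro i
      have h1 := intervalIntegral.norm_integral_le_integral_norm_uIoc (f := q i) (a := t) (b := s)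
        (μ := volume)
      refine h1.trans ?_
      have : ∀ u, ‖q i u‖ = q i u := fun u => Real.norm_of_nonneg (hZ.nonneg i u)
      simp_rw [this]
      exact setIntegral_le_integral (hZ.integrable i) (ae_of_all _ (hZ.nonneg i))
    exact (abs_add_le _ _).trans (add_le_add (hb 1) (hb 0))
  -- The accuracy of the estimators for which both lower bounds survive.
  obtain ⟨η, hη, hηK, hηA, hηp, hηp1⟩ : ∃ η > 0, K * η + η ≤ m ∧ A * η + 2 * η ≤ η₀ ∧
      η ≤ p ∧ η ≤ 1 - p := by
    refine ⟨min (min (m / (K + 1)) (η₀ / (A + 2))) (min p (1 - p)), ?_, ?_, ?_, ?_, ?_⟩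
    · exact lt_min (lt_min (by positivity) (by positivity)) (lt_min hp0 (by linarith))
    · have : min (min (m / (K + 1)) (η₀ / (A + 2))) (min p (1 - p)) ≤ m / (K + 1) :=
        (min_le_left _ _).trans (min_le_left _ _)
      rw [le_div_iff₀ (by positivity)] at this
      linarith
    · have : min (min (m / (K + 1)) (η₀ / (A + 2))) (min p (1 - p)) ≤ η₀ / (A + 2) :=
        (min_le_left _ _).trans (min_le_right _ _)
      rw [le_div_iff₀ (by positivity)] at this
      linarith
    · exact (min_le_right _ _).trans (min_le_left _ _)
    · exact (min_le_right _ _).trans (min_le_right _ _)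
  have hS0 : (0 : ℝ) ≤ M + 1 := by linarith
  have hder : ∀ i, WithHighProbability P fun n ω => ∀ s ∈ Set.Icc (t - δ) (t + δ),
      |empiricalIntegral (fun j => Z j ω) n i
        (fun u => (bandwidth c n)⁻¹ ^ 2 * deriv k ((s - u) / bandwidth c n)) - q' i s| < η :=
    fun i => hZ.deriv_subdensityEst_consistent hK hc i (by linarith) hδpos
      (fun x hx => hd i x (hsub hx)) ((hq' i).mono hsub) hη
  have hdist : ∀ i, WithHighProbability P fun n ω => ∀ s ∈ Set.Icc 0 (M + 1),
      |subdistributionEst k (bandwidth c n) (fun j => Z j ω) n i s -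
        ∫ u in (0 : ℝ)..s, q i u| < η :=
    fun i => hZ.subdistributionEst_consistent hK hc h0 i hS0 hη
  have hnaive := hZ.naiveEst_consistent hK hc ht hq hpos hη
  have hpos_est := hZ.densityEst_pos hK hc ht hq hpos
  have hae : ∀ᵐ ω ∂P, (∀ j, 0 < (Z j ω).1) ∧ ∀ j, (Z j ω).2 = 0 → (Z j ω).1 ≤ M := by
    filter_upwards [hZ.ae_pos h0, hZ.ae_notMem measurableSet_Ioi hM] with ω h1 h2
    exact ⟨h1, fun j hj => not_lt.1 (h2 j hj)⟩
  refine ((((((hder 0).and (hder 1)).and ((hdist 0).and (hdist 1))).and hnaive).and hpos_est).and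
    (WithHighProbability.of_ae fun _ => hae)).mono ?_
  filter_upwards [eventually_gt_atTop 0,
    (tendsto_bandwidth c).eventually (gt_mem_nhds (show (0 : ℝ) < t - δ by linarith)),
    (tendsto_bandwidth c).eventually (gt_mem_nhds one_pos)] with n hn hnt hn1 ω hω
  obtain ⟨⟨⟨⟨⟨hD0, hD1⟩, hG0, hG1⟩, hN⟩, hdpos⟩, hz, hmark⟩ := hω
  have hh := bandwidth_pos hc hn
  rw [hpt] at hN
  have hN' := abs_lt.1 hN
  have hN0 : 0 ≤ naiveEst k (bandwidth c n) (fun j => Z j ω) n t := by linarith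
  have hN1 : naiveEst k (bandwidth c n) (fun j => Z j ω) n t ≤ 1 := by linarith
  refine hK.msleEst_eq_naiveEst hh hz ht hdpos fun s hs => ?_
  refine hK.supporting_line hh hz (M := M) (S := M + 1) hδpos hnt (by linarith) (by linarith)
    hmark hdpos hN1 (fun s hs => ?_) (fun s hs hst => ?_) hs
  · exact nonneg_of_perturbation hN.le hN0 hN1 (hD1 s hs).le (hD0 s hs).le
      (hK' s ⟨by linarith [hs.1], by linarith [hs.2]⟩) (hwin s hs) hηK
  · have hint : ∀ i a b, IntervalIntegrable (q i) volume a b := fun i a b =>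
      (hZ.integrable i).intervalIntegrable
    have hdiff : ∀ i, ∫ u in t..s, q i u =
        (∫ u in (0 : ℝ)..s, q i u) - ∫ u in (0 : ℝ)..t, q i u := fun i =>
      (intervalIntegral.integral_interval_sub_left (hint i 0 s) (hint i 0 t)).symm
    have htS : t ∈ Set.Icc 0 (M + 1) := ⟨ht.le, by linarith⟩
    have herr : ∀ i, (∀ s ∈ Set.Icc 0 (M + 1),
        |subdistributionEst k (bandwidth c n) (fun j => Z j ω) n i s -
          ∫ u in (0 : ℝ)..s, q i u| < η) →
        |(subdistributionEst k (bandwidth c n) (fun j => Z j ω) n i s -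
          subdistributionEst k (bandwidth c n) (fun j => Z j ω) n i t) - ∫ u in t..s, q i u| ≤
          2 * η := by
      intro i hG
      have h1 := abs_lt.1 (hG s hs)
      have h2 := abs_lt.1 (hG t htS)
      rw [hdiff i, abs_le]
      constructor <;> linarith
    refine nonneg_of_perturbation hN.le hN0 hN1 (herr 1 hG1) (herr 0 hG0) (hAbd s) ?_ hηA
    refine (hΛ s hs.1 hst).trans (le_of_eq ?_)
    rw [← intervalIntegral.integral_const_mul, ← intervalIntegral.integral_const_mul,
      ← intervalIntegral.integral_sub ((hint 1 _ _).const_mul _) ((hint 0 _ _).const_mul _)]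

end IsSubdensitySample

/-! ### The lower convex hull of a compact planar set -/

/-- By Carathéodory's theorem, the convex hull of a compact set is a continuous image of a compact
set of weights and vertices. -/
lemma isCompact_convexHull {E : Type*} [AddCommGroup E] [Module ℝ E] [TopologicalSpace E]
    [IsTopologicalAddGroup E] [ContinuousSMul ℝ E] [FiniteDimensional ℝ E] {S : Set E}
    (hS : IsCompact S) : IsCompact (convexHull ℝ S) := by
  rcases S.eq_empty_or_nonempty with rfl | ⟨s₀, hs₀⟩
  · simp
  set d := Module.finrank ℝ E + 1 with hd
  have hK : IsCompact (stdSimplex ℝ (Fin d) ×ˢ Set.univ.pi fun _ : Fin d => S) :=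
    (isCompact_stdSimplex ℝ (Fin d)).prod (isCompact_univ_pi fun _ => hS)
  have hf : Continuous fun p : (Fin d → ℝ) × (Fin d → E) => ∑ j, p.1 j • p.2 j := by fun_prop
  convert hK.image hf
  refine Set.Subset.antisymm (fun x hx => ?_) ?_
  · obtain ⟨ι, _, z, w, hz, hind, hw, hw1, rfl⟩ := eq_pos_convex_span_of_mem_convexHull hx
    have hcard : Fintype.card ι ≤ d :=
      (hind.card_le_finrank_succ).trans (Nat.succ_le_succ (Submodule.finrank_le _))
    obtain ⟨e⟩ : Nonempty (ι ↪ Fin d) :=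
      Function.Embedding.nonempty_of_card_le (by simpa using hcard)
    have hout : ∀ j, j ∉ Set.range e → Function.extend e w 0 j = 0 := fun j hj =>
      Function.extend_apply' _ _ _ hj
    refine ⟨(Function.extend e w 0, Function.extend e z fun _ => s₀), ⟨⟨fun j => ?_, ?_⟩, ?_⟩, ?_⟩
    · by_cases hj : j ∈ Set.range e
      · obtain ⟨i, rfl⟩ := hj
        simpa [e.injective.extend_apply] using (hw i).le
      · exact (hout j hj).ge
    · rw [← hw1]
      exact (Fintype.sum_of_injective e e.injective _ _ hout
        fun i => (e.injective.extend_apply _ _ i).symm).symm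
    · intro j _
      by_cases hj : j ∈ Set.range e
      · obtain ⟨i, rfl⟩ := hj
        simpa [e.injective.extend_apply] using hz ⟨i, rfl⟩
      · simpa only [Function.extend_apply' _ _ _ hj] using hs₀
    · refine (Fintype.sum_of_injective e e.injective _ _ (fun j hj => ?_) fun i => ?_).symm
      · simp only [hout j hj, zero_smul]
      · simp only [e.injective.extend_apply]
  · rintro _ ⟨⟨w, z⟩, ⟨hw, hz⟩, rfl⟩
    exact (convex_convexHull ℝ S).sum_mem (fun j _ => hw.1 j) hw.2
      fun j _ => subset_convexHull ℝ S (hz j trivial)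

/-- The intercept of the supporting line of slope `l` of a planar set. -/
noncomputable def supportIntercept (S : Set (ℝ × ℝ)) (l : ℝ) : ℝ :=
  sInf ((fun p : ℝ × ℝ => p.2 - l * p.1) '' S)

lemma supportIntercept_add_le {S : Set (ℝ × ℝ)} (hS : IsCompact S) (l : ℝ) {p : ℝ × ℝ}
    (hp : p ∈ convexHull ℝ S) : supportIntercept S l + l * p.1 ≤ p.2 := by
  refine le_of_mem_convexHull (fun q hq => ?_) hp
  have hb : BddBelow ((fun p : ℝ × ℝ => p.2 - l * p.1) '' S) :=
    (hS.image (by fun_prop)).bddBelow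
  have := csInf_le hb ⟨q, hq, rfl⟩
  rw [supportIntercept]
  linarith

/-- Away from the projection of the set the lower convex hull takes the value `sInf ∅ = 0`. -/
lemma lowerConvexHull_eq_zero {S : Set (ℝ × ℝ)} {a b x : ℝ} (h : ∀ p ∈ S, p.1 ∈ Set.Icc a b)
    (hx : x ∉ Set.Icc a b) : lowerConvexHull S x = 0 := by
  have hconv : Convex ℝ {p : ℝ × ℝ | p.1 ∈ Set.Icc a b} :=
    (convex_Icc a b).is_linear_preimage (LinearMap.fst ℝ ℝ ℝ).isLinear
  have : {y : ℝ | (x, y) ∈ convexHull ℝ S} = ∅ :=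
    Set.eq_empty_of_forall_notMem fun y hy => hx (convexHull_min h hconv hy)
  rw [lowerConvexHull, this, Real.sInf_empty]

lemma exists_mem_convexHull {S : Set (ℝ × ℝ)} {p q : ℝ × ℝ} (hp : p ∈ S) (hq : q ∈ S) {x : ℝ}
    (hx : x ∈ Set.Icc p.1 q.1) : ∃ y, (x, y) ∈ convexHull ℝ S := by
  have himg : Convex ℝ (Prod.fst '' convexHull ℝ S) :=
    (convex_convexHull ℝ S).is_linear_image (LinearMap.fst ℝ ℝ ℝ).isLinear
  obtain ⟨r, hr, rfl⟩ := himg.ordConnected.out ⟨p, subset_convexHull ℝ S hp, rfl⟩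
    ⟨q, subset_convexHull ℝ S hq, rfl⟩ hx
  exact ⟨r.2, hr⟩

/-- On the projection of a compact set, the lower convex hull is the supremum of the supporting
lines with rational slope. -/
lemma isLUB_lowerConvexHull {S : Set (ℝ × ℝ)} (hS : IsCompact S) {x : ℝ}
    (hx : ∃ y, (x, y) ∈ convexHull ℝ S) :
    IsLUB (Set.range fun l : ℚ => supportIntercept S l + l * x) (lowerConvexHull S x) := by
  constructor
  · rintro _ ⟨l, rfl⟩
    exact le_csInf hx fun y hy => supportIntercept_add_le hS l hy
  intro B hB
  by_contra! hlt
  obtain ⟨y, hBy, hy⟩ := exists_between hlt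
  obtain ⟨y₀, hy₀⟩ := hx
  have hbdd : BddBelow {y : ℝ | (x, y) ∈ convexHull ℝ S} :=
    ⟨supportIntercept S 0 + 0 * x, fun y hy => supportIntercept_add_le hS 0 hy⟩
  have hnot : (x, y) ∉ convexHull ℝ S := fun h => hy.not_ge (csInf_le hbdd h)
  have hyy₀ : y < y₀ := hy.trans_le (csInf_le hbdd hy₀)
  obtain ⟨f, u, hfu, hu⟩ := geometric_hahn_banach_closed_point (convex_convexHull ℝ S)
    (isCompact_convexHull hS).isClosed hnot
  set α := f (1, 0) with hα
  set β := f (0, 1) with hβ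
  have hf : ∀ p : ℝ × ℝ, f p = α * p.1 + β * p.2 := by
    intro p
    have : p = p.1 • ((1, 0) : ℝ × ℝ) + p.2 • ((0, 1) : ℝ × ℝ) := by ext <;> simp
    conv_lhs => rw [this]
    rw [map_add, map_smul, map_smul, smul_eq_mul, smul_eq_mul]
    ring
  have h1 := (hfu _ hy₀).trans hu
  rw [hf, hf] at h1
  have hβ0 : β < 0 := by
    by_contra! h
    have := mul_le_mul_of_nonneg_left hyy₀.le h
    simp only at h1
    linarith
  -- The separating line has slope `-α / β` and passes strictly below `S` by the margin `2 * e`.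
  have hsep : ∀ p ∈ S, y + (-α / β) * (p.1 - x) + (u - f (x, y)) / β ≤ p.2 := by
    intro p hp
    have h2 := (hfu p (subset_convexHull ℝ S hp)).le
    rw [hf] at h2 ⊢
    have : y + -α / β * (p.1 - x) + (u - (α * (x, y).1 + β * (x, y).2)) / β
        = (u - α * p.1) / β := by
      have := hβ0.ne
      field_simp
      ring
    rw [this, div_le_iff_of_neg hβ0]
    linarith
  have hmargin : 0 < (u - f (x, y)) / β := div_pos_of_neg_of_neg (sub_neg.2 hu) hβ0
  obtain ⟨R, hR⟩ := hS.isBounded.exists_norm_le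
  have hR0 : 0 < |x| + |R| + 1 := by positivity
  obtain ⟨l, hl1, hl2⟩ := exists_rat_btwn (show -α / β <
    -α / β + (u - f (x, y)) / β / (|x| + |R| + 1) from lt_add_of_pos_right _ (by positivity))
  have hSne : S.Nonempty := convexHull_nonempty_iff.1 ⟨_, hy₀⟩
  have hJ : y - l * x ≤ supportIntercept S l := by
    refine le_csInf (hSne.image _) ?_
    rintro _ ⟨p, hp, rfl⟩
    have h2 := hsep p hp
    have h3 : |p.1 - x| ≤ |x| + |R| + 1 := by
      have := (norm_fst_le p).trans (hR p hp)
      rw [Real.norm_eq_abs] at this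
      have := abs_sub p.1 x
      have := le_abs_self R
      linarith
    have h4 : (l - -α / β) * (p.1 - x) ≤ (u - f (x, y)) / β := by
      refine (mul_le_mul_of_nonneg_left ((le_abs_self _).trans h3) (by linarith)).trans ?_
      rw [← le_div_iff₀ hR0]
      linarith
    simp only
    nlinarith
  have := hB ⟨l, rfl⟩
  simp only at this
  linarith

lemma convexOn_lowerConvexHull {S : Set (ℝ × ℝ)} (hS : IsCompact S) {p q : ℝ × ℝ} (hp : p ∈ S)
    (hq : q ∈ S) : ConvexOn ℝ (Set.Icc p.1 q.1) (lowerConvexHull S) := by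
  refine ⟨convex_Icc _ _, fun x hx x' hx' a b ha hb hab => ?_⟩
  have hlub := fun x hx => isLUB_lowerConvexHull hS (exists_mem_convexHull hp hq (x := x) hx)
  refine (hlub _ (convex_Icc _ _ hx hx' ha hb hab)).2 ?_
  rintro _ ⟨l, rfl⟩
  have h1 := mul_le_mul_of_nonneg_left ((hlub x hx).1 ⟨l, rfl⟩) ha
  have h2 := mul_le_mul_of_nonneg_left ((hlub x' hx').1 ⟨l, rfl⟩) hb
  simp only [smul_eq_mul] at *
  calc supportIntercept S l + l * (a * x + b * x')
      = a * (supportIntercept S l + l * x) + b * (supportIntercept S l + l * x') := by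
        linear_combination -supportIntercept S l * hab
    _ ≤ _ := by linarith

/-! ### Right derivatives along a sequence -/

lemma tendsto_nhdsGT_of_monotoneOn {f : ℝ → ℝ} {x ε L : ℝ} (hε : 0 < ε)
    (hf : MonotoneOn f (Set.Ioo x (x + ε)))
    (hL : Tendsto (fun m : ℕ => f (x + 1 / ((m : ℝ) + 1))) atTop (𝓝 L)) :
    Tendsto f (𝓝[>] x) (𝓝 L) := by
  have hsmall : ∀ δ > 0, ∀ᶠ m : ℕ in atTop, x + 1 / ((m : ℝ) + 1) ∈ Set.Ioo x (x + δ) := by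
    intro δ hδ
    filter_upwards [tendsto_one_div_add_atTop_nhds_zero_nat.eventually (gt_mem_nhds hδ)] with m hm
    have : 0 < 1 / ((m : ℝ) + 1) := by positivity
    exact ⟨by linarith, by linarith⟩
  rw [tendsto_order] at hL ⊢
  constructor
  · intro a ha
    filter_upwards [Ioo_mem_nhdsGT (lt_add_of_pos_right x hε)] with y hy
    obtain ⟨m, hm1, hm2⟩ := ((hL.1 a ha).and (hsmall (y - x) (sub_pos.2 hy.1))).exists
    rw [add_sub_cancel] at hm2
    exact hm1.trans_le (hf ⟨hm2.1, hm2.2.trans hy.2⟩ hy hm2.2.le)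
  · intro a ha
    obtain ⟨m, hm1, hm2⟩ := ((hL.2 a ha).and (hsmall ε hε)).exists
    filter_upwards [Ioo_mem_nhdsGT hm2.1] with y hy
    exact (hf ⟨hy.1, hy.2.trans hm2.2⟩ hm2 hy.2.le).trans_lt hm1

/-- The difference quotient of `f` at `x` with increment `1 / (m + 1)`. -/
noncomputable def rightQuotient (f : ℝ → ℝ) (x : ℝ) (m : ℕ) : ℝ :=
  ((m : ℝ) + 1) * (f (x + 1 / ((m : ℝ) + 1)) - f x)

lemma rightQuotient_eq_slope (f : ℝ → ℝ) (x : ℝ) (m : ℕ) :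
    rightQuotient f x m = slope f x (x + 1 / ((m : ℝ) + 1)) := by
  rw [rightQuotient, slope_def_field, add_sub_cancel_left, div_div_eq_mul_div, div_one, mul_comm]

lemma tendsto_rightQuotient {f : ℝ → ℝ} {x L : ℝ} (h : HasDerivWithinAt f L (Set.Ioi x) x) :
    Tendsto (rightQuotient f x) atTop (𝓝 L) := by
  rw [hasDerivWithinAt_iff_tendsto_slope' Set.self_notMem_Ioi] at h
  have hx : Tendsto (fun m : ℕ => x + 1 / ((m : ℝ) + 1)) atTop (𝓝[>] x) := by
    rw [tendsto_nhdsWithin_iff]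
    constructor
    · simpa using tendsto_one_div_add_atTop_nhds_zero_nat.const_add x
    · refine Eventually.of_forall fun m => ?_
      have : 0 < 1 / ((m : ℝ) + 1) := by positivity
      exact Set.mem_Ioi.2 (by linarith)
  refine (h.comp hx).congr fun m => (rightQuotient_eq_slope f x m).symm

lemma hasDerivWithinAt_of_tendsto_rightQuotient {f : ℝ → ℝ} {x ε L : ℝ} (hε : 0 < ε)
    (hf : MonotoneOn (slope f x) (Set.Ioo x (x + ε)) ∨ AntitoneOn (slope f x) (Set.Ioo x (x + ε)))
    (hL : Tendsto (rightQuotient f x) atTop (𝓝 L)) : HasDerivWithinAt f L (Set.Ioi x) x := by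
  rw [hasDerivWithinAt_iff_tendsto_slope' Set.self_notMem_Ioi]
  simp only [funext (rightQuotient_eq_slope f x)] at hL
  rcases hf with hf | hf
  · exact tendsto_nhdsGT_of_monotoneOn hε hf hL
  · have := tendsto_nhdsGT_of_monotoneOn hε hf.neg hL.neg
    simpa using this.neg

/-- The lower convex hull has monotone difference quotients to the right of every point: it is
convex over the projection of the set and constant elsewhere. -/
lemma slope_lowerConvexHull {S : Set (ℝ × ℝ)} (hS : IsCompact S) (hne : S.Nonempty) (x : ℝ) :
    ∃ ε > 0, MonotoneOn (slope (lowerConvexHull S) x) (Set.Ioo x (x + ε)) ∨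
      AntitoneOn (slope (lowerConvexHull S) x) (Set.Ioo x (x + ε)) := by
  obtain ⟨p, hp, hpmin⟩ := hS.exists_isMinOn hne continuous_fst.continuousOn
  obtain ⟨q, hq, hqmax⟩ := hS.exists_isMaxOn hne continuous_fst.continuousOn
  have hpq : ∀ r ∈ S, r.1 ∈ Set.Icc p.1 q.1 := fun r hr => ⟨hpmin hr, hqmax hr⟩
  have hout : ∀ ε > 0, (∀ y ∈ Set.Ioo x (x + ε), y ∉ Set.Icc p.1 q.1) →
      MonotoneOn (slope (lowerConvexHull S) x) (Set.Ioo x (x + ε)) ∨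
      AntitoneOn (slope (lowerConvexHull S) x) (Set.Ioo x (x + ε)) := by
    intro ε _ h
    have hs : ∀ y ∈ Set.Ioo x (x + ε),
        slope (lowerConvexHull S) x y = (0 - lowerConvexHull S x) / (y - x) := fun y hy => by
      rw [slope_def_field, lowerConvexHull_eq_zero hpq (h y hy)]
    rcases le_total 0 (lowerConvexHull S x) with h0 | h0
    · left
      intro y hy y' hy' hyy'
      rw [hs y hy, hs y' hy', zero_sub, neg_div, neg_div, neg_le_neg_iff]
      exact div_le_div_of_nonneg_left h0 (sub_pos.2 hy.1) (by linarith)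
    · right
      intro y hy y' hy' hyy'
      rw [hs y hy, hs y' hy', zero_sub]
      exact div_le_div_of_nonneg_left (neg_nonneg.2 h0) (sub_pos.2 hy.1) (by linarith)
  rcases lt_or_ge x p.1 with hx | hx
  · refine ⟨p.1 - x, sub_pos.2 hx, hout _ (sub_pos.2 hx) fun y hy hy' => ?_⟩
    linarith [hy.2, hy'.1]
  rcases lt_or_ge x q.1 with hx' | hx'
  · refine ⟨q.1 - x, sub_pos.2 hx', Or.inl ?_⟩
    refine ((convexOn_lowerConvexHull hS hp hq).slope_mono ⟨hx, hx'.le⟩).mono fun y hy => ?_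
    exact ⟨⟨hx.trans hy.1.le, by linarith [hy.2]⟩, hy.1.ne'⟩
  · exact ⟨1, one_pos, hout 1 one_pos fun y hy hy' => by linarith [hy.1, hy'.2]⟩

/-- The right derivative is the limit of the difference quotients along a sequence where that limit
exists, and the value `0` of `derivWithin` elsewhere; hence it is measurable in a parameter. -/
lemma measurable_derivWithin_lowerConvexHull {Ω : Type*} [MeasurableSpace Ω]
    {S : Ω → Set (ℝ × ℝ)} {x : Ω → ℝ} (hS : ∀ ω, IsCompact (S ω)) (hne : ∀ ω, (S ω).Nonempty)
    (hx : Measurable x)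
    (hmeas : ∀ y : Ω → ℝ, Measurable y → Measurable fun ω => lowerConvexHull (S ω) (y ω)) :
    Measurable fun ω => derivWithin (lowerConvexHull (S ω)) (Set.Ioi (x ω)) (x ω) := by
  have hq : ∀ m, Measurable fun ω => rightQuotient (lowerConvexHull (S ω)) (x ω) m := fun m =>
    ((hmeas _ (hx.add_const _)).sub (hmeas _ hx)).const_mul _
  set A := {ω | ∃ L, Tendsto (fun m => rightQuotient (lowerConvexHull (S ω)) (x ω) m) atTop (𝓝 L)}
    with hA
  have hAm : MeasurableSet A := measurableSet_exists_tendsto hq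
  refine measurable_of_tendsto_metrizable (fun m => (hq m).indicator hAm)
    (tendsto_pi_nhds.2 fun ω => ?_)
  by_cases hω : ω ∈ A
  · simp only [Set.indicator_of_mem hω]
    obtain ⟨L, hL⟩ := hω
    obtain ⟨ε, hε, hmono⟩ := slope_lowerConvexHull (hS ω) (hne ω) (x ω)
    rwa [(hasDerivWithinAt_of_tendsto_rightQuotient hε hmono hL).derivWithin
      (uniqueDiffWithinAt_Ioi _)]
  · simp only [Set.indicator_of_notMem hω]
    rw [derivWithin_zero_of_not_differentiableWithinAt fun h =>
      hω ⟨_, tendsto_rightQuotient h.hasDerivWithinAt⟩]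
    exact tendsto_const_nhds

/-- The lower convex hull of a curve over `[0, τ]` depends measurably on a parameter. -/
lemma measurable_lowerConvexHull {Ω : Type*} [MeasurableSpace Ω] {u v : Ω → ℝ → ℝ} {τ y : Ω → ℝ}
    (hu : ∀ s, Measurable fun ω => u ω s) (hv : ∀ s, Measurable fun ω => v ω s)
    (hu' : ∀ ω, Continuous (u ω)) (hv' : ∀ ω, Continuous (v ω)) (hτ : Measurable τ)
    (hτ0 : ∀ ω, 0 ≤ τ ω) (hy : Measurable y) :
    Measurable fun ω =>
      lowerConvexHull ((fun s => (u ω s, v ω s)) '' Set.Icc 0 (τ ω)) (y ω) := by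
  have hS : ∀ ω, IsCompact ((fun s => (u ω s, v ω s)) '' Set.Icc 0 (τ ω)) := fun ω =>
    isCompact_Icc.image ((hu' ω).prodMk (hv' ω))
  have hne : ∀ ω, ((fun s => (u ω s, v ω s)) '' Set.Icc 0 (τ ω)).Nonempty := fun ω =>
    ⟨_, 0, ⟨le_rfl, hτ0 ω⟩, rfl⟩
  -- Extrema of a continuous random curve over a random interval are measurable.
  have hinf : ∀ w : Ω → ℝ → ℝ, (∀ s, Measurable fun ω => w ω s) → (∀ ω, Continuous (w ω)) →
      Measurable fun ω => sInf (w ω '' Set.Icc 0 (τ ω)) := by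
    intro w hw hw'
    have huncurry : Measurable (Function.uncurry fun s ω => w ω s) :=
      measurable_uncurry_of_continuous_of_measurable hw' hw
    have hpt : ∀ r : ℝ, Measurable fun ω => w ω (r * τ ω) := fun r =>
      huncurry.comp ((hτ.const_mul r).prodMk measurable_id)
    have heq : ∀ ω, sInf (w ω '' Set.Icc 0 (τ ω)) =
        ⨅ i : ℕ, w ω ((TopologicalSpace.denseSeq (Set.Icc (0 : ℝ) 1) i : ℝ) * τ ω) := by
      intro ω
      have hc : Continuous fun r : Set.Icc (0 : ℝ) 1 => w ω (r * τ ω) :=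
        (hw' ω).comp (by fun_prop)
      have h1 : w ω '' Set.Icc 0 (τ ω) = Set.range fun r : Set.Icc (0 : ℝ) 1 => w ω (r * τ ω) := by
        ext z
        constructor
        · rintro ⟨s, hs, rfl⟩
          rcases (hτ0 ω).eq_or_lt with h0 | h0
          · refine ⟨⟨0, by simp⟩, ?_⟩
            rw [← h0] at hs ⊢
            simp [le_antisymm hs.2 hs.1]
          · refine ⟨⟨s / τ ω, div_nonneg hs.1 h0.le, (div_le_one h0).2 hs.2⟩, ?_⟩
            simp [div_mul_cancel₀ _ h0.ne']
        · rintro ⟨r, rfl⟩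
          exact ⟨_, ⟨mul_nonneg r.2.1 (hτ0 ω), mul_le_of_le_one_left (hτ0 ω) r.2.2⟩, rfl⟩
      rw [h1, sInf_range, ← (TopologicalSpace.denseRange_denseSeq (Set.Icc (0 : ℝ) 1)).ciInf' hc,
        iInf, iInf]
      congr 1
      ext z
      simp
    simp only [heq]
    exact Measurable.iInf fun i => hpt _
  set a : Ω → ℝ := fun ω => sInf (u ω '' Set.Icc 0 (τ ω)) with ha
  set b : Ω → ℝ := fun ω => sInf ((fun s => -u ω s) '' Set.Icc 0 (τ ω)) with hb
  have ham : Measurable a := hinf u hu hu'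
  have hbm : Measurable b := hinf _ (fun s => (hu s).neg) fun ω => (hu' ω).neg
  have hJm : ∀ l : ℝ, Measurable fun ω =>
      supportIntercept ((fun s => (u ω s, v ω s)) '' Set.Icc 0 (τ ω)) l := by
    intro l
    simp only [supportIntercept, Set.image_image]
    exact hinf _ (fun s => (hv s).sub ((hu s).const_mul l))
      fun ω => (hv' ω).sub ((hu' ω).const_mul l)
  have hformula : ∀ ω, lowerConvexHull ((fun s => (u ω s, v ω s)) '' Set.Icc 0 (τ ω)) (y ω) =
      {ω | a ω ≤ y ω ∧ b ω ≤ -y ω}.indicator (fun ω => ⨆ l : ℚ,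
        supportIntercept ((fun s => (u ω s, v ω s)) '' Set.Icc 0 (τ ω)) l + l * y ω) ω := by
    intro ω
    have hcu := (hu' ω).continuousOn (s := Set.Icc 0 (τ ω))
    have hne' : (Set.Icc 0 (τ ω)).Nonempty := ⟨0, le_rfl, hτ0 ω⟩
    obtain ⟨s, hs, hsa⟩ := (isCompact_Icc.image_of_continuousOn hcu).sInf_mem (hne'.image _)
    obtain ⟨s', hs', hsb⟩ := (isCompact_Icc.image_of_continuousOn hcu.neg).sInf_mem (hne'.image _)
    have hmin : ∀ r ∈ Set.Icc 0 (τ ω), u ω s ≤ u ω r := fun r hr => by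
      rw [hsa]
      exact csInf_le (isCompact_Icc.image_of_continuousOn hcu).bddBelow ⟨r, hr, rfl⟩
    have hmax : ∀ r ∈ Set.Icc 0 (τ ω), u ω r ≤ u ω s' := fun r hr => by
      have : -u ω s' ≤ -u ω r := by
        have := csInf_le (isCompact_Icc.image_of_continuousOn hcu.neg).bddBelow ⟨r, hr, rfl⟩
        rw [← hsb] at this
        exact this
      linarith
    have hsb' : b ω = -u ω s' := hsb.symm
    have hsa' : a ω = u ω s := hsa.symm
    by_cases hω : a ω ≤ y ω ∧ b ω ≤ -y ω
    · rw [Set.indicator_of_mem (Set.mem_ofPred_eq ▸ hω)]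
      have hy' : y ω ∈ Set.Icc (u ω s) (u ω s') :=
        ⟨hsa' ▸ hω.1, by linarith [hω.2]⟩
      have hlub := isLUB_lowerConvexHull (hS ω) (exists_mem_convexHull
        (S := (fun s => (u ω s, v ω s)) '' Set.Icc 0 (τ ω)) ⟨s, hs, rfl⟩ ⟨s', hs', rfl⟩ hy')
      exact (hlub.csSup_eq (Set.range_nonempty _)).symm
    · rw [Set.indicator_of_notMem (by simpa using hω)]
      refine lowerConvexHull_eq_zero (a := u ω s) (b := u ω s') ?_ fun hmem => hω ?_
      · rintro _ ⟨r, hr, rfl⟩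
        exact ⟨hmin r hr, hmax r hr⟩
      · rw [hsa', hsb']
        exact ⟨hmem.1, neg_le_neg hmem.2⟩
  simp only [hformula]
  refine Measurable.indicator (Measurable.iSup fun l => (hJm l).add (hy.const_mul _)) ?_
  exact (measurableSet_le ham hy).inter (measurableSet_le hbm hy.neg)

/-! ### Measurability of the estimators -/

lemma measurable_empiricalIntegral {Ω : Type*} [MeasurableSpace Ω] {Z : ℕ → Ω → ℝ × Fin 2}
    (hZ : ∀ j, Measurable (Z j)) (n : ℕ) (i : Fin 2) {φ : ℝ → ℝ} (hφ : Measurable φ) :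
    Measurable fun ω => empiricalIntegral (fun j => Z j ω) n i φ := by
  unfold empiricalIntegral
  refine (Finset.measurable_fun_sum _ fun j _ => ?_).const_mul _
  exact Measurable.ite ((hZ j).snd (measurableSet_singleton i)) (hφ.comp (hZ j).fst)
    measurable_const

namespace ConditionK

variable {k : ℝ → ℝ} (hK : ConditionK k) {Ω : Type*} [MeasurableSpace Ω]
  {Z : ℕ → Ω → ℝ × Fin 2}
include hK

lemma measurable_subdensityEst (hZ : ∀ j, Measurable (Z j)) (h : ℝ) (n : ℕ) (i : Fin 2) (s : ℝ) :
    Measurable fun ω => subdensityEst k h (fun j => Z j ω) n i s := by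
  unfold subdensityEst
  have hk := hK.continuous.measurable
  split_ifs
  · refine measurable_empiricalIntegral hZ n i (Measurable.const_mul ?_ _)
    have : Measurable (boundaryKernel k (s / h)) := by
      unfold boundaryKernel
      exact Measurable.indicator (by fun_prop) measurableSet_Ioo
    exact this.comp (by fun_prop)
  · exact measurable_empiricalIntegral hZ n i ((hk.comp (by fun_prop)).const_mul _)

lemma measurable_densityEst (hZ : ∀ j, Measurable (Z j)) (h : ℝ) (n : ℕ) (s : ℝ) :
    Measurable fun ω => densityEst k h (fun j => Z j ω) n s :=
  (hK.measurable_subdensityEst hZ h n 0 s).add (hK.measurable_subdensityEst hZ h n 1 s)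

lemma measurable_naiveEst (hZ : ∀ j, Measurable (Z j)) (h : ℝ) (n : ℕ) (s : ℝ) :
    Measurable fun ω => naiveEst k h (fun j => Z j ω) n s :=
  (hK.measurable_subdensityEst hZ h n 1 s).div (hK.measurable_densityEst hZ h n s)

lemma measurable_subdistributionEst (hZ : ∀ j, Measurable (Z j)) (hpos : ∀ j ω, 0 < (Z j ω).1)
    {h : ℝ} (hh : 0 < h) (n : ℕ) (i : Fin 2) {s : ℝ} (hs : 0 ≤ s) :
    Measurable fun ω => subdistributionEst k h (fun j => Z j ω) n i s := by
  have hjoint : Measurable (Function.uncurry fun u ω =>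
      subdensityEst k h (fun j => Z j ω) n i (max 0 u)) := by
    refine measurable_uncurry_of_continuous_of_measurable (fun ω => ?_) fun u =>
      hK.measurable_subdensityEst hZ h n i _
    exact (hK.continuousOn_subdensityEst hh (fun j => hpos j ω) n i).comp_continuous
      (by fun_prop) fun u => Set.mem_Ici.2 (le_max_left _ _)
  have hint := (hjoint.comp measurable_swap).stronglyMeasurable.integral_prod_right'
    (ν := volume.restrict (Set.Ioc 0 s))
  convert hint.measurable using 2 with ω
  rw [subdistributionEst, intervalIntegral.integral_of_le hs]
  refine setIntegral_congr_fun measurableSet_Ioc fun u hu => ?_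
  simp [Function.uncurry, max_eq_right hu.1.le]

lemma measurable_diagramEnd (hZ : ∀ j, Measurable (Z j)) (hpos : ∀ j ω, 0 < (Z j ω).1)
    {h : ℝ} (hh : 0 < h) (n : ℕ) :
    Measurable fun ω => diagramEnd k h (fun j => Z j ω) n := by
  -- By continuity, the supremum may be taken over the rationals.
  have heq : ∀ ω, diagramEnd k h (fun j => Z j ω) n = ⨆ r : ℚ,
      {ω | 0 ≤ (r : ℝ) ∧ 0 < densityEst k h (fun j => Z j ω) n r}.indicator
        (fun _ => (r : ℝ)) ω := by
    intro ω
    have hbdd := hK.bddAbove_densityEst_pos hh (fun j => hpos j ω) n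
    have hterm : ∀ r : ℚ, {ω | 0 ≤ (r : ℝ) ∧ 0 < densityEst k h (fun j => Z j ω) n r}.indicator
        (fun _ => (r : ℝ)) ω ≤ diagramEnd k h (fun j => Z j ω) n := by
      intro r
      refine Set.indicator_apply_le' (fun hr => le_csSup hbdd hr) fun _ => ?_
      exact Real.sSup_nonneg fun x hx => hx.1
    refine le_antisymm (Real.sSup_le (fun s hs => ?_) ?_) (ciSup_le hterm)
    · refine le_of_forall_pos_lt_add fun ε hε => ?_
      have hev := (hK.continuousOn_densityEst hh (fun j => hpos j ω) n s hs.1).eventually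
        (lt_mem_nhds hs.2)
      have hev' : ∀ᶠ x in 𝓝[>] s, 0 < densityEst k h (fun j => Z j ω) n x :=
        hev.filter_mono (nhdsWithin_mono s fun x hx => hs.1.trans (le_of_lt hx))
      obtain ⟨b, hb, hb'⟩ := (mem_nhdsGT_iff_exists_Ioo_subset).1 hev'
      obtain ⟨r, hr1, hr2⟩ := exists_rat_btwn (Set.mem_Ioi.1 hb)
      have hr : ω ∈ {ω | 0 ≤ (r : ℝ) ∧ 0 < densityEst k h (fun j => Z j ω) n r} :=
        ⟨hs.1.trans hr1.le, hb' ⟨hr1, hr2⟩⟩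
      have := le_ciSup (f := fun r : ℚ =>
        {ω | 0 ≤ (r : ℝ) ∧ 0 < densityEst k h (fun j => Z j ω) n r}.indicator
          (fun _ => (r : ℝ)) ω) ⟨_, Set.forall_mem_range.2 hterm⟩ r
      simp only [Set.indicator_of_mem hr] at this
      linarith
    · exact Real.iSup_nonneg fun r => Set.indicator_apply_nonneg fun h => h.1
  simp only [heq]
  refine Measurable.iSup fun r => measurable_const.indicator ?_
  exact (MeasurableSet.const _).inter
    (measurableSet_lt measurable_const (hK.measurable_densityEst hZ h n r))

lemma measurable_msleEst (hZ : ∀ j, Measurable (Z j)) (hpos : ∀ j ω, 0 < (Z j ω).1)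
    {h : ℝ} (hh : 0 < h) (n : ℕ) {s : ℝ} (hs : 0 ≤ s) :
    Measurable fun ω => msleEst k h (fun j => Z j ω) n s := by
  have hdist : ∀ s, 0 ≤ s → Measurable fun ω => distributionEst k h (fun j => Z j ω) n s :=
    fun s hs => by
      simp only [fun ω => hK.distributionEst_eq hh (fun j => hpos j ω) n hs]
      exact (hK.measurable_subdistributionEst hZ hpos hh n 0 hs).add
        (hK.measurable_subdistributionEst hZ hpos hh n 1 hs)
  have hτ0 : ∀ ω, 0 ≤ diagramEnd k h (fun j => Z j ω) n := fun ω =>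
    Real.sSup_nonneg fun x hx => hx.1
  refine measurable_derivWithin_lowerConvexHull (S := fun ω => cumSumDiagram k h (fun j => Z j ω) n)
    (fun ω => ?_) (fun ω => ⟨_, 0, ⟨le_rfl, hτ0 ω⟩, rfl⟩) (hdist s hs) fun y hy => ?_
  · exact isCompact_Icc.image_of_continuousOn
      (((hK.continuousOn_distributionEst hh (fun j => hpos j ω) n).prodMk
        (hK.continuousOn_subdistributionEst hh (fun j => hpos j ω) n 1)).mono
          Set.Icc_subset_Ici_self)
  · have hmax : Continuous fun s : ℝ => max 0 s := by fun_prop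
    have := measurable_lowerConvexHull
      (u := fun ω s => distributionEst k h (fun j => Z j ω) n (max 0 s))
      (v := fun ω s => subdistributionEst k h (fun j => Z j ω) n 1 (max 0 s))
      (τ := fun ω => diagramEnd k h (fun j => Z j ω) n)
      (fun s => hdist _ (le_max_left _ _))
      (fun s => hK.measurable_subdistributionEst hZ hpos hh n 1 (le_max_left _ _))
      (fun ω => (hK.continuousOn_distributionEst hh (fun j => hpos j ω) n).comp_continuous
        hmax fun s => Set.mem_Ici.2 (le_max_left _ _))
      (fun ω => (hK.continuousOn_subdistributionEst hh (fun j => hpos j ω) n 1).comp_continuous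
        hmax fun s => Set.mem_Ici.2 (le_max_left _ _))
      (hK.measurable_diagramEnd hZ hpos hh n) hτ0 hy
    convert this using 3 with ω
    refine Set.image_congr fun s hs => ?_
    rw [max_eq_right hs.1]

/-- Almost surely positive observation times may be modified on a null set to be positive
everywhere. -/
lemma aemeasurable_msleEst {P : Measure Ω} (hZ : ∀ j, Measurable (Z j))
    (hpos : ∀ᵐ ω ∂P, ∀ j, 0 < (Z j ω).1) {h : ℝ} (hh : 0 < h) (n : ℕ) {s : ℝ} (hs : 0 ≤ s) :
    AEMeasurable (fun ω => msleEst k h (fun j => Z j ω) n s) P := by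
  let Z' : ℕ → Ω → ℝ × Fin 2 := fun j ω => (if 0 < (Z j ω).1 then (Z j ω).1 else 1, (Z j ω).2)
  have hZ' : ∀ j, Measurable (Z' j) := fun j =>
    (Measurable.ite (measurableSet_lt measurable_const (hZ j).fst) (hZ j).fst
      measurable_const).prodMk (hZ j).snd
  have hpos' : ∀ j ω, 0 < (Z' j ω).1 := by
    intro j ω
    simp only [Z']
    split_ifs with h0
    · exact h0
    · exact one_pos
  refine ⟨_, hK.measurable_msleEst hZ' hpos' hh n hs, ?_⟩
  filter_upwards [hpos] with ω hω
  congr 1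
  funext j
  simp [Z', hω j]

end ConditionK

/-- Without observations the estimator does not depend on the data. This covers `n = 0`, where the
bandwidth is `c * 0 ^ (-1 / 5) = 0`. -/
lemma msleEst_zero (k : ℝ → ℝ) (h : ℝ) (z z' : ℕ → ℝ × Fin 2) (s : ℝ) :
    msleEst k h z 0 s = msleEst k h z' 0 s := by
  have h1 : subdensityEst k h z 0 = subdensityEst k h z' 0 := by
    funext i s
    simp [subdensityEst, empiricalIntegral]
  have h2 : densityEst k h z 0 = densityEst k h z' 0 := by
    funext s
    simp [densityEst, h1]
  simp only [msleEst, cumSumDiagram, diagramEnd, distributionEst, subdistributionEst, h1, h2]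

/-! ### Asymptotic normality of the naive estimator -/

/-- Convergence in distribution to a variable, restated as convergence to its law. -/
lemma tendstoInDistribution_id_of_map_eq {Ω Ω' : Type*} [MeasurableSpace Ω] [MeasurableSpace Ω']
    {P : Measure Ω} [IsProbabilityMeasure P] {P' : Measure Ω'} [IsProbabilityMeasure P']
    {U : ℕ → Ω → ℝ} {L : Ω' → ℝ} (hU : TendstoInDistribution U atTop L (fun _ => P) P')
    {ν : Measure ℝ} [IsProbabilityMeasure ν] (hν : P'.map L = ν) :
    TendstoInDistribution U atTop id (fun _ => P) ν := by
  refine ⟨hU.forall_aemeasurable, aemeasurable_id, ?_⟩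
  convert hU.tendsto using 2
  exact congrArg 𝓝 (Subtype.ext (Measure.map_id.trans hν.symm))

namespace IsSubdensitySample

variable {Ω : Type*} [MeasurableSpace Ω] {P : Measure Ω}
  {Z : ℕ → Ω → ℝ × Fin 2} {q : Fin 2 → ℝ → ℝ}

/-- The contribution of one observation to the linearised rescaled error
`n^{2/5} (ĝ_{n,1}(t) - p ĝ_n(t))`. -/
noncomputable def errorSummand (k : ℝ → ℝ) (c p t : ℝ) (n : ℕ) (z : ℝ × Fin 2) : ℝ :=
  c⁻¹ * (n : ℝ) ^ (-(2 / 5) : ℝ) * (k ((t - z.1) / bandwidth c n) * ((if z.2 = 1 then 1 else 0) - p))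

lemma measurable_errorSummand {k : ℝ → ℝ} (hK : ConditionK k) (c p t : ℝ) (n : ℕ) :
    Measurable (errorSummand k c p t n) := by
  unfold errorSummand
  have hk := hK.continuous.measurable
  have hm : Measurable fun z : ℝ × Fin 2 => (if z.2 = 1 then (1 : ℝ) else 0) :=
    Measurable.ite (measurable_snd (measurableSet_singleton 1)) measurable_const measurable_const
  exact ((hk.comp (by fun_prop)).mul (hm.sub_const p)).const_mul _

lemma abs_errorSummand_le {k : ℝ → ℝ} {C : ℝ} (hC : 0 ≤ C) (hkC : ∀ u, |k u| ≤ C) {c : ℝ}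
    (hc : 0 < c) (p t : ℝ) (n : ℕ) (z : ℝ × Fin 2) :
    |errorSummand k c p t n z| ≤ c⁻¹ * (n : ℝ) ^ (-(2 / 5) : ℝ) * (C * (1 + |p|)) := by
  have h0 : 0 ≤ c⁻¹ * (n : ℝ) ^ (-(2 / 5) : ℝ) := by positivity
  rw [errorSummand, abs_mul, abs_of_nonneg h0, abs_mul]
  refine mul_le_mul_of_nonneg_left (mul_le_mul (hkC _) ?_ (abs_nonneg _) hC) (by positivity)
  refine (abs_sub _ _).trans ?_
  split_ifs <;> simp

lemma sum_errorSummand {k : ℝ → ℝ} {c p t : ℝ} {n : ℕ} (hn : 0 < n)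
    (hh : bandwidth c n < t) (z : ℕ → ℝ × Fin 2) :
    ∑ j ∈ Finset.range n, errorSummand k c p t n (z j) = (n : ℝ) ^ (2 / 5 : ℝ) *
      (subdensityEst k (bandwidth c n) z n 1 t - p * densityEst k (bandwidth c n) z n t) := by
  have hn' : (0 : ℝ) < n := Nat.cast_pos.2 hn
  rw [densityEst, subdensityEst_eq hh, subdensityEst_eq hh, empiricalIntegral, empiricalIntegral,
    ← mul_add, ← Finset.sum_add_distrib, mul_left_comm p, ← mul_sub, Finset.mul_sum,
    ← Finset.sum_sub_distrib, ← mul_assoc, Finset.mul_sum]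
  refine Finset.sum_congr rfl fun j _ => ?_
  have h1 := inv_bandwidth_pow c n 1
  rw [pow_one, pow_one] at h1
  have h2 : (n : ℝ) ^ (2 / 5 : ℝ) * (1 / (n : ℝ)) * (n : ℝ) ^ ((1 : ℕ) / 5 : ℝ) =
      (n : ℝ) ^ (-(2 / 5) : ℝ) := by
    rw [one_div, ← Real.rpow_neg_one, ← Real.rpow_add hn', ← Real.rpow_add hn']
    norm_num
  rw [errorSummand, ← h2, one_div (bandwidth c n), h1]
  obtain h | h : (z j).2 = 0 ∨ (z j).2 = 1 := by
    generalize (z j).2 = i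
    fin_cases i <;> simp
  · simp only [h, zero_ne_one, if_false, if_true]
    ring
  · simp only [h, one_ne_zero, if_false, if_true]
    ring

/-- The integral of a function of a marked observation as an integral with respect to the kernel
variable. -/
lemma sum_integral_kernel (hZ : IsSubdensitySample P Z q) {φ : ℝ → ℝ} (hφ : Measurable φ) {C : ℝ}
    (hφC : ∀ u, |φ u| ≤ C) (α : Fin 2 → ℝ) {h : ℝ} (hh : 0 < h) (t : ℝ) :
    ∑ i, ∫ u, (φ ((t - u) / h) * α i) * q i u =
      h * ∫ v, φ v * (α 0 * q 0 (t - h * v) + α 1 * q 1 (t - h * v)) := by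
  have hi : ∀ i, Integrable fun u => (φ ((t - u) / h) * α i) * q i u := fun i =>
    (hZ.integrable i).bdd_mul (c := C * |α i|)
      (((hφ.comp (by fun_prop : Measurable fun u : ℝ => (t - u) / h)).mul_const
        (α i)).aestronglyMeasurable)
      (ae_of_all _ fun u => by
        rw [Real.norm_eq_abs, abs_mul]
        exact mul_le_mul_of_nonneg_right (hφC _) (abs_nonneg _))
  rw [Fin.sum_univ_two, ← integral_add (hi 0) (hi 1),
    ← integral_kernel_comp φ (fun u => α 0 * q 0 u + α 1 * q 1 u) hh t]
  congr 1 with u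
  ring

variable [IsProbabilityMeasure P]

/-- Central limit theorem for the numerator `ĝ_{n,1}(t) - p ĝ_n(t)` of the error of the naive
estimator. -/
lemma tendstoInDistribution_sum_errorSummand (hZ : IsSubdensitySample P Z q) {k : ℝ → ℝ}
    (hK : ConditionK k) {c : ℝ} (hc : 0 < c) {t p a b : ℝ} (hq : ∀ i, ContinuousAt (q i) t)
    (hexp : (fun x => ((1 - p) * q 1 (t + x) - p * q 0 (t + x)) - (a * x + b * x ^ 2))
      =o[𝓝 0] fun x => x ^ 2) :
    TendstoInDistribution
      (fun n ω => ∑ j ∈ Finset.range n, errorSummand k c p t n (Z j ω)) atTop id (fun _ => P)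
      (gaussianReal (c ^ 2 * (b * secondMoment k))
        (c⁻¹ * ((∫ u, k u ^ 2) * ((1 - p) ^ 2 * q 1 t + p ^ 2 * q 0 t))).toNNReal) := by
  obtain ⟨C, hC, hkC⟩ := hK.exists_bound
  have hbw : ∀ᶠ n : ℕ in atTop, 0 < bandwidth c n := by
    filter_upwards [eventually_gt_atTop 0] with n hn using bandwidth_pos hc hn
  have hψm : Measurable fun u => (1 - p) * q 1 u - p * q 0 u :=
    ((hZ.measurable_subdensity 1).const_mul _).sub ((hZ.measurable_subdensity 0).const_mul _)
  have hχm : Measurable fun u => (1 - p) ^ 2 * q 1 u + p ^ 2 * q 0 u :=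
    ((hZ.measurable_subdensity 1).const_mul _).add ((hZ.measurable_subdensity 0).const_mul _)
  refine hZ.tendstoInDistribution_sum (fun n => measurable_errorSummand hK c p t n)
    (fun n z => abs_errorSummand_le hC.le (fun u => (hkC u).1) hc p t n z) ?_ ?_ ?_ ?_
  · have := ((tendsto_rpow_neg_atTop (y := (2 / 5 : ℝ)) (by norm_num)).comp
      tendsto_natCast_atTop_atTop).const_mul c⁻¹ |>.mul_const (C * (1 + |p|))
    simpa using this
  · have h1 := hZ.nonneg 0 t
    have h2 := hZ.nonneg 1 t
    have h3 : 0 ≤ ∫ u, k u ^ 2 := integral_nonneg fun u => sq_nonneg _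
    positivity
  · refine ((hK.tendsto_bias hψm hexp (tendsto_bandwidth c) hbw).const_mul (c ^ 2)).congr' ?_
    filter_upwards [eventually_gt_atTop 0] with n hn
    have hn' : (0 : ℝ) < n := Nat.cast_pos.2 hn
    have h1 := hZ.sum_integral_kernel hK.continuous.measurable (fun u => (hkC u).1)
      (fun i => (if i = 1 then 1 else 0) - p) (bandwidth_pos hc hn) t
    simp only [errorSummand, mul_assoc (c⁻¹ * _), integral_const_mul, ← Finset.mul_sum]
    rw [h1, inv_bandwidth_pow, bandwidth]
    have h2 : (n : ℝ) * ((n : ℝ) ^ (-(2 / 5) : ℝ) * (n : ℝ) ^ (-(1 / 5) : ℝ)) =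
        (n : ℝ) ^ ((2 : ℕ) / 5 : ℝ) := by
      rw [← Real.rpow_add hn', ← Real.rpow_one_add' hn'.le (by norm_num)]
      norm_num
    rw [← h2]
    simp only [zero_ne_one, if_false, if_true, zero_sub, neg_mul, neg_add_eq_sub]
    field_simp
  · have hk2 : Continuous fun u => k u ^ 2 := hK.continuous.pow 2
    have hlim := tendsto_integral_kernel hk2 (fun u hu => by rw [hK.eq_zero hu, zero_pow two_ne_zero])
      hχm (((hq 1).const_mul _).add ((hq 0).const_mul _)) (tendsto_bandwidth c)
    refine (hlim.const_mul c⁻¹).congr' ?_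
    filter_upwards [eventually_gt_atTop 0] with n hn
    have hn' : (0 : ℝ) < n := Nat.cast_pos.2 hn
    have h1 := hZ.sum_integral_kernel hk2.measurable (C := C ^ 2) (fun u => by
        rw [abs_pow]
        exact pow_le_pow_left₀ (abs_nonneg _) (hkC u).1 2)
      (fun i => ((if i = 1 then 1 else 0) - p) ^ 2) (bandwidth_pos hc hn) t
    have h2 : ∀ (i : Fin 2) (u : ℝ), errorSummand k c p t n (u, i) ^ 2 * q i u =
        (c⁻¹ * (n : ℝ) ^ (-(2 / 5) : ℝ)) ^ 2 *
          (k ((t - u) / bandwidth c n) ^ 2 * ((if i = 1 then 1 else 0) - p) ^ 2 * q i u) := by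
      intro i u
      rw [errorSummand]
      ring
    simp only [h2, integral_const_mul, ← Finset.mul_sum]
    rw [h1]
    have h3 : (n : ℝ) * (((n : ℝ) ^ (-(2 / 5) : ℝ)) ^ 2 * (n : ℝ) ^ (-(1 / 5) : ℝ)) = 1 := by
      rw [sq, ← Real.rpow_add hn', ← Real.rpow_add hn',
        show (-(2 / 5) + -(2 / 5) + -(1 / 5) : ℝ) = -1 by norm_num, Real.rpow_neg_one,
        mul_inv_cancel₀ hn'.ne']
    have h4 : (n : ℝ) * ((c⁻¹ * (n : ℝ) ^ (-(2 / 5) : ℝ)) ^ 2 * bandwidth c n) = c⁻¹ := by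
      rw [bandwidth]
      calc _ = c⁻¹ * (c⁻¹ * c) * ((n : ℝ) * (((n : ℝ) ^ (-(2 / 5) : ℝ)) ^ 2 *
            (n : ℝ) ^ (-(1 / 5) : ℝ))) := by ring
        _ = c⁻¹ := by rw [h3, inv_mul_cancel₀ hc.ne', mul_one, mul_one]
    rw [← mul_assoc _ (bandwidth c n), ← mul_assoc, h4]
    simp only [zero_ne_one, if_false, if_true, zero_sub, neg_sq, add_comm (p ^ 2 * _)]

/-- Asymptotic normality of the naive estimator: its error is `(ĝ_{n,1}(t) - p ĝ_n(t)) / ĝ_n(t)`,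
and the denominator is consistent. -/
lemma tendstoInDistribution_naiveEst (hZ : IsSubdensitySample P Z q) {k : ℝ → ℝ}
    (hK : ConditionK k) {c : ℝ} (hc : 0 < c) {t p a b : ℝ} (ht : 0 < t)
    (hq : ∀ i, ContinuousAt (q i) t) (hpos : 0 < q 0 t + q 1 t)
    (hexp : (fun x => ((1 - p) * q 1 (t + x) - p * q 0 (t + x)) - (a * x + b * x ^ 2))
      =o[𝓝 0] fun x => x ^ 2) :
    TendstoInDistribution (fun (n : ℕ) ω => (n : ℝ) ^ (2 / 5 : ℝ) *
        (naiveEst k (bandwidth c n) (fun j => Z j ω) n t - p)) atTop id (fun _ => P)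
      (gaussianReal (c ^ 2 * (b * secondMoment k) / (q 0 t + q 1 t))
        (c⁻¹ * ((∫ u, k u ^ 2) * ((1 - p) ^ 2 * q 1 t + p ^ 2 * q 0 t)) /
          (q 0 t + q 1 t) ^ 2).toNNReal) := by
  have hinv : TendstoInMeasure P
      (fun n ω => (densityEst k (bandwidth c n) (fun j => Z j ω) n t)⁻¹) atTop
      fun _ => (q 0 t + q 1 t)⁻¹ := by
    refine tendstoInMeasure_of_withHighProbability fun ε hε => ?_
    obtain ⟨δ, hδ, hδε⟩ := Metric.continuousAt_iff.1 (continuousAt_inv₀ hpos.ne') ε hε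
    exact (hZ.densityEst_consistent hK hc ht hq hδ).mono
      (Eventually.of_forall fun n ω hω => hδε hω)
  have hslutsky := (hZ.tendstoInDistribution_sum_errorSummand hK hc hq
    hexp).continuous_comp_prodMk_of_tendstoInMeasure_const (continuous_mul (M := ℝ)) hinv
      fun n => (hK.measurable_densityEst hZ.measurable _ n t).inv.aemeasurable
  have hmap : (gaussianReal (c ^ 2 * (b * secondMoment k))
      (c⁻¹ * ((∫ u, k u ^ 2) * ((1 - p) ^ 2 * q 1 t + p ^ 2 * q 0 t))).toNNReal).map
        (fun x => id x * (q 0 t + q 1 t)⁻¹) =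
      gaussianReal (c ^ 2 * (b * secondMoment k) / (q 0 t + q 1 t))
        (c⁻¹ * ((∫ u, k u ^ 2) * ((1 - p) ^ 2 * q 1 t + p ^ 2 * q 0 t)) /
          (q 0 t + q 1 t) ^ 2).toNNReal := by
    simp only [id, ← div_eq_mul_inv]
    rw [gaussianReal_map_div_const, Real.toNNReal_div' (sq_nonneg _)]
    congr 2
    ext
    simp [sq_nonneg]
  refine tendstoInDistribution_of_withHighProbability_eq
    (tendstoInDistribution_id_of_map_eq hslutsky hmap)
    (fun n => ((hK.measurable_naiveEst hZ.measurable _ n t).sub_const p).const_mul _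
      |>.aemeasurable) ?_
  refine (hZ.densityEst_pos hK hc ht hq hpos).mono ?_
  filter_upwards [eventually_gt_atTop 0, (tendsto_bandwidth c).eventually (gt_mem_nhds ht)]
    with n hn hh ω hω
  rw [sum_errorSummand hn hh, naiveEst]
  field_simp

end IsSubdensitySample

/-! ### Consequences of the conditions on the model -/

lemma IsDensity.cdf_eq_integral {μ : Measure ℝ} [IsProbabilityMeasure μ] {f : ℝ → ℝ}
    (h : IsDensity μ f) (x : ℝ) : cdf μ x = ∫ u in Set.Iic x, f u := by
  rw [cdf_eq_real, measureReal_def, h.eq_withDensity, withDensity_apply _ measurableSet_Iic,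
    integral_eq_lintegral_of_nonneg_ae (ae_of_all _ h.nonneg) h.measurable.aestronglyMeasurable]

lemma IsDensity.hasDerivAt_cdf {μ : Measure ℝ} [IsProbabilityMeasure μ] {f : ℝ → ℝ}
    (h : IsDensity μ f) {x : ℝ} (hf : ContinuousAt f x) : HasDerivAt (cdf μ) (f x) x := by
  have h1 : HasDerivAt (fun y => cdf μ x + ∫ u in x..y, f u) (f x) x :=
    (intervalIntegral.integral_hasDerivAt_right (by simp)
      (h.measurable.stronglyMeasurable.stronglyMeasurableAtFilter) hf).const_add _
  refine h1.congr_of_eventuallyEq (Eventually.of_forall fun y => ?_)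
  simp only
  rw [← intervalIntegral.integral_Iic_sub_Iic h.integrable.integrableOn h.integrable.integrableOn,
    h.cdf_eq_integral, h.cdf_eq_integral]
  ring

lemma IsDensity.setIntegral_mul_eq_zero {μ : Measure ℝ} {f : ℝ → ℝ} (h : IsDensity μ f)
    {B : Set ℝ} (hB : MeasurableSet B) (hμ : μ B = 0) (a : ℝ → ℝ) : ∫ u in B, a u * f u = 0 := by
  rw [h.eq_withDensity, withDensity_apply _ hB,
    lintegral_eq_zero_iff h.measurable.ennreal_ofReal] at hμ
  refine integral_eq_zero_of_ae ?_
  filter_upwards [hμ] with u hu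
  have : f u = 0 := le_antisymm (ENNReal.ofReal_eq_zero.1 hu) (h.nonneg u)
  simp [this]

namespace ConditionF

variable {μX : Measure ℝ} [IsProbabilityMeasure μX] {f₀ : ℝ → ℝ} {M₀ : ℝ}

lemma cdf_eq_one (hF : ConditionF μX f₀ M₀) {x : ℝ} (hx : M₀ ≤ x) : cdf μX x = 1 := by
  have h0 : μX (Set.Iic x)ᶜ = 0 := by
    refine measure_mono_null (fun y hy => ?_) μX.measure_compl_support
    rw [hF.support_eq]
    exact fun hy' => hy (hy'.2.trans hx)
  rw [cdf_eq_real, ← probReal_univ (μ := μX), ← Set.union_compl_self (Set.Iic x),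
    measureReal_union disjoint_compl_right measurableSet_Iic.compl, measureReal_def μX (Set.Iic x)ᶜ,
    h0]
  simp

/-- The nondegeneracy condition forces `t` into the interior of the support: the distribution
function is constant beyond `M₀`, and its one-sided slopes at `M₀` differ. -/
lemma lt_of_nondegenerate (hF : ConditionF μX f₀ M₀) {g : ℝ → ℝ} {t : ℝ} (ht : 0 < t)
    (hf : ∀ᶠ x in 𝓝 t, ContinuousAt f₀ x)
    (hne : g t * deriv f₀ t + 2 * f₀ t * deriv g t ≠ 0) : t < M₀ := by
  by_contra! hM
  have hzero : ∀ x, M₀ ≤ x → ContinuousAt f₀ x → f₀ x = 0 := by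
    intro x hx hc
    have h1 := (hF.density.hasDerivAt_cdf hc).hasDerivWithinAt (s := Set.Ici x)
    have h2 : HasDerivWithinAt (cdf μX) 0 (Set.Ici x) x :=
      (hasDerivWithinAt_const x _ (1 : ℝ)).congr (fun y hy => hF.cdf_eq_one (hx.trans hy))
        (hF.cdf_eq_one hx)
    exact (uniqueDiffWithinAt_Ici x).eq_deriv _ h1 h2
  have hft := hzero t hM hf.self_of_nhds
  rcases hM.eq_or_lt with rfl | hlt
  · obtain ⟨ε, hε, hεf⟩ := hF.away_from_zero
    linarith [hεf M₀ ⟨ht.le, le_rfl⟩]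
  · have hev : f₀ =ᶠ[𝓝 t] fun _ => 0 := by
      filter_upwards [hf, Ioi_mem_nhds hlt] with x hx hx'
      exact hzero x (le_of_lt hx') hx
    refine hne ?_
    rw [hft, hev.deriv_eq]
    simp

end ConditionF

lemma ConditionG.measure_Iic_zero {μT : Measure ℝ} {g : ℝ → ℝ} {M₀ : ℝ}
    (hG : ConditionG μT g M₀) : μT (Set.Iic 0) = 0 := by
  rw [← Set.Iio_insert, Set.insert_eq]
  refine measure_union_null ?_ ?_
  · have : μT ≪ volume := by
      rw [hG.density.eq_withDensity]
      exact withDensity_absolutelyContinuous _ _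
    exact this Real.volume_singleton
  · refine measure_mono_null (fun y hy => ?_) μT.measure_compl_support
    rw [hG.support_eq]
    exact fun hy' => not_le_of_gt (Set.mem_Iio.1 hy) (Set.mem_Ici.1 hy')

/-- Taylor's formula of order two with Peano remainder. -/
lemma isLittleO_taylor_two {ψ ψ' : ℝ → ℝ} {t d : ℝ} (h1 : ∀ᶠ x in 𝓝 t, HasDerivAt ψ (ψ' x) x)
    (h2 : HasDerivAt ψ' d t) (h0 : ψ t = 0) :
    (fun x => ψ (t + x) - (ψ' t * x + d / 2 * x ^ 2)) =o[𝓝 0] fun x => x ^ 2 := by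
  obtain ⟨δ, hδ, hδ1⟩ := Metric.eventually_nhds_iff_ball.1 h1
  have hr : ∀ x ∈ Metric.ball t δ, HasDerivWithinAt
      (fun x => ψ x - (ψ' t * (x - t) + d / 2 * (x - t) ^ 2)) (ψ' x - ψ' t - (x - t) * d)
        (Metric.ball t δ) x := by
    intro x hx
    have e1 : HasDerivAt (fun x => x - t) 1 x := (hasDerivAt_id x).sub_const t
    refine (((hδ1 x hx).sub ((e1.const_mul (ψ' t)).add
      ((e1.pow 2).const_mul (d / 2)))).congr_deriv ?_).hasDerivWithinAt
    simp
    ring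
  have hr' : (fun x => ψ' x - ψ' t - (x - t) * d) =o[𝓝[Metric.ball t δ] t]
      fun x => (x - t) ^ 1 := by
    have := hasDerivAt_iff_isLittleO.1 h2
    simpa using this.mono nhdsWithin_le_nhds
  have h := (convex_ball t δ).isLittleO_pow_succ_real (Metric.mem_ball_self hδ) hr hr'
  rw [Metric.isOpen_ball.nhdsWithin_eq (Metric.mem_ball_self hδ)] at h
  have hshift : Tendsto (fun x => t + x) (𝓝 0) (𝓝 t) := by
    have : ContinuousAt (fun x => t + x) 0 := by fun_prop
    simpa [ContinuousAt] using this
  simpa [Function.comp_def, h0] using h.comp_tendsto hshift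

/-! ### The optimal bandwidth -/

lemma integral_sq_gaussianReal (m : ℝ) {v : ℝ} (hv : 0 ≤ v) :
    ∫ x, x ^ 2 ∂gaussianReal m v.toNNReal = m ^ 2 + v := by
  have h1 := variance_eq_sub (memLp_id_gaussianReal (μ := m) (v := v.toNNReal) 2)
  rw [variance_id_gaussianReal, Real.coe_toNNReal v hv] at h1
  simp only [id, Pi.pow_apply, integral_id_gaussianReal] at h1
  linarith

/-- The minimiser of `a c⁴ + b / c` over `c > 0`. -/
lemma quartic_add_inv_lt {a s c : ℝ} (ha : 0 < a) (hs : 0 < s) (hc : 0 < c) (hcs : c ≠ s) :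
    a * s ^ 4 + s⁻¹ * (4 * a * s ^ 5) < a * c ^ 4 + c⁻¹ * (4 * a * s ^ 5) := by
  have h1 : a * c ^ 4 + c⁻¹ * (4 * a * s ^ 5) - (a * s ^ 4 + s⁻¹ * (4 * a * s ^ 5)) =
      a / c * ((c - s) ^ 2 * (c ^ 3 + 2 * c ^ 2 * s + 3 * c * s ^ 2 + 4 * s ^ 3)) := by
    field_simp
    ring
  have h2 : 0 < (c - s) ^ 2 := by
    have := sub_ne_zero.2 hcs
    positivity
  have h3 : 0 < a / c * ((c - s) ^ 2 * (c ^ 3 + 2 * c ^ 2 * s + 3 * c * s ^ 2 + 4 * s ^ 3)) := by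
    positivity
  linarith

lemma asympMSE_eq {F₀ f₀ g k : ℝ → ℝ} {t c : ℝ} (hc : 0 < c) (hv : 0 ≤ varFactor F₀ g k t) :
    asympMSE F₀ f₀ g k t c =
      1 / 4 * c ^ 4 * secondMoment k ^ 2 * biasFactor f₀ g t ^ 2 + c⁻¹ * varFactor F₀ g k t := by
  rw [asympMSE, limitLaw, integral_sq_gaussianReal _ (by unfold asympVar; positivity), asympMean,
    asympVar]
  ring

lemma optimalConst_pos {F₀ f₀ g k : ℝ → ℝ} {t : ℝ} (hv : 0 < varFactor F₀ g k t)
    (hm : secondMoment k ≠ 0) (hb : biasFactor f₀ g t ≠ 0) : 0 < optimalConst F₀ f₀ g k t := by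
  unfold optimalConst
  positivity

lemma asympMSE_optimalConst_lt {F₀ f₀ g k : ℝ → ℝ} {t c : ℝ} (hv : 0 < varFactor F₀ g k t)
    (hm : secondMoment k ≠ 0) (hb : biasFactor f₀ g t ≠ 0) (hc : 0 < c)
    (hcs : c ≠ optimalConst F₀ f₀ g k t) :
    asympMSE F₀ f₀ g k t (optimalConst F₀ f₀ g k t) < asympMSE F₀ f₀ g k t c := by
  have hs := optimalConst_pos hv hm hb
  have hB : 0 < secondMoment k ^ 2 * biasFactor f₀ g t ^ 2 := by positivity
  have h5 : optimalConst F₀ f₀ g k t ^ 5 * (secondMoment k ^ 2 * biasFactor f₀ g t ^ 2) =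
      varFactor F₀ g k t := by
    rw [optimalConst, mul_pow, ← Real.rpow_natCast, ← Real.rpow_natCast, ← Real.rpow_mul hv.le,
      ← Real.rpow_mul hB.le]
    norm_num
    rw [Real.rpow_neg_one]
    field_simp
  have h := quartic_add_inv_lt (a := 1 / 4 * (secondMoment k ^ 2 * biasFactor f₀ g t ^ 2))
    (by positivity) hs hc hcs
  rw [asympMSE_eq hs hv.le, asympMSE_eq hc hv.le]
  have h4 : 4 * (1 / 4 * (secondMoment k ^ 2 * biasFactor f₀ g t ^ 2)) *
      optimalConst F₀ f₀ g k t ^ 5 = varFactor F₀ g k t := by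
    rw [← h5]
    ring
  rw [h4] at h
  linarith

lemma ConditionK.integral_sq_pos {k : ℝ → ℝ} (hK : ConditionK k) : 0 < ∫ u, k u ^ 2 := by
  have hc : Continuous fun u => k u ^ 2 := hK.continuous.pow 2
  have hcs : HasCompactSupport fun u => k u ^ 2 :=
    hK.hasCompactSupport.comp_left (g := fun x : ℝ => x ^ 2) (by simp)
  obtain ⟨u, -, hu⟩ := hK.exists_pos_mem (β := 1) (by norm_num)
  exact hc.integral_pos_of_hasCompactSupport_nonneg_nonzero hcs (fun u => sq_nonneg _)
    (pow_pos hu 2).ne'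

theorem theorem3p5 {Ω : Type*} [MeasurableSpace Ω] (P : Measure Ω) [IsProbabilityMeasure P]
    (X T : ℕ → Ω → ℝ) (μX μT : Measure ℝ) (hModel : IsCurrentStatusModel P X T μX μT)
    (f₀ g : ℝ → ℝ) (M₀ : ℝ) (hF : ConditionF μX f₀ M₀) (hG : ConditionG μT g M₀)
    (k : ℝ → ℝ) (hK : ConditionK k)
    (t : ℝ) (ht : 0 < t)
    (hf₀t : HasContinuousSecondDerivAt f₀ t) (hgt : HasContinuousSecondDerivAt g t)
    (hne : g t * deriv f₀ t + 2 * f₀ t * deriv g t ≠ 0) :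
    (∀ c : ℝ, 0 < c →
      TendstoInDistribution
        (fun (n : ℕ) (ω : Ω) => (n : ℝ) ^ (2 / 5 : ℝ) *
          (msleEst k (bandwidth c n) (fun j => observation (X j ω) (T j ω)) n t - cdf μX t))
        atTop id (fun _ => P) (limitLaw (cdf μX) f₀ g k t c) ∧
      TendstoInDistribution
        (fun (n : ℕ) (ω : Ω) => (n : ℝ) ^ (2 / 5 : ℝ) *
          (naiveEst k (bandwidth c n) (fun j => observation (X j ω) (T j ω)) n t - cdf μX t))
        atTop id (fun _ => P) (limitLaw (cdf μX) f₀ g k t c)) ∧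
    (∀ c : ℝ, 0 < c →
      asympMSE (cdf μX) f₀ g k t c =
        1 / 4 * c ^ 4 * secondMoment k ^ 2 *
            (deriv f₀ t + 2 * (f₀ t * deriv g t / g t)) ^ 2 +
          c⁻¹ * (cdf μX t * (1 - cdf μX t) / g t * ∫ u, k u ^ 2)) ∧
    0 < optimalConst (cdf μX) f₀ g k t ∧
    ∀ c : ℝ, 0 < c → c ≠ optimalConst (cdf μX) f₀ g k t →
      asympMSE (cdf μX) f₀ g k t (optimalConst (cdf μX) f₀ g k t) <
        asympMSE (cdf μX) f₀ g k t c := by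
  have hμX : IsProbabilityMeasure μX :=
    hModel.law_X 0 ▸ Measure.isProbabilityMeasure_map (hModel.measurable_X 0).aemeasurable
  have hZ := hModel.isSubdensitySample hG.density
  have htM : t < M₀ := hF.lt_of_nondegenerate ht (hf₀t.1.mono fun x hx => hx.1.continuousAt) hne
  have hM0 : 0 < M₀ := ht.trans htM
  have hmem : ∀ u ∈ Set.Ioo 0 M₀, u ∈ Set.Icc 0 M₀ := fun u hu => ⟨hu.1.le, hu.2.le⟩
  have hmono := hF.strictMonoOn_cdf
  set p := cdf μX t with hp
  have hp0 : 0 < p := (cdf_nonneg μX 0).trans_lt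
    (hmono ⟨le_rfl, hM0.le⟩ (hmem t ⟨ht, htM⟩) ht)
  have hp1 : p < 1 := (hmono (hmem t ⟨ht, htM⟩) ⟨hM0.le, le_rfl⟩ htM).trans_le (cdf_le_one μX M₀)
  have hg0 : ∀ u ∈ Set.Icc 0 M₀, 0 < g u := by
    obtain ⟨ε, hε, hεg⟩ := hG.away_from_zero
    exact fun u hu => hε.trans_le (hεg u hu)
  have hgt0 : 0 < g t := hg0 t (hmem t ⟨ht, htM⟩)
  have hft0 : 0 < f₀ t := by
    obtain ⟨ε, hε, hεf⟩ := hF.away_from_zero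
    exact hε.trans_le (hεf t (hmem t ⟨ht, htM⟩))
  -- The subdensities and their derivatives near `t`.
  set q := subdensity (cdf μX) g with hq
  have hq1 : ∀ u, q 1 u = cdf μX u * g u := fun u => by simp [hq, subdensity]
  have hq0 : ∀ u, q 0 u = (1 - cdf μX u) * g u := fun u => by simp [hq, subdensity]
  have hqsum : q 0 t + q 1 t = g t := by
    rw [hq0, hq1]
    ring
  have hdiff : ∀ u, (1 - p) * q 1 u - p * q 0 u = (cdf μX u - p) * g u := fun u => by
    rw [hq0, hq1]
    ring
  let q' : Fin 2 → ℝ → ℝ := fun i u => if i = 1 then f₀ u * g u + cdf μX u * deriv g u else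
    -f₀ u * g u + (1 - cdf μX u) * deriv g u
  have hcdf : ∀ᶠ x in 𝓝 t, HasDerivAt (cdf μX) (f₀ x) x := by
    filter_upwards [hf₀t.1] with x hx
    exact hF.density.hasDerivAt_cdf hx.1.continuousAt
  have hderiv : ∀ᶠ x in 𝓝 t, ∀ i, HasDerivAt (q i) (q' i x) x ∧ ContinuousAt (q' i) x := by
    filter_upwards [hf₀t.1, hgt.1, hcdf] with x hfx hgx hFx i
    have hgd := hgx.1.hasDerivAt
    obtain rfl | rfl : i = 0 ∨ i = 1 := by fin_cases i <;> simp
    · refine ⟨?_, ?_⟩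
      · exact (((hFx.const_sub 1).mul hgd).congr_of_eventuallyEq
          (Eventually.of_forall hq0)).congr_deriv (by simp [q'])
      · have := ((hfx.1.continuousAt.neg.mul hgx.1.continuousAt).add
          ((hFx.continuousAt.const_sub 1).mul hgx.2.continuousAt))
        simpa [q', Pi.mul_def, Pi.add_def, Pi.neg_def] using this
    · refine ⟨?_, ?_⟩
      · exact ((hFx.mul hgd).congr_of_eventuallyEq
          (Eventually.of_forall hq1)).congr_deriv (by simp [q'])
      · have := ((hfx.1.continuousAt.mul hgx.1.continuousAt).add
          (hFx.continuousAt.mul hgx.2.continuousAt))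
        simpa [q', Pi.mul_def, Pi.add_def] using this
  obtain ⟨δ, hδ, hδd⟩ := Metric.eventually_nhds_iff.1 hderiv
  have hwin : ∀ x ∈ Set.Icc (t - δ / 2) (t + δ / 2),
      ∀ i, HasDerivAt (q i) (q' i x) x ∧ ContinuousAt (q' i) x := by
    intro x hx
    refine hδd ?_
    rw [Real.dist_eq, abs_lt]
    constructor <;> linarith [hx.1, hx.2]
  have hqc : ∀ i, ContinuousAt (q i) t := fun i => (hderiv.self_of_nhds i).1.continuousAt
  -- Second-order expansion of the numerator of the bias.
  have hexp : (fun x => ((1 - p) * q 1 (t + x) - p * q 0 (t + x)) - (f₀ t * g t * x +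
      (deriv f₀ t * g t + 2 * (f₀ t * deriv g t)) / 2 * x ^ 2)) =o[𝓝 0] fun x => x ^ 2 := by
    have h1 : ∀ᶠ x in 𝓝 t, HasDerivAt (fun u => (cdf μX u - p) * g u)
        (f₀ x * g x + (cdf μX x - p) * deriv g x) x := by
      filter_upwards [hcdf, hgt.1] with x hFx hgx
      exact (hFx.sub_const p).mul hgx.1.hasDerivAt
    have hgd := hgt.1.self_of_nhds
    have h2 : HasDerivAt (fun x => f₀ x * g x + (cdf μX x - p) * deriv g x)
        (deriv f₀ t * g t + 2 * (f₀ t * deriv g t)) t := by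
      refine ((hf₀t.1.self_of_nhds.1.hasDerivAt.mul hgd.1.hasDerivAt).add
        ((hcdf.self_of_nhds.sub_const p).mul hgd.2.hasDerivAt)).congr_deriv ?_
      rw [← hp]
      ring
    simpa [hdiff, ← hp] using isLittleO_taylor_two h1 h2 (by simp [← hp])
  have hbias : biasFactor f₀ g t = (deriv f₀ t * g t + 2 * (f₀ t * deriv g t)) / g t := by
    rw [biasFactor]
    field_simp
  have hbias0 : biasFactor f₀ g t ≠ 0 := by
    rw [hbias]
    refine div_ne_zero (fun h => hne ?_) hgt0.ne'
    linarith
  have hvar0 : 0 < varFactor (cdf μX) g k t :=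
    mul_pos (div_pos (mul_pos hp0 (sub_pos.2 hp1)) hgt0) hK.integral_sq_pos
  have hm2 := hK.secondMoment_pos.ne'
  have h0 : ∀ i, ∫ u in Set.Iic 0, q i u = 0 := fun i =>
    hG.density.setIntegral_mul_eq_zero measurableSet_Iic hG.measure_Iic_zero _
  refine ⟨fun c hc => ?_, fun c hc => asympMSE_eq hc hvar0.le, optimalConst_pos hvar0 hm2 hbias0,
    fun c hc hcs => asympMSE_optimalConst_lt hvar0 hm2 hbias0 hc hcs⟩
  have hnaive := hZ.tendstoInDistribution_naiveEst hK hc ht hqc (by rw [hqsum]; exact hgt0) hexp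
  have hlaw : gaussianReal (c ^ 2 * ((deriv f₀ t * g t + 2 * (f₀ t * deriv g t)) / 2 *
      secondMoment k) / (q 0 t + q 1 t)) (c⁻¹ * ((∫ u, k u ^ 2) * ((1 - p) ^ 2 * q 1 t +
        p ^ 2 * q 0 t)) / (q 0 t + q 1 t) ^ 2).toNNReal = limitLaw (cdf μX) f₀ g k t c := by
    rw [limitLaw, asympMean, asympVar, hbias, varFactor, hqsum, hq0, hq1, ← hp]
    congr 2 <;> field_simp
    ring
  replace hnaive := tendstoInDistribution_id_of_map_eq hnaive (Measure.map_id.trans hlaw)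
  refine ⟨?_, hnaive⟩
  refine tendstoInDistribution_of_withHighProbability_eq hnaive (fun n => ?_) ?_
  · refine AEMeasurable.const_mul (AEMeasurable.sub_const ?_ p) _
    rcases n.eq_zero_or_pos with rfl | hn
    · simp only [fun ω => msleEst_zero k (bandwidth c 0) (fun j => observation (X j ω) (T j ω))
        (fun _ => (0, 0)) t]
      exact aemeasurable_const
    · exact hK.aemeasurable_msleEst hZ.measurable (hZ.ae_pos h0) (bandwidth_pos hc hn) n ht.le
  · refine (hZ.msleEst_eq_naiveEst (p := p) (q' := q') hK hc ht htM (half_pos hδ) h0 ?_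
      (fun i x hx => (hwin x hx i).1) (fun i x hx => (hwin x hx i).2.continuousWithinAt)
      hp0 hp1 ?_ ?_ ?_ ?_ ?_ ?_).mono (Eventually.of_forall fun n ω hω => by rw [hω])
    · refine setIntegral_eq_zero_of_forall_eq_zero fun u hu => ?_
      rw [hq0, hF.cdf_eq_one (le_of_lt hu), sub_self, zero_mul]
    · rw [hqsum]
      exact hgt0
    · rw [hqsum, hq1, mul_div_cancel_right₀ _ hgt0.ne']
    · have : (1 - p) * q' 1 t - p * q' 0 t = f₀ t * g t := by
        simp only [q', zero_ne_one, if_false, if_true, ← hp]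
        ring
      rw [this]
      exact mul_pos hft0 hgt0
    · intro u hu
      have hu' := hmem u ⟨hu.1, hu.2.trans htM⟩
      rw [hdiff]
      exact mul_neg_of_neg_of_pos (sub_neg.2 (hmono hu' (hmem t ⟨ht, htM⟩) hu.2)) (hg0 u hu')
    · intro u hu
      have hu' := hmem u ⟨ht.trans hu.1, hu.2⟩
      rw [hdiff]
      exact mul_pos (sub_pos.2 (hmono (hmem t ⟨ht, htM⟩) hu' hu.1)) (hg0 u hu')
    · intro u hu
      rw [hdiff]
      exact mul_nonneg (sub_nonneg.2 (monotone_cdf μX hu.le)) (hG.density.nonneg u)
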